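/- \textbf{Conventions.} Let $\mathcal G$ be a context-free grammar with finite terminal alphabet $\Sigma$, finite nonterminal alphabet, finitely many productions, and a start symbol $S$ that is the left-hand side of exactly one production and occurs in no right-hand side. Let $\dashv\,\notin\Sigma$ be an end marker and $\Gamma=\Sigma\cup\{\dashv\}$. An \emph{LR parse} of $x\in\Sigma^*$ is the sequence of operations $\mathrm{Shift}(\sigma)$ (at the leaves) and $\mathrm{Reduce}(\Pi)$ (at the inner nodes) met in a postorder traversal of a parse tree of $x$ with root $S$. A \emph{partial LR parse} of $x_1\cdots x_s$ with lookahead $\lambda\in\Gamma^k$ is a sequence that, for some $y\in\Sigma^*$ such that $\lambda$ consists of the first $k$ symbols of $y\dashv^k$ and for some LR parse $\mathcal S$ of $x_1\cdots x_s\,y$, is the longest prefix of $\mathcal S$ with exactly $s$ shifts. The grammar is \emph{XLR}$(k,t)$ if for every $x\in\Sigma^*$ and every $\lambda\in\Gamma^k$ there are at most $t$ distinct partial LR parses of $x$ with lookahead $\lambda$. The \emph{stack-based XLR algorithm} is the usual stack-based LR parsing algorithm run on the canonical LR$(k)$ DFA of $\mathcal G$, which may have conflicts; a copy is forked whenever several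 actions are possible on the current lookahead (the first $k$ symbols of the unread input followed by $\dashv^k$), and a copy halts with success and returns its syntax tree if it reduces to $S$ at the end of the input. A copy is \emph{live} if it has not halted and has at least one action on its current lookahead. \textbf{Theorem (Efficient XLR Parsing).} Let $k,t\ge 0$ and let $\mathcal G$ be XLR$(k,t)$. 1. $\mathcal G$ can be parsed in linear time: there are a random access machine (unit cost; the only arithmetic operations are $\pm1$ and constant address offsets) and a constant $C$, depending on $\mathcal G$, $k$ and $t$ (and on the chosen numerical coding of terminals and productions), such that on every input $x\in\Sigma^*$ of length $n$ the machine halts after at most $C(n+1)$ instructions and outputs the number of parse trees of $x$ and a list of all of them, without repetition, each written as its LR parse. 2. On every input $x$, the runs of the stack-based XLR algorithm that halt with success are in bijection with the parse trees of $x$: a run with operation sequence $p$ returns the tree $P$ if and only if $P$ is a parse tree of $x$ and $p$ is its LR parse. There is a constant $C'$, depending only on $\mathcal G$, $k$ and $t$, such that every run on $x$ performs at most $C'(|x|+1)$ operations. 3. Let $x=x_1\cdots x_n$, let $0\le s\le n$, and let $\lambda$ be the first $k$ symbols of $x_{s+1}\cdots x_n\dashv^k$. A sequence $p$ is a partial LR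 parse of $x_1\cdots x_s$ with lookahead $\lambda$ if and only if either some run on $x$ has performed exactly the operations $p$, has not halted, has its cursor just after $x_s$, and has $\mathrm{Shift}$ among its actions on $\lambda$; or $\lambda=\dashv^k$, $p$ is an LR parse of $x_1\cdots x_s$, and some run on $x$ performs $p$. The operation sequence of every live copy with cursor just after $x_s$ is a prefix of a partial LR parse of $x_1\cdots x_s$ with lookahead $\lambda$. 4. Consequently the algorithm never has more than $t$ live copies at any cursor position: every set of live copies with cursor just after $x_s$ in which none is a continuation of another has at most $t$ elements. -/

import Mathlib

namespace XLR

/-! ### Grammars, parse trees and LR parses -/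

section Grammar

variable {T : Type}

/-- The standing normal form: the start symbol is the left-hand side of exactly one production and
occurs in no right-hand side. -/
def StartNormal (G : ContextFreeGrammar T) : Prop :=
  (∃! r, r ∈ G.rules ∧ r.input = G.initial) ∧
    ∀ r ∈ G.rules, Symbol.nonterminal G.initial ∉ r.output

/-- Ordered trees whose leaves carry terminals and whose inner nodes carry productions. -/
inductive ParseTree (T N : Type) : Type
  | leaf (a : T) : ParseTree T N
  | node (r : ContextFreeRule T N) (children : List (ParseTree T N)) : ParseTree T N

/-- The operations `Shift(σ)` and `Reduce(Π)` of an LR parse. -/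
inductive LROp (T N : Type) : Type
  | shift (a : T) : LROp T N
  | reduce (r : ContextFreeRule T N) : LROp T N

/-- The symbol at the root. -/
def ParseTree.root {N : Type} : ParseTree T N → Symbol T N
  | .leaf a => .terminal a
  | .node r _ => .nonterminal r.input

mutual
/-- The operations met in a postorder traversal. -/
def ParseTree.postorder {N : Type} : ParseTree T N → List (LROp T N)
  | .leaf a => [.shift a]
  | .node r cs => ParseTree.postorderForest cs ++ [.reduce r]
/-- Concatenation of the postorder traversals of a list of trees. -/
def ParseTree.postorderForest {N : Type} : List (ParseTree T N) → List (LROp T N)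
  | [] => []
  | c :: cs => ParseTree.postorder c ++ ParseTree.postorderForest cs
end

mutual
/-- The terminal string at the leaves, from left to right. -/
def ParseTree.yield {N : Type} : ParseTree T N → List T
  | .leaf a => [a]
  | .node _ cs => ParseTree.yieldForest cs
/-- Concatenation of the yields of a list of trees. -/
def ParseTree.yieldForest {N : Type} : List (ParseTree T N) → List T
  | [] => []
  | c :: cs => ParseTree.yield c ++ ParseTree.yieldForest cs
end

/-- Every inner node carries a production of `G`, and its children are labelled, in order, by the
right-hand side of that production. -/
inductive ParseTree.Valid (G : ContextFreeGrammar T) : ParseTree T G.NT → Prop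
  | leaf (a : T) : ParseTree.Valid G (.leaf a)
  | node (r : ContextFreeRule T G.NT) (cs : List (ParseTree T G.NT)) (hr : r ∈ G.rules)
      (hroot : cs.map ParseTree.root = r.output) (hcs : ∀ c ∈ cs, ParseTree.Valid G c) :
      ParseTree.Valid G (.node r cs)

/-- `P` is a parse tree of `x` for the start symbol of `G`. -/
def IsParseTree (G : ContextFreeGrammar T) (x : List T) (P : ParseTree T G.NT) : Prop :=
  P.Valid G ∧ P.root = Symbol.nonterminal G.initial ∧ P.yield = x

/-- `p` is an LR parse of `x` for the start symbol of `G`. -/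
def IsLRParse (G : ContextFreeGrammar T) (x : List T) (p : List (LROp T G.NT)) : Prop :=
  ∃ P : ParseTree T G.NT, IsParseTree G x P ∧ p = P.postorder

/-- The number of `Shift` operations in a sequence. -/
def numShifts {N : Type} : List (LROp T N) → ℕ
  | [] => 0
  | .shift _ :: p => numShifts p + 1
  | .reduce _ :: p => numShifts p

/-- `p` is the longest prefix of `q` that includes exactly `s` `Shift` operations. -/
def IsLongestPrefix {N : Type} (s : ℕ) (p q : List (LROp T N)) : Prop :=
  p <+: q ∧ numShifts p = s ∧ ∀ p' : List (LROp T N), p' <+: q → numShifts p' = s → p' <+: p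

/-- The first `k` symbols of `y ⊣ᵏ`. The extended terminal alphabet is `Option T`, where `none` is
the end marker `⊣`. -/
def lookahead (k : ℕ) (y : List T) : List (Option T) :=
  (y.map some ++ List.replicate k none).take k

/-- `p` is a partial LR parse of `x` with lookahead `l`. -/
def IsPartialLRParse (G : ContextFreeGrammar T) (k : ℕ) (x : List T) (l : List (Option T))
    (p : List (LROp T G.NT)) : Prop :=
  ∃ (y : List T) (q : List (LROp T G.NT)),
    lookahead k y = l ∧ IsLRParse G (x ++ y) q ∧ IsLongestPrefix x.length p q

/-- The grammar `G` is XLR(`k`, `t`). -/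
def IsXLR (G : ContextFreeGrammar T) (k t : ℕ) : Prop :=
  ∀ (x : List T) (l : List (Option T)), l.length = k →
    {p | IsPartialLRParse G k x l p}.encard ≤ t

end Grammar

/-! ### The canonical LR(`k`) automata -/

section Automaton

variable {T : Type}

/-- `First_k(Gen(β l))`. -/
def firstGen (G : ContextFreeGrammar T) (k : ℕ) (β : List (Symbol T G.NT)) (l : List (Option T)) :
    Set (List (Option T)) :=
  {m | ∃ y : List T, G.Derives β (y.map Symbol.terminal) ∧ m = (y.map some ++ l).take k}

/-- The strings of length `k` over the extended alphabet that can follow the nonterminal `X` in a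
derivation from the start symbol. -/
def followStrings (G : ContextFreeGrammar T) (k : ℕ) (X : G.NT) : Set (List (Option T)) :=
  {m | ∃ u v : List (Symbol T G.NT),
    G.Derives [Symbol.nonterminal G.initial] (u ++ [Symbol.nonterminal X] ++ v) ∧
      m ∈ firstGen G k v (List.replicate k none)}

/-- A dotted production `X → pre · post` together with a follow string. -/
structure LRItem (T N : Type) : Type where
  rule : ContextFreeRule T N
  pre : List (Symbol T N)
  post : List (Symbol T N)
  look : List (Option T)

/-- The vertices of the canonical LR(`k`) NFA. -/
def LRItem.IsVertex (G : ContextFreeGrammar T) (k : ℕ) (v : LRItem T G.NT) : Prop :=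
  v.rule ∈ G.rules ∧ v.rule.output = v.pre ++ v.post ∧ v.look ∈ followStrings G k v.rule.input

/-- The edges of the canonical LR(`k`) NFA; the label `none` stands for `ε`. -/
inductive LREdge (G : ContextFreeGrammar T) (k : ℕ) :
    LRItem T G.NT → Option (Symbol T G.NT) → LRItem T G.NT → Prop
  /-- prediction edge from `X → α · Y β` to `Y → · γ` -/
  | predict (v w : LRItem T G.NT) (β : List (Symbol T G.NT))
      (hv : v.IsVertex G k) (hw : w.IsVertex G k)
      (hpost : v.post = Symbol.nonterminal w.rule.input :: β) (hpre : w.pre = [])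
      (hlook : w.look ∈ firstGen G k β v.look) : LREdge G k v none w
  /-- step edge from `X → α · τ β` to `X → α τ · β` -/
  | step (v w : LRItem T G.NT) (τ : Symbol T G.NT)
      (hv : v.IsVertex G k) (hw : w.IsVertex G k) (hrule : w.rule = v.rule)
      (hpost : v.post = τ :: w.post) (hpre : w.pre = v.pre ++ [τ]) (hlook : w.look = v.look) :
      LREdge G k v (some τ) w

/-- The two kinds of parsing actions. -/
inductive LRAction (T N : Type) : Type
  | shift : LRAction T N
  | reduce (r : ContextFreeRule T N) : LRAction T N

/-- `HasAction G k v l a`: the action `a` is associated with the vertex `v` on lookahead `l`. -/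
inductive HasAction (G : ContextFreeGrammar T) (k : ℕ) :
    LRItem T G.NT → List (Option T) → LRAction T G.NT → Prop
  | reduce (v : LRItem T G.NT) (hv : v.IsVertex G k) (hpost : v.post = []) :
      HasAction G k v v.look (.reduce v.rule)
  | shift (v : LRItem T G.NT) (l : List (Option T)) (a : T) (β : List (Symbol T G.NT))
      (hv : v.IsVertex G k) (hpost : v.post = Symbol.terminal a :: β)
      (hl : l ∈ firstGen G k v.post v.look) : HasAction G k v l .shift

/-- The canonical LR(`k`) NFA. The vertices that have an action on some lookahead are marked as
accepting. -/
def lrNFA (G : ContextFreeGrammar T) (k : ℕ) : εNFA (Symbol T G.NT) (LRItem T G.NT) where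
  step v τ := {w | LREdge G k v τ w}
  start := {v | v.IsVertex G k ∧ v.rule.input = G.initial ∧ v.pre = [] ∧
    v.look = List.replicate k none}
  accept := {v | ∃ l a, HasAction G k v l a}

/-- The start vertex of the canonical LR(`k`) DFA, which is the subset construction applied to the
NFA: its vertices are sets of NFA vertices. -/
def dfaStart (G : ContextFreeGrammar T) (k : ℕ) : Set (LRItem T G.NT) :=
  (lrNFA G k).εClosure (lrNFA G k).start

/-- The vertex of the canonical LR(`k`) DFA reached from `v` by the edge labelled `τ`. -/
def dfaStep (G : ContextFreeGrammar T) (k : ℕ) (v : Set (LRItem T G.NT)) (τ : Symbol T G.NT) :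
    Set (LRItem T G.NT) :=
  (lrNFA G k).stepSet v τ

end Automaton

/-! ### The stack-based XLR parsing algorithm -/

section Algorithm

variable {T : Type}

/-- A configuration of one copy of the algorithm: the state stack and the syntax stack (tops first)
and the part of the input at and after the cursor. -/
structure Config (G : ContextFreeGrammar T) : Type where
  states : List (Set (LRItem T G.NT))
  syn : List (ParseTree T G.NT)
  rest : List T

/-- The status of a copy. -/
inductive Outcome (G : ContextFreeGrammar T) : Type
  | running (c : Config G) : Outcome G
  | success (P : ParseTree T G.NT) : Outcome G
  | failure : Outcome G

/-- The actions available to a copy: those of the vertex on top of the state stack on the current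
lookahead. -/
def Config.actions {G : ContextFreeGrammar T} (k : ℕ) (c : Config G) : Set (LRAction T G.NT) :=
  {a | ∃ v S, c.states = S :: v ∧ ∃ w ∈ S, HasAction G k w (lookahead k c.rest) a}

open Classical in
/-- The second half of a round, with current buffer symbol `α`: halt if `α` is the start symbol,
otherwise follow the edge labelled `α` from the top of the state stack. -/
noncomputable def Config.advance {G : ContextFreeGrammar T} (k : ℕ) (c : Config G)
    (α : Symbol T G.NT) : Outcome G :=
  if α = Symbol.nonterminal G.initial then
    match c.rest, c.syn with
    | [], P :: _ => .success P
    | _, _ => .failure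
  else
    match c.states with
    | [] => .failure
    | S :: v => .running { c with states := dfaStep G k S α :: S :: v }

/-- One round of a copy that has chosen the given action. -/
noncomputable def Config.act {G : ContextFreeGrammar T} (k : ℕ) (c : Config G) :
    LRAction T G.NT → Outcome G
  | .shift =>
    match c.rest with
    | [] => .failure
    | a :: y => Config.advance k ⟨c.states, .leaf a :: c.syn, y⟩ (Symbol.terminal a)
  | .reduce r =>
    Config.advance k
      ⟨c.states.drop r.output.length,
        .node r (c.syn.take r.output.length).reverse :: c.syn.drop r.output.length, c.rest⟩
      (Symbol.nonterminal r.input)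

/-- The shift/reduce operation performed in such a round (none if the copy tries to shift past the
end of the input). -/
def Config.op {G : ContextFreeGrammar T} (c : Config G) : LRAction T G.NT → List (LROp T G.NT)
  | .shift =>
    match c.rest with
    | [] => []
    | a :: _ => [.shift a]
  | .reduce r => [.reduce r]

/-- `Run G k x p o`: on input `x`, some run of the stack-based XLR algorithm over the canonical
LR(`k`) DFA, with nondeterministic choice among conflicting actions, has performed exactly the
operations `p` and then has status `o`. -/
inductive Run (G : ContextFreeGrammar T) (k : ℕ) (x : List T) :
    List (LROp T G.NT) → Outcome G → Prop
  | init : Run G k x [] (.running ⟨[dfaStart G k], [], x⟩)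
  | step (p : List (LROp T G.NT)) (c : Config G) (a : LRAction T G.NT)
      (h : Run G k x p (.running c)) (ha : a ∈ c.actions k) : Run G k x (p ++ c.op a) (c.act k a)
  | noAction (p : List (LROp T G.NT)) (c : Config G)
      (h : Run G k x p (.running c)) (ha : c.actions k = ∅) : Run G k x p .failure

/-- `LiveAt G k x s p`: on input `x`, the copy of the algorithm that has performed the operations
`p` is live (it has not halted, and has an action on the current lookahead), with exactly `s` input
symbols before its cursor. -/
def LiveAt (G : ContextFreeGrammar T) (k : ℕ) (x : List T) (s : ℕ) (p : List (LROp T G.NT)) :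
    Prop :=
  ∃ c : Config G, Run G k x p (.running c) ∧ c.rest = x.drop s ∧ (c.actions k).Nonempty

/-- As `LiveAt`, and moreover `Shift` is one of the actions on the current lookahead. -/
def ShiftReadyAt (G : ContextFreeGrammar T) (k : ℕ) (x : List T) (s : ℕ)
    (p : List (LROp T G.NT)) : Prop :=
  ∃ c : Config G, Run G k x p (.running c) ∧ c.rest = x.drop s ∧ LRAction.shift ∈ c.actions k

end Algorithm

/-! ### Random access machines

The only arithmetic is `± 1` (and constant address offsets), so in `m` steps no number exceeds the
largest number of the input and the program by more than `O(m)`, and unit cost is realistic. -/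

section Machine

/-- Instructions of a random access machine with program labels `Q`. Registers are numbered by `ℕ`
(a finite program uses finitely many), and so are the cells of the memory. -/
inductive Instr (Q : Type) : Type
  /-- `R[r] := c` -/
  | set (r c : ℕ) (next : Q) : Instr Q
  /-- `R[r] := R[r']` -/
  | copy (r r' : ℕ) (next : Q) : Instr Q
  /-- `R[r] := R[r] + 1` -/
  | inc (r : ℕ) (next : Q) : Instr Q
  /-- `R[r] := R[r] - 1` (and `0` stays `0`) -/
  | dec (r : ℕ) (next : Q) : Instr Q
  /-- `R[r] := M[R[a] + d]` -/
  | load (r a d : ℕ) (next : Q) : Instr Q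
  /-- `M[R[a] + d] := R[r]` -/
  | store (a d r : ℕ) (next : Q) : Instr Q
  /-- go to `yes` if `R[r] = R[r']`, and to `no` otherwise -/
  | ifEq (r r' : ℕ) (yes no : Q) : Instr Q
  /-- stop -/
  | halt : Instr Q

/-- A program: finitely many labelled instructions. -/
structure Program : Type 1 where
  Label : Type
  finite_label : Finite Label
  start : Label
  code : Label → Instr Label

/-- A state of the machine: the program counter, the registers and the memory. -/
structure MState (M : Program) : Type where
  pc : M.Label
  reg : ℕ → ℕ
  mem : ℕ → ℕ

/-- The execution of one instruction. -/
def Program.step (M : Program) (σ : MState M) : MState M :=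
  match M.code σ.pc with
  | .set r c q => ⟨q, Function.update σ.reg r c, σ.mem⟩
  | .copy r r' q => ⟨q, Function.update σ.reg r (σ.reg r'), σ.mem⟩
  | .inc r q => ⟨q, Function.update σ.reg r (σ.reg r + 1), σ.mem⟩
  | .dec r q => ⟨q, Function.update σ.reg r (σ.reg r - 1), σ.mem⟩
  | .load r a d q => ⟨q, Function.update σ.reg r (σ.mem (σ.reg a + d)), σ.mem⟩
  | .store a d r q => ⟨q, σ.reg, Function.update σ.mem (σ.reg a + d) (σ.reg r)⟩
  | .ifEq r r' q q' => ⟨if σ.reg r = σ.reg r' then q else q', σ.reg, σ.mem⟩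
  | .halt => σ

/-- The initial state on the input word `w`: the entries of `w`, each increased by one, stand in the
memory cells `0, 1, …`, and everything else is `0`. -/
def Program.init (M : Program) (w : List ℕ) : MState M :=
  ⟨M.start, fun _ => 0, fun i => (w[i]?.map (· + 1)).getD 0⟩

/-- On input `w`, the program halts after at most `m` instructions with the number `c` in register
`0` and the word `z` in consecutive memory cells, beginning with the one whose address is in
register `1`. -/
def Program.Outputs (M : Program) (w : List ℕ) (m c : ℕ) (z : List ℕ) : Prop :=
  ∃ m' ≤ m, let σ := M.step^[m'] (M.init w)
    M.code σ.pc = .halt ∧ σ.reg 0 = c ∧ ∀ i (hi : i < z.length), σ.mem (σ.reg 1 + i) = z[i]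

end Machine

section Parsing

variable {T : Type}

/-- The code of an operation, for given numberings of the terminals and the productions. -/
def opCode {N : Type} (encT : T → ℕ) (encR : ContextFreeRule T N → ℕ) : LROp T N → ℕ
  | .shift a => 2 * encT a + 1
  | .reduce r => 2 * encR r + 2

/-- A list of parse trees as a word: each tree is written as its LR parse, followed by a `0`. -/
def treesCode {N : Type} (encT : T → ℕ) (encR : ContextFreeRule T N → ℕ)
    (L : List (ParseTree T N)) : List ℕ :=
  L.flatMap fun P => P.postorder.map (opCode encT encR) ++ [0]

/-- The grammar `G` can be parsed in linear time: for all numberings of its terminals and its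
productions there are a random access machine and a constant `C` such that, for every input string
`x`, the machine halts after at most `C (|x| + 1)` instructions, and outputs the number of parse
trees of `x` and a list of all of them without repetition. -/
def LinearTimeParsable (G : ContextFreeGrammar T) : Prop :=
  ∀ (encT : T → ℕ) (encR : ContextFreeRule T G.NT → ℕ), Function.Injective encT →
    Set.InjOn encR {r | r ∈ G.rules} →
    ∃ (M : Program) (C : ℕ), ∀ x : List T, ∃ L : List (ParseTree T G.NT),
      L.Nodup ∧ (∀ P, P ∈ L ↔ IsParseTree G x P) ∧
      M.Outputs (x.map encT) (C * (x.length + 1)) L.length (treesCode encT encR L)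

end Parsing

end XLR

namespace XLR

/-! ### Forests -/

section Forests

variable {T : Type}

-- The link between runs and trees is a forest. A copy that has performed the operations `p` holds
-- on its syntax stack a forest of valid trees whose postorder is `p` and whose yield is the input
-- read so far; postorder is injective on valid forests, so operation sequences and forests are
-- interchangeable. Soundness (`Run.status`) and completeness (`run_success_of_isParseTree`) give
-- the bijection between successful runs and parse trees. The viable prefix property
-- (`itemContext_of_mem_eval`, `exists_parse_of_action`) says more: an action available on a
-- lookahead is the next operation of an LR parse of some continuation with that lookahead. So every
-- live copy is a prefix of a partial LR parse. Since a continuation matters only through its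
-- lookahead (`Run.congr_rest`), partial LR parses are in turn reached by runs on the actual input.
-- Incomparable live copies extend to different partial LR parses, which gives the bound `t`.
--
-- The linear bound on a run is a pumping argument. For fixed input and lookahead there are finitely
-- many partial LR parses, so live forests with a given yield have bounded size
-- (`exists_length_bound`). Hence no tree of a live forest properly contains a tree with the same
-- root and the same yield, and no nonempty block of trees with empty yield leads from an automaton
-- state to itself, because either could be repeated at will. The first restriction makes each tree
-- linear in its yield, up to a constant (`TreeReduced.length_le`); the second bounds the number of
-- trees on the stack by pigeonhole (`exists_stack_bound`).
--
-- For linear time the copies are not simulated operation by operation. State stacks live in memory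
-- as linked cells that share their tails, and each cell carries a table: for a symbol `Y` and a
-- lookahead `l`, the list of all ways to continue by reductions, after `Y` is pushed on this stack,
-- until a shift or acceptance. Such a list has at most `t` entries, because they extend one
-- operation sequence to distinct partial LR parses (`ListSpec.length_le`). Reductions that do not
-- pop the top state of the cell form finitely many sequences, known when the program is written
-- (`vred_finite`); once this state is popped, the remaining reductions are an entry in the table of
-- a deeper cell at bounded distance (`listSpec_vouts`). So a push takes constant time, and so does
-- an input symbol, there being at most `t` copies.
--
-- Operation sequences are kept as ropes, which are joined in constant time. At the end the ropes of
-- the accepted copies are flattened in time linear in their length (`flatten_tri`), which is linear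
-- in the input by the bound on runs. The program is written in a small structured language and
-- compiled with its finitely many continuations as labels (`Cmd.view_step`).

theorem postorderForest_append {N : Type} (fs gs : List (ParseTree T N)) :
    ParseTree.postorderForest (fs ++ gs) =
      ParseTree.postorderForest fs ++ ParseTree.postorderForest gs := by
  induction fs with
  | nil => simp [ParseTree.postorderForest]
  | cons c cs ih => simp [ParseTree.postorderForest, ih]

theorem yieldForest_append {N : Type} (fs gs : List (ParseTree T N)) :
    ParseTree.yieldForest (fs ++ gs) =
      ParseTree.yieldForest fs ++ ParseTree.yieldForest gs := by
  induction fs with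
  | nil => simp [ParseTree.yieldForest]
  | cons c cs ih => simp [ParseTree.yieldForest, ih]

theorem postorderForest_singleton {N : Type} (c : ParseTree T N) :
    ParseTree.postorderForest [c] = c.postorder := by
  simp [ParseTree.postorderForest]

/-- All trees of the forest are valid. -/
def ForestValid (G : ContextFreeGrammar T) (fs : List (ParseTree T G.NT)) : Prop :=
  ∀ c ∈ fs, c.Valid G

theorem ForestValid.append {G : ContextFreeGrammar T} {fs gs : List (ParseTree T G.NT)}
    (hf : ForestValid G fs) (hg : ForestValid G gs) : ForestValid G (fs ++ gs) := by
  intro c hc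
  rcases List.mem_append.1 hc with h | h
  exacts [hf c h, hg c h]

theorem ForestValid.nil {G : ContextFreeGrammar T} : ForestValid G [] := by
  intro c hc; simp at hc

theorem ForestValid.singleton {G : ContextFreeGrammar T} {c : ParseTree T G.NT}
    (hc : c.Valid G) : ForestValid G [c] := by
  intro d hd; simp at hd; exact hd ▸ hc

theorem ForestValid.reverse {G : ContextFreeGrammar T} {fs : List (ParseTree T G.NT)}
    (hf : ForestValid G fs) : ForestValid G fs.reverse := by
  intro c hc; exact hf c (by simpa using hc)

theorem derives_of_append {G : ContextFreeGrammar T} {a a' b b' : List (Symbol T G.NT)}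
    (ha : G.Derives a a') (hb : G.Derives b b') : G.Derives (a ++ b) (a' ++ b') :=
  (ha.append_right b).trans (hb.append_left a')

theorem derives_forest_of_forall {G : ContextFreeGrammar T} {fs : List (ParseTree T G.NT)}
    (h : ∀ c ∈ fs, G.Derives [c.root] (c.yield.map Symbol.terminal)) :
    G.Derives (fs.map ParseTree.root) ((ParseTree.yieldForest fs).map Symbol.terminal) := by
  induction fs with
  | nil => simpa [ParseTree.yieldForest] using ContextFreeGrammar.Derives.refl _
  | cons c cs ih =>
    have h1 := h c (by simp)
    have h2 := ih fun d hd => h d (by simp [hd])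
    have := derives_of_append h1 h2
    simpa [ParseTree.yieldForest] using this

theorem ParseTree.Valid.derives {G : ContextFreeGrammar T} {c : ParseTree T G.NT}
    (hc : c.Valid G) : G.Derives [c.root] (c.yield.map Symbol.terminal) := by
  induction hc with
  | leaf a => simpa [ParseTree.root, ParseTree.yield] using ContextFreeGrammar.Derives.refl _
  | node r cs hr hroot hcs ih =>
    have h := derives_forest_of_forall ih
    rw [hroot] at h
    refine ContextFreeGrammar.Produces.trans_derives ⟨r, hr, ?_⟩
      (by simpa [ParseTree.yield] using h)
    exact ContextFreeRule.Rewrites.input_output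

theorem ForestValid.derives {G : ContextFreeGrammar T} {fs : List (ParseTree T G.NT)}
    (hf : ForestValid G fs) :
    G.Derives (fs.map ParseTree.root) ((ParseTree.yieldForest fs).map Symbol.terminal) :=
  derives_forest_of_forall fun c hc => (hf c hc).derives

theorem exists_forest_of_terminals (G : ContextFreeGrammar T) (y : List T) :
    ∃ fs : List (ParseTree T G.NT), ForestValid G fs ∧
      fs.map ParseTree.root = y.map Symbol.terminal ∧ ParseTree.yieldForest fs = y := by
  induction y with
  | nil => exact ⟨[], ForestValid.nil, rfl, rfl⟩
  | cons a y ih =>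
    obtain ⟨fs, h1, h2, h3⟩ := ih
    refine ⟨.leaf a :: fs, ?_, by simp [ParseTree.root, h2], by
      simp [ParseTree.yieldForest, ParseTree.yield, h3]⟩
    exact (ForestValid.singleton (.leaf a)).append h1

/-- Induction from the front of the derivation: given a forest for the string after the first
rewriting step, the trees over the rewritten right-hand side become the children of one new node. -/
theorem exists_forest_of_derives {G : ContextFreeGrammar T} {α : List (Symbol T G.NT)} {y : List T}
    (h : G.Derives α (y.map Symbol.terminal)) :
    ∃ fs : List (ParseTree T G.NT), ForestValid G fs ∧
      fs.map ParseTree.root = α ∧ ParseTree.yieldForest fs = y := by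
  induction h using Relation.ReflTransGen.head_induction_on with
  | refl => exact exists_forest_of_terminals G y
  | head hp _ ih =>
    obtain ⟨fs, hv, hr, hy⟩ := ih
    obtain ⟨r, hrG, hrw⟩ := hp
    obtain ⟨p, q, rfl, rfl⟩ := hrw.exists_parts
    obtain ⟨f12, f3, rfl, h12, h3⟩ := List.map_eq_append_iff.1 hr
    obtain ⟨f1, f2, rfl, h1, h2⟩ := List.map_eq_append_iff.1 h12
    refine ⟨f1 ++ [.node r f2] ++ f3, ?_, by simp [h1, h3, ParseTree.root], ?_⟩
    · intro c hc
      simp only [List.mem_append, List.mem_singleton] at hc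
      rcases hc with (hc | rfl) | hc
      · exact hv c (by simp [hc])
      · exact .node r f2 hrG h2 fun d hd => hv d (by simp [hd])
      · exact hv c (by simp [hc])
    · rw [← hy]
      simp [yieldForest_append, ParseTree.yieldForest, ParseTree.yield]

/-- Rebuild a stack of trees (top first) by performing shift and reduce operations. -/
def rebuild {N : Type} : List (LROp T N) → List (ParseTree T N) → List (ParseTree T N)
  | [], st => st
  | .shift a :: p, st => rebuild p (.leaf a :: st)
  | .reduce r :: p, st =>
    rebuild p (.node r (st.take r.output.length).reverse :: st.drop r.output.length)

theorem rebuild_append {N : Type} (p q : List (LROp T N)) (st : List (ParseTree T N)) :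
    rebuild (p ++ q) st = rebuild q (rebuild p st) := by
  induction p generalizing st with
  | nil => rfl
  | cons o p ih => cases o <;> simp [rebuild, ih]

theorem rebuild_postorderForest_of_forall {N : Type} {fs : List (ParseTree T N)}
    (h : ∀ c ∈ fs, ∀ st, rebuild c.postorder st = c :: st) (st : List (ParseTree T N)) :
    rebuild (ParseTree.postorderForest fs) st = fs.reverse ++ st := by
  induction fs generalizing st with
  | nil => simp [ParseTree.postorderForest, rebuild]
  | cons c cs ih =>
    simp [ParseTree.postorderForest, rebuild_append, h c (by simp),
      ih (fun d hd => h d (by simp [hd]))]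

/-- A stack machine inverts postorder: when `reduce r` arrives, the children are the top
`r.output.length` entries, because validity ties their number to the right-hand side. -/
theorem ParseTree.Valid.rebuild {G : ContextFreeGrammar T} {c : ParseTree T G.NT}
    (hc : c.Valid G) : ∀ st, rebuild c.postorder st = c :: st := by
  induction hc with
  | leaf a => intro st; simp [ParseTree.postorder, XLR.rebuild]
  | node r cs hr hroot hcs ih =>
    intro st
    have hlen : r.output.length = cs.reverse.length := by simp [← hroot]
    simp only [ParseTree.postorder, rebuild_append, rebuild_postorderForest_of_forall ih,
      XLR.rebuild, hlen, List.take_left, List.drop_left, List.reverse_reverse]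

/-- Both forests are the stack rebuilt from the common sequence. This is what allows an operation
sequence to identify the forest on the syntax stack. -/
theorem ForestValid.postorder_injective {G : ContextFreeGrammar T}
    {fs gs : List (ParseTree T G.NT)} (hf : ForestValid G fs) (hg : ForestValid G gs)
    (h : ParseTree.postorderForest fs = ParseTree.postorderForest gs) : fs = gs := by
  have h1 := rebuild_postorderForest_of_forall (fun c hc => (hf c hc).rebuild) []
  have h2 := rebuild_postorderForest_of_forall (fun c hc => (hg c hc).rebuild) []
  rw [h, h2] at h1
  simpa using h1.symm

theorem ParseTree.Valid.postorder_injective {G : ContextFreeGrammar T}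
    {P Q : ParseTree T G.NT} (hP : P.Valid G) (hQ : Q.Valid G)
    (h : P.postorder = Q.postorder) : P = Q := by
  have := ForestValid.postorder_injective (ForestValid.singleton hP) (ForestValid.singleton hQ)
    (by simpa [postorderForest_singleton] using h)
  simpa using this

theorem numShifts_append {N : Type} (p q : List (LROp T N)) :
    numShifts (p ++ q) = numShifts p + numShifts q := by
  induction p with
  | nil => simp [numShifts]
  | cons o p ih => cases o <;> (simp [numShifts, ih]; try omega)

theorem numShifts_postorderForest_of_forall {N : Type} {fs : List (ParseTree T N)}
    (h : ∀ c ∈ fs, numShifts c.postorder = c.yield.length) :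
    numShifts (ParseTree.postorderForest fs) = (ParseTree.yieldForest fs).length := by
  induction fs with
  | nil => simp [ParseTree.postorderForest, ParseTree.yieldForest, numShifts]
  | cons c cs ih =>
    simp [ParseTree.postorderForest, ParseTree.yieldForest, numShifts_append, h c (by simp),
      ih (fun d hd => h d (by simp [hd]))]

theorem ParseTree.Valid.numShifts {G : ContextFreeGrammar T} {c : ParseTree T G.NT}
    (hc : c.Valid G) : numShifts c.postorder = c.yield.length := by
  induction hc with
  | leaf a => simp [ParseTree.postorder, ParseTree.yield, XLR.numShifts]
  | node r cs hr hroot hcs ih =>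
    simp [ParseTree.postorder, ParseTree.yield, numShifts_append,
      numShifts_postorderForest_of_forall ih, XLR.numShifts]

theorem ForestValid.numShifts {G : ContextFreeGrammar T} {fs : List (ParseTree T G.NT)}
    (hf : ForestValid G fs) :
    numShifts (ParseTree.postorderForest fs) = (ParseTree.yieldForest fs).length :=
  numShifts_postorderForest_of_forall fun c hc => (hf c hc).numShifts

end Forests

/-! ### Lookaheads -/

section Lookahead

variable {T : Type}

theorem lookahead_length (k : ℕ) (y : List T) : (lookahead k y).length = k := by
  simp [lookahead]

theorem lookahead_nil (k : ℕ) : lookahead k ([] : List T) = List.replicate k none := by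
  simp [lookahead]

theorem take_append_take {α : Type*} (k : ℕ) (u v : List α) :
    (u ++ v.take k).take k = (u ++ v).take k := by
  rw [List.take_append, List.take_append, List.take_take]
  congr 2; omega

theorem lookahead_append (k : ℕ) (u v : List T) :
    lookahead k (u ++ v) = (u.map some ++ lookahead k v).take k := by
  simp [lookahead, take_append_take]

theorem lookahead_append_congr {k : ℕ} (u : List T) {v w : List T}
    (h : lookahead k v = lookahead k w) : lookahead k (u ++ v) = lookahead k (u ++ w) := by
  rw [lookahead_append, lookahead_append, h]

theorem lookahead_mem_firstGen {G : ContextFreeGrammar T} {k : ℕ} {β : List (Symbol T G.NT)}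
    {y z : List T} (h : G.Derives β (y.map Symbol.terminal)) :
    lookahead k (y ++ z) ∈ firstGen G k β (lookahead k z) :=
  ⟨y, h, lookahead_append k y z⟩

theorem firstGen_append {G : ContextFreeGrammar T} {k : ℕ} {β γ : List (Symbol T G.NT)}
    {l m n : List (Option T)} (hm : m ∈ firstGen G k β l) (hl : l ∈ firstGen G k γ n) :
    m ∈ firstGen G k (β ++ γ) n := by
  obtain ⟨y, hy, rfl⟩ := hm
  obtain ⟨z, hz, rfl⟩ := hl
  refine ⟨y ++ z, by simpa using derives_of_append hy hz, ?_⟩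
  rw [take_append_take]; simp

end Lookahead

/-! ### Items of the automaton -/

section Items

variable {T : Type} {G : ContextFreeGrammar T} {k : ℕ}

/-- The context provided by an item `w` reached along `γ`: every forest along `γ`, completed by a
forest for the rest of the item, is part of a parse tree. -/
structure ItemContext (G : ContextFreeGrammar T) (k : ℕ) (γ : List (Symbol T G.NT))
    (w : LRItem T G.NT) : Prop where
  vertex : w.IsVertex G k
  stem : ∃ δ, γ = δ ++ w.pre ∧ (w.rule.input = G.initial → δ = [])
  look_initial : w.rule.input = G.initial → w.look = List.replicate k none
  complete : ∃ (z : List T) (tail : List (LROp T G.NT)), lookahead k z = w.look ∧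
    ∀ fs gs : List (ParseTree T G.NT), ForestValid G fs → ForestValid G gs →
      fs.map ParseTree.root = γ → gs.map ParseTree.root = w.post →
      ∃ P, IsParseTree G (ParseTree.yieldForest fs ++ ParseTree.yieldForest gs ++ z) P ∧
        P.postorder = ParseTree.postorderForest fs ++ ParseTree.postorderForest gs ++
          .reduce w.rule :: tail

theorem ItemContext.of_start {w : LRItem T G.NT} (hw : w ∈ (lrNFA G k).start) :
    ItemContext G k [] w := by
  obtain ⟨hv, hin, hpre, hlook⟩ := hw
  refine ⟨hv, ⟨[], by simp [hpre], fun _ => rfl⟩, fun _ => hlook, [], [], ?_, ?_⟩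
  · rw [lookahead_nil, hlook]
  · intro fs gs hf hg hfr hgr
    obtain rfl : fs = [] := by simpa using hfr
    refine ⟨.node w.rule gs, ⟨.node _ _ hv.1 ?_ hg, ?_, ?_⟩, ?_⟩
    · rw [hgr, hv.2.1, hpre]; rfl
    · simp [ParseTree.root, hin]
    · simp [ParseTree.yield, ParseTree.yieldForest]
    · simp [ParseTree.postorder, ParseTree.postorderForest]

/-- A tree for the production of `w` followed by a forest `hs` for `β` is a completion of the item
`v`. Choosing `hs` to realise the follow string of `w` gives the terminal continuation exactly that
lookahead. -/
theorem ItemContext.predict (hG : StartNormal G) {γ : List (Symbol T G.NT)} {v w : LRItem T G.NT}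
    (hv : ItemContext G k γ v) (h : LREdge G k v none w) : ItemContext G k γ w := by
  cases h with
  | predict _ β hvv hwv hpost hpre hlook =>
    -- The start symbol occurs in no right-hand side, so it is never predicted and the conditions on
    -- start items are vacuous for `w`.
    have hne : w.rule.input ≠ G.initial := by
      intro he
      apply hG.2 v.rule hvv.1
      rw [hvv.2.1, hpost, he]; simp
    obtain ⟨z, tail, hz, hc⟩ := hv.complete
    obtain ⟨y, hy, hly⟩ := hlook
    obtain ⟨hs, hhv, hhr, hhy⟩ := exists_forest_of_derives hy
    refine ⟨hwv, ⟨γ, by simp [hpre], fun h => absurd h hne⟩, fun h => absurd h hne,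
      y ++ z, ParseTree.postorderForest hs ++ .reduce v.rule :: tail, ?_, ?_⟩
    · rw [lookahead_append, hz, hly]
    · intro fs gs hf hg hfr hgr
      obtain ⟨P, hP, hPo⟩ := hc fs (.node w.rule gs :: hs) hf
        (ForestValid.append (ForestValid.singleton (.node _ _ hwv.1
          (by rw [hgr, hwv.2.1, hpre]; rfl) hg)) hhv) hfr (by simp [ParseTree.root, hhr, hpost])
      refine ⟨P, ?_, ?_⟩
      · simpa [ParseTree.yieldForest, ParseTree.yield, hhy] using hP
      · simp [hPo, ParseTree.postorderForest, ParseTree.postorder]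

/-- The parse tree is unchanged: the last tree of the forest along `γ ++ [τ]` is merely regarded as
the first tree of the completion of `v`. -/
theorem ItemContext.step {γ : List (Symbol T G.NT)} {v w : LRItem T G.NT}
    {τ : Symbol T G.NT} (hv : ItemContext G k γ v) (h : LREdge G k v (some τ) w) :
    ItemContext G k (γ ++ [τ]) w := by
  cases h with
  | step _ _ hvv hwv hrule hpost hpre hlook =>
    obtain ⟨δ, hδ, hδ'⟩ := hv.stem
    obtain ⟨z, tail, hz, hc⟩ := hv.complete
    refine ⟨hwv, ⟨δ, by simp [hδ, hpre], by rwa [hrule]⟩, by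
      rw [hrule, hlook]; exact hv.look_initial, z, tail, by rw [hlook, hz], ?_⟩
    intro fs gs hf hg hfr hgr
    obtain ⟨f1, f2, rfl, h1, h2⟩ := List.map_eq_append_iff.1 hfr
    obtain ⟨P, hP, hPo⟩ := hc f1 (f2 ++ gs) (fun c hc => hf c (by simp [hc]))
      (fun c hc => by
        rcases List.mem_append.1 hc with h | h
        exacts [hf c (by simp [h]), hg c h]) h1 (by simp [h2, hgr, hpost])
    refine ⟨P, ?_, ?_⟩
    · simpa [yieldForest_append] using hP
    · simp [hPo, postorderForest_append, hrule]

theorem ItemContext.closure (hG : StartNormal G) {γ : List (Symbol T G.NT)}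
    {S : Set (LRItem T G.NT)} (hS : ∀ v ∈ S, ItemContext G k γ v) :
    ∀ w ∈ (lrNFA G k).εClosure S, ItemContext G k γ w := by
  intro w hw
  induction hw with
  | base v hv => exact hS v hv
  | step v w hw _ ih => exact ih.predict hG hw

/-- The viable prefix property, which is the soundness of the automaton: `ItemContext` holds at the
start vertices and survives both kinds of edges, so no item in a reached state is a dead end. -/
theorem itemContext_of_mem_eval (hG : StartNormal G) (γ : List (Symbol T G.NT)) :
    ∀ w ∈ (lrNFA G k).eval γ, ItemContext G k γ w := by
  induction γ using List.reverseRecOn with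
  | nil => exact ItemContext.closure hG fun v hv => ItemContext.of_start hv
  | append_singleton γ τ ih =>
    intro w hw
    rw [εNFA.eval_append_singleton, εNFA.mem_stepSet_iff] at hw
    obtain ⟨v, hv, hw⟩ := hw
    exact ItemContext.closure hG (fun u hu => (ih v hv).step hu) w hw

theorem mem_εClosure_of_edge {S : Set (LRItem T G.NT)} {v w : LRItem T G.NT}
    (hv : v ∈ (lrNFA G k).εClosure S) (h : LREdge G k v none w) :
    w ∈ (lrNFA G k).εClosure S :=
  εNFA.εClosure.step v w h hv

theorem mem_eval_of_predict {γ : List (Symbol T G.NT)} {v w : LRItem T G.NT}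
    (hv : v ∈ (lrNFA G k).eval γ) (h : LREdge G k v none w) : w ∈ (lrNFA G k).eval γ := by
  induction γ using List.reverseRecOn with
  | nil => exact mem_εClosure_of_edge hv h
  | append_singleton γ τ _ =>
    rw [εNFA.eval_append_singleton, εNFA.mem_stepSet_iff] at hv ⊢
    obtain ⟨u, hu, hv⟩ := hv
    exact ⟨u, hu, mem_εClosure_of_edge hv h⟩

theorem mem_eval_of_step {γ : List (Symbol T G.NT)} {v w : LRItem T G.NT} {τ : Symbol T G.NT}
    (hv : v ∈ (lrNFA G k).eval γ) (h : LREdge G k v (some τ) w) :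
    w ∈ (lrNFA G k).eval (γ ++ [τ]) := by
  rw [εNFA.eval_append_singleton, εNFA.mem_stepSet_iff]
  exact ⟨v, hv, εNFA.εClosure.base _ h⟩

/-- Advancing the dot of a vertex gives a vertex. -/
theorem exists_step_of_mem_eval (hG : StartNormal G) {γ : List (Symbol T G.NT)}
    {v : LRItem T G.NT} (hv : v ∈ (lrNFA G k).eval γ) {τ : Symbol T G.NT}
    {β : List (Symbol T G.NT)} (hpost : v.post = τ :: β) :
    ⟨v.rule, v.pre ++ [τ], β, v.look⟩ ∈ (lrNFA G k).eval (γ ++ [τ]) := by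
  have hvv := (itemContext_of_mem_eval hG γ v hv).vertex
  refine mem_eval_of_step hv (.step _ _ τ hvv ⟨hvv.1, ?_, hvv.2.2⟩ rfl hpost rfl rfl)
  simp [hvv.2.1, hpost]

/-- Every production of the nonterminal after the dot is predicted, with each of its follow
strings. -/
theorem exists_predict_of_mem_eval (hG : StartNormal G) {γ : List (Symbol T G.NT)}
    {v : LRItem T G.NT} (hv : v ∈ (lrNFA G k).eval γ) {r : ContextFreeRule T G.NT}
    (hr : r ∈ G.rules) {β : List (Symbol T G.NT)}
    (hpost : v.post = Symbol.nonterminal r.input :: β) {l : List (Option T)}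
    (hl : l ∈ firstGen G k β v.look) :
    ⟨r, [], r.output, l⟩ ∈ (lrNFA G k).eval γ := by
  have hvv := (itemContext_of_mem_eval hG γ v hv).vertex
  refine mem_eval_of_predict hv (.predict _ _ β hvv ⟨hr, by simp, ?_⟩ hpost rfl hl)
  -- Prolonging the derivation that justifies the follow string of `v` by the production of `v` puts
  -- `r.input` between `u ++ v.pre` and `β ++ v'`.
  obtain ⟨u, v', hd, hm⟩ := hvv.2.2
  refine ⟨u ++ v.pre, β ++ v', ?_, firstGen_append hl hm⟩
  refine hd.trans ?_
  have : G.Derives [Symbol.nonterminal v.rule.input] v.rule.output :=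
    ContextFreeGrammar.Produces.single ⟨v.rule, hvv.1, ContextFreeRule.Rewrites.input_output⟩
  have := (this.append_left u).append_right v'
  rw [hvv.2.1, hpost] at this
  simpa using this

end Items

-- Soundness and completeness of the runs with respect to parse trees

section Runs

variable {T : Type} {G : ContextFreeGrammar T} {k : ℕ}

/-- The state stack above which the symbols `γ` (top first) have been pushed. -/
def stackStates (G : ContextFreeGrammar T) (k : ℕ) :
    List (Symbol T G.NT) → List (Set (LRItem T G.NT))
  | [] => [dfaStart G k]
  | X :: γ => (lrNFA G k).eval (X :: γ).reverse :: stackStates G k γ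

theorem stackStates_eq_cons (γ : List (Symbol T G.NT)) :
    stackStates G k γ = (lrNFA G k).eval γ.reverse :: (stackStates G k γ).tail := by
  cases γ <;> simp [stackStates, dfaStart]

theorem stackStates_drop (m : ℕ) (γ : List (Symbol T G.NT)) (hm : m ≤ γ.length) :
    (stackStates G k γ).drop m = stackStates G k (γ.drop m) := by
  induction m generalizing γ with
  | zero => simp
  | succ m ih =>
    cases γ with
    | nil => simp at hm
    | cons X γ => simpa [stackStates] using ih γ (by simpa using hm)

theorem stackStates_cons (X : Symbol T G.NT) (γ : List (Symbol T G.NT)) :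
    stackStates G k (X :: γ) =
      dfaStep G k ((lrNFA G k).eval γ.reverse) X :: stackStates G k γ := by
  simp [stackStates, dfaStep]

/-- The configuration with the given syntax stack. -/
def configOf (G : ContextFreeGrammar T) (k : ℕ) (syn : List (ParseTree T G.NT)) (y : List T) :
    Config G :=
  ⟨stackStates G k (syn.map ParseTree.root), syn, y⟩

/-- The actions on the given lookahead at the state reached along `γ`. -/
def actionsAt (G : ContextFreeGrammar T) (k : ℕ) (S : Set (LRItem T G.NT)) (l : List (Option T)) :
    Set (LRAction T G.NT) :=
  {a | ∃ w ∈ S, HasAction G k w l a}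

theorem actions_configOf (syn : List (ParseTree T G.NT)) (y : List T) :
    (configOf G k syn y).actions k =
      actionsAt G k ((lrNFA G k).eval (syn.map ParseTree.root).reverse) (lookahead k y) := by
  ext a
  simp only [Config.actions, configOf, actionsAt, Set.mem_ofPred_eq]
  rw [stackStates_eq_cons]
  constructor
  · rintro ⟨v, S, hS, h⟩
    obtain ⟨rfl, rfl⟩ := List.cons_eq_cons.1 hS
    exact h
  · intro h
    exact ⟨_, _, rfl, h⟩

theorem advance_of_ne {α : Symbol T G.NT} (hα : α ≠ .nonterminal G.initial)
    (γ : List (Symbol T G.NT)) (syn : List (ParseTree T G.NT)) (y : List T) :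
    Config.advance k ⟨stackStates G k γ, syn, y⟩ α =
      .running ⟨stackStates G k (α :: γ), syn, y⟩ := by
  simp only [Config.advance, if_neg hα]
  rw [stackStates_eq_cons γ]
  simp only [stackStates_cons]
  rw [← stackStates_eq_cons γ]

theorem act_shift (syn : List (ParseTree T G.NT)) (a : T) (y : List T) :
    (configOf G k syn (a :: y)).act k .shift = .running (configOf G k (.leaf a :: syn) y) := by
  simp only [Config.act, configOf]
  rw [advance_of_ne (by simp)]
  rfl

/-- A reduction on the stack consists of a valid handle on top of the remaining stack. -/
theorem exists_handle (hG : StartNormal G) {syn : List (ParseTree T G.NT)} {l : List (Option T)}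
    (hsyn : ForestValid G syn) {r : ContextFreeRule T G.NT}
    (ha : .reduce r ∈ actionsAt G k ((lrNFA G k).eval (syn.map ParseTree.root).reverse) l) :
    ∃ cs rem : List (ParseTree T G.NT), syn = cs.reverse ++ rem ∧ cs.length = r.output.length ∧
      (ParseTree.node r cs).Valid G ∧
      (r.input = G.initial → rem = [] ∧ l = List.replicate k none) := by
  obtain ⟨w, hw, ha⟩ := ha
  cases ha with
  | reduce hv hpost =>
    have hc := itemContext_of_mem_eval hG _ w hw
    -- The dot stands at the end, so the path to the state ends with the whole right-hand side. The
    -- trees over that part are the handle, and for a start production `δ` is empty, so nothing lies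
    -- below it.
    obtain ⟨δ, hδ, hδ'⟩ := hc.stem
    have hout : w.rule.output = w.pre := by simpa [hpost] using hv.2.1
    rw [← List.map_reverse] at hδ
    obtain ⟨f1, f2, hf, h1, h2⟩ := List.map_eq_append_iff.1 hδ
    refine ⟨f2, f1.reverse, ?_, ?_, ?_, ?_⟩
    · rw [← List.reverse_append, ← hf, List.reverse_reverse]
    · rw [hout, ← h2, List.length_map]
    · refine .node _ _ hv.1 (by rw [h2, hout]) fun c hc => hsyn c ?_
      rw [← List.mem_reverse, hf]; simp [hc]
    · intro h
      have := hδ' h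
      subst this
      exact ⟨by simpa using h1, hc.look_initial h⟩

theorem act_reduce {cs rem : List (ParseTree T G.NT)} {r : ContextFreeRule T G.NT}
    (hlen : cs.length = r.output.length) (hr : r.input ≠ G.initial) (y : List T) :
    (configOf G k (cs.reverse ++ rem) y).act k (.reduce r) =
      .running (configOf G k (.node r cs :: rem) y) := by
  have hlen' : r.output.length = cs.reverse.length := by simp [hlen]
  simp only [Config.act, configOf]
  rw [stackStates_drop _ _ (by simp [hlen]), ← List.map_drop, hlen', List.drop_left,
    List.take_left, advance_of_ne (by simpa using hr)]
  simp [ParseTree.root]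

theorem act_reduce_initial {cs rem : List (ParseTree T G.NT)} {r : ContextFreeRule T G.NT}
    (hlen : cs.length = r.output.length) (hr : r.input = G.initial) (y : List T) :
    (configOf G k (cs.reverse ++ rem) y).act k (.reduce r) =
      if y = [] then .success (.node r cs) else .failure := by
  have hlen' : r.output.length = cs.reverse.length := by simp [hlen]
  simp only [Config.act, configOf, Config.advance, hr, if_true]
  rw [hlen', List.drop_left, List.take_left]
  cases y <;> simp

theorem act_shift_nil (syn : List (ParseTree T G.NT)) :
    (configOf G k syn []).act k .shift = .failure := by
  simp [Config.act, configOf]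

/-- The invariant of the runs. -/
def RunStatus (G : ContextFreeGrammar T) (k : ℕ) (x : List T) (p : List (LROp T G.NT)) :
    Outcome G → Prop
  | .running c => ∃ fs y, ForestValid G fs ∧ c = configOf G k fs.reverse y ∧
      p = ParseTree.postorderForest fs ∧ x = ParseTree.yieldForest fs ++ y ∧
      ∀ c ∈ fs, c.root ≠ .nonterminal G.initial
  | .success P => IsParseTree G x P ∧ p = P.postorder
  | .failure => True

/-- The forest is the syntax stack read from the bottom. A reduction takes off a genuine handle by
`exists_handle`; a start production leaves nothing below, so success at the end of the input returns
a tree of the entire input. -/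
theorem Run.status (hG : StartNormal G) {x : List T} {p : List (LROp T G.NT)} {o : Outcome G}
    (h : Run G k x p o) : RunStatus G k x p o := by
  induction h with
  | init => exact ⟨[], x, ForestValid.nil, by simp [configOf, stackStates], rfl, rfl, by simp⟩
  | noAction => trivial
  | step p c a h ha ih =>
    obtain ⟨fs, y, hf, rfl, rfl, rfl, hne⟩ := ih
    cases a with
    | shift =>
      cases y with
      | nil => rw [act_shift_nil]; trivial
      | cons a y =>
        rw [act_shift]
        refine ⟨fs ++ [.leaf a], y, hf.append (ForestValid.singleton (.leaf a)), by simp, ?_, ?_, ?_⟩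
        · simp [Config.op, configOf, postorderForest_append, ParseTree.postorderForest,
            ParseTree.postorder]
        · simp [yieldForest_append, ParseTree.yieldForest, ParseTree.yield]
        · intro c hc
          rcases List.mem_append.1 hc with hc | hc
          · exact hne c hc
          · rw [List.mem_singleton.1 hc]; simp [ParseTree.root]
    | reduce r =>
      rw [actions_configOf] at ha
      obtain ⟨cs, rem, hsyn, hlen, hval, hin⟩ := exists_handle hG hf.reverse ha
      have hfs : fs = rem.reverse ++ cs := by
        rw [← List.reverse_reverse fs, hsyn]; simp
      rw [hsyn]
      by_cases hr : r.input = G.initial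
      · rw [act_reduce_initial hlen hr]
        split_ifs with hy
        · obtain ⟨rfl, -⟩ := hin hr
          subst hy
          refine ⟨⟨hval, by simp [ParseTree.root, hr], ?_⟩, ?_⟩
          · simp [hfs, ParseTree.yield]
          · simp [hfs, ParseTree.postorder, Config.op]
        · trivial
      · rw [act_reduce hlen hr]
        refine ⟨rem.reverse ++ [.node r cs], y, ?_, by simp, ?_, ?_, ?_⟩
        · refine ForestValid.append (fun c hc => hf c ?_) (ForestValid.singleton hval)
          rw [hfs]; simp [List.mem_reverse.1 hc]
        · simp [hfs, postorderForest_append, Config.op, ParseTree.postorderForest,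
            ParseTree.postorder]
        · simp [hfs, yieldForest_append, ParseTree.yieldForest, ParseTree.yield]
        · intro c hc
          rcases List.mem_append.1 hc with hc | hc
          · exact hne c (by rw [hfs]; exact List.mem_append_left _ hc)
          · rw [List.mem_singleton.1 hc]; simpa [ParseTree.root] using hr

/-- A running configuration is given by a valid forest. -/
theorem Run.exists_forest (hG : StartNormal G) {x : List T} {p : List (LROp T G.NT)} {c : Config G}
    (h : Run G k x p (.running c)) :
    ∃ fs y, ForestValid G fs ∧ c = configOf G k fs.reverse y ∧
      p = ParseTree.postorderForest fs ∧ x = ParseTree.yieldForest fs ++ y := by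
  obtain ⟨fs, y, h1, h2, h3, h4, -⟩ := h.status hG
  exact ⟨fs, y, h1, h2, h3, h4⟩

/-- A round performs at most one operation, so a run passes through a configuration at each proper
prefix of its operation sequence, and the action chosen there performs the next operation. -/
theorem Run.exists_of_prefix {x : List T} {p : List (LROp T G.NT)} {o : Outcome G}
    (h : Run G k x p o) {p' : List (LROp T G.NT)} {op : LROp T G.NT} (hp : p' ++ [op] <+: p) :
    ∃ c a, Run G k x p' (.running c) ∧ a ∈ c.actions k ∧ c.op a = [op] := by
  induction h with
  | init => simp at hp
  | noAction p c h ha ih => exact ih hp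
  | step p c a h ha ih =>
    have hop : c.op a = [] ∨ ∃ o, c.op a = [o] := by
      cases a with
      | shift => simp only [Config.op]; cases c.rest <;> simp
      | reduce r => simp [Config.op]
    rcases hop with hop | ⟨o, hop⟩
    · rw [hop, List.append_nil] at hp
      exact ih hp
    · rw [hop] at hp
      rcases List.prefix_concat_iff.1 hp with heq | hlt
      · obtain ⟨rfl, ho⟩ := List.append_inj' heq rfl
        exact ⟨c, a, h, ha, by rw [hop]; exact ho.symm⟩
      · exact ih hlt

/-- Runs follow the tree `c`, given an item with the root of `c` after its dot. -/
def RunsTree (G : ContextFreeGrammar T) (k : ℕ) (x : List T) (c : ParseTree T G.NT) : Prop :=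
  ∀ (p : List (LROp T G.NT)) (syn : List (ParseTree T G.NT)) (z : List T)
    (v : LRItem T G.NT) (β : List (Symbol T G.NT)),
    Run G k x p (.running (configOf G k syn (c.yield ++ z))) →
    v ∈ (lrNFA G k).eval (syn.map ParseTree.root).reverse → v.post = c.root :: β →
    lookahead k z ∈ firstGen G k β v.look →
    Run G k x (p ++ c.postorder) (.running (configOf G k (c :: syn) z))

/-- The item `w` is advanced over the trees one at a time. The lookahead behind each tree is
admissible because the remaining trees derive their own yield; when the dot reaches the end,
`w.look` is the actual lookahead and the reduction is available. -/
theorem run_forest_of_forall (hG : StartNormal G) {x : List T} {cs : List (ParseTree T G.NT)}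
    (hcs : ForestValid G cs) (ih : ∀ c ∈ cs, RunsTree G k x c) (z : List T) :
    ∀ (p : List (LROp T G.NT)) (syn : List (ParseTree T G.NT)) (w : LRItem T G.NT),
      Run G k x p (.running (configOf G k syn (ParseTree.yieldForest cs ++ z))) →
      w ∈ (lrNFA G k).eval (syn.map ParseTree.root).reverse →
      w.post = cs.map ParseTree.root → w.look = lookahead k z →
      Run G k x (p ++ ParseTree.postorderForest cs)
        (.running (configOf G k (cs.reverse ++ syn) z)) ∧
      .reduce w.rule ∈ (configOf G k (cs.reverse ++ syn) z).actions k := by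
  induction cs with
  | nil =>
    intro p syn w hrun hw hpost hlook
    refine ⟨by simpa [ParseTree.yieldForest, ParseTree.postorderForest] using hrun, ?_⟩
    rw [actions_configOf]
    refine ⟨w, by simpa using hw, ?_⟩
    have := HasAction.reduce w (itemContext_of_mem_eval hG _ w hw).vertex (by simpa using hpost)
    rwa [hlook] at this
  | cons d ds ihd =>
    intro p syn w hrun hw hpost hlook
    have hds : ForestValid G ds := fun e he => hcs e (by simp [he])
    have h1 := ih d (by simp) p syn (ParseTree.yieldForest ds ++ z) w
      (ds.map ParseTree.root) (by simpa [ParseTree.yieldForest] using hrun) hw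
      (by simpa using hpost) (by rw [hlook]; exact lookahead_mem_firstGen hds.derives)
    have h2 := exists_step_of_mem_eval hG hw (by simpa using hpost)
    have h3 := ihd hds (fun c hc => ih c (by simp [hc])) _ (d :: syn)
      ⟨w.rule, w.pre ++ [d.root], ds.map ParseTree.root, w.look⟩ h1
      (by rw [List.map_cons, List.reverse_cons]; exact h2) rfl hlook
    simpa [ParseTree.postorderForest] using h3

/-- At a node, the state contains the item that predicts its production with the lookahead behind
the node as follow string; this item guides the run through the children and permits the reduction.
At a leaf the item `v` itself permits the shift. -/
theorem ParseTree.Valid.runsTree (hG : StartNormal G) {x : List T} {c : ParseTree T G.NT}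
    (hc : c.Valid G) : RunsTree G k x c := by
  induction hc with
  | leaf a =>
    intro p syn z v β hrun hv hpost hl
    have hvv := (itemContext_of_mem_eval hG _ v hv).vertex
    have := hrun.step (a := .shift) _ _ (by
      rw [actions_configOf]
      refine ⟨v, hv, .shift v _ a β hvv hpost ?_⟩
      rw [hpost]
      refine firstGen_append (β := [.terminal a]) (γ := β) ?_ hl
      exact lookahead_mem_firstGen (y := [a]) (ContextFreeGrammar.Derives.refl _))
    rw [ParseTree.yield, List.singleton_append, act_shift] at this
    simpa [Config.op, configOf, ParseTree.postorder] using this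
  | node r cs hr hroot hcs ih =>
    intro p syn z v β hrun hv hpost hl
    have hw := exists_predict_of_mem_eval hG hv hr (by simpa [ParseTree.root] using hpost) hl
    obtain ⟨h1, ha⟩ := run_forest_of_forall hG hcs ih z p syn _
      (by simpa [ParseTree.yield] using hrun) hw hroot.symm rfl
    have hne : r.input ≠ G.initial := by
      intro he
      have hvv := (itemContext_of_mem_eval hG _ v hv).vertex
      apply hG.2 v.rule hvv.1
      rw [hvv.2.1, hpost]; simp [ParseTree.root, he]
    have := h1.step _ _ (.reduce r) ha
    rw [act_reduce (by simp [← hroot]) hne] at this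
    simpa [Config.op, ParseTree.postorder] using this

/-- Nothing predicts the start production. The root is instead guided by the start item whose follow
string consists of end markers, the lookahead at the end of the input. -/
theorem run_success_of_isParseTree (hG : StartNormal G) {x : List T} {P : ParseTree T G.NT}
    (hP : IsParseTree G x P) : Run G k x P.postorder (.success P) := by
  obtain ⟨hv, hroot, hy⟩ := hP
  cases hv with
  | leaf a => simp [ParseTree.root] at hroot
  | node r cs hr hout hcs =>
    have hin : r.input = G.initial := by simpa [ParseTree.root] using hroot
    have hw : (⟨r, [], r.output, List.replicate k none⟩ : LRItem T G.NT) ∈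
        (lrNFA G k).eval [] := by
      refine εNFA.εClosure.base _ ⟨⟨hr, rfl, [], [], ?_, [], ?_, by simp⟩, hin, rfl, rfl⟩
      · simpa [hin] using ContextFreeGrammar.Derives.refl _
      · exact ContextFreeGrammar.Derives.refl _
    obtain ⟨h1, ha⟩ := run_forest_of_forall hG hcs
      (fun c hc => (hcs c hc).runsTree hG) [] [] [] _
      (by simpa [← hy, ParseTree.yield, configOf, stackStates] using
        Run.init (G := G) (k := k) (x := x)) hw hout.symm (by simp [lookahead_nil])
    have := h1.step _ _ (.reduce r) ha
    rw [act_reduce_initial (by simp [← hout]) hin] at this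
    subst hy
    simpa [Config.op, ParseTree.postorder, ParseTree.yield] using this

theorem run_success_iff (hG : StartNormal G) (x : List T) (p : List (LROp T G.NT))
    (P : ParseTree T G.NT) :
    Run G k x p (.success P) ↔ IsParseTree G x P ∧ p = P.postorder := by
  constructor
  · exact fun h => h.status hG
  · rintro ⟨hP, rfl⟩
    exact run_success_of_isParseTree hG hP

/-- The unread part of the input matters only through the lookahead. -/
theorem Run.congr_rest (hG : StartNormal G) {u y₁ y₂ : List T}
    (hy : lookahead k y₁ = lookahead k y₂) {p : List (LROp T G.NT)} {o : Outcome G}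
    (h : Run G k (u ++ y₁) p o) :
    ∀ (syn : List (ParseTree T G.NT)) (w : List T), o = .running (configOf G k syn (w ++ y₁)) →
      Run G k (u ++ y₂) p (.running (configOf G k syn (w ++ y₂))) := by
  induction h with
  | init =>
    intro syn w ho
    simp only [configOf, Outcome.running.injEq, Config.mk.injEq] at ho
    obtain ⟨-, rfl, hw⟩ := ho
    obtain rfl : u = w := by simpa using hw
    simpa [configOf, stackStates] using Run.init (G := G) (k := k) (x := u ++ y₂)
  | noAction => intro syn w ho; simp at ho
  | step p c a h ha ih =>
    intro syn w ho
    obtain ⟨fs, y, hf, rfl, hp, hx⟩ := h.exists_forest hG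
    rw [actions_configOf] at ha
    cases a with
    | shift =>
      cases y with
      | nil => rw [act_shift_nil] at ho; simp at ho
      | cons a y =>
        rw [act_shift] at ho
        simp only [configOf, Outcome.running.injEq, Config.mk.injEq] at ho
        obtain ⟨-, rfl, rfl⟩ := ho
        have h1 := ih fs.reverse (a :: w) rfl
        have h2 := h1.step (a := .shift) _ _ (by
          rw [actions_configOf, ← lookahead_append_congr (a :: w) hy]; exact ha)
        rw [List.cons_append, act_shift] at h2
        simpa [Config.op, configOf] using h2
    | reduce r =>
      obtain ⟨cs, rem, hsyn, hlen, hval, hin⟩ := exists_handle hG hf.reverse ha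
      by_cases hr : r.input = G.initial
      · rw [hsyn, act_reduce_initial hlen hr] at ho
        split_ifs at ho
      · rw [hsyn, act_reduce hlen hr] at ho
        simp only [configOf, Outcome.running.injEq, Config.mk.injEq] at ho
        obtain ⟨-, rfl, rfl⟩ := ho
        have h1 := ih fs.reverse w rfl
        have h2 := h1.step (a := .reduce r) _ _ (by
          rw [actions_configOf, ← lookahead_append_congr w hy]; exact ha)
        rw [hsyn, act_reduce hlen hr] at h2
        simpa [Config.op] using h2

end Runs

-- Partial LR parses and live copies

section Partial

variable {T : Type} {G : ContextFreeGrammar T} {k : ℕ}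

theorem IsLongestPrefix.of_shift {N : Type} (p r : List (LROp T N)) (a : T) :
    IsLongestPrefix (numShifts p) p (p ++ .shift a :: r) := by
  refine ⟨List.prefix_append _ _, rfl, fun p' hp' hs => ?_⟩
  rcases List.prefix_or_prefix_of_prefix hp' (List.prefix_append p (.shift a :: r)) with h | h
  · exact h
  · obtain ⟨e, rfl⟩ := h
    rw [List.prefix_append_right_inj] at hp'
    cases e with
    | nil => simp
    | cons o e =>
      obtain ⟨rfl, -⟩ := List.cons_prefix_cons.1 hp'
      simp [numShifts_append, numShifts] at hs

theorem IsLongestPrefix.self {N : Type} (p : List (LROp T N)) :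
    IsLongestPrefix (numShifts p) p p :=
  ⟨List.prefix_rfl, rfl, fun _ h _ => h⟩

/-- Extend `p` over the reductions that follow it, up to the next shift or the end. -/
theorem exists_isLongestPrefix {N : Type} (r p : List (LROp T N)) :
    ∃ p', p <+: p' ∧ IsLongestPrefix (numShifts p) p' (p ++ r) := by
  induction r generalizing p with
  | nil => exact ⟨p, List.prefix_rfl, by simpa using IsLongestPrefix.self p⟩
  | cons o r ih =>
    cases o with
    | shift a => exact ⟨p, List.prefix_rfl, IsLongestPrefix.of_shift p r a⟩
    | reduce R =>
      obtain ⟨p', h1, h2⟩ := ih (p ++ [.reduce R])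
      refine ⟨p', (List.prefix_append _ _).trans h1, ?_⟩
      simpa [numShifts_append, numShifts] using h2

/-- An action available above a valid forest is the next operation of some LR parse. -/
theorem exists_parse_of_action (hG : StartNormal G) {fs : List (ParseTree T G.NT)}
    (hf : ForestValid G fs) {l : List (Option T)} {a : LRAction T G.NT}
    (ha : a ∈ actionsAt G k ((lrNFA G k).eval (fs.map ParseTree.root)) l) :
    ∃ (y : List T) (op : LROp T G.NT) (rest : List (LROp T G.NT)) (P : ParseTree T G.NT),
      lookahead k y = l ∧ IsParseTree G (ParseTree.yieldForest fs ++ y) P ∧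
      P.postorder = ParseTree.postorderForest fs ++ op :: rest ∧
      (a = .shift → ∃ b, op = .shift b) := by
  obtain ⟨w, hw, ha⟩ := ha
  obtain ⟨z, tail, hz, hc⟩ := (itemContext_of_mem_eval hG _ w hw).complete
  cases ha with
  | reduce hv hpost =>
    obtain ⟨P, hP, hPo⟩ := hc fs [] hf ForestValid.nil rfl (by simp [hpost])
    exact ⟨z, .reduce w.rule, tail, P, hz, by simpa [ParseTree.yieldForest] using hP,
      by simpa [ParseTree.postorderForest] using hPo, by simp⟩
  | shift _ b β hv hpost hl =>
    obtain ⟨y, hy, rfl⟩ := hl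
    obtain ⟨gs, hgv, hgr, hgy⟩ := exists_forest_of_derives hy
    obtain ⟨P, hP, hPo⟩ := hc fs gs hf hgv rfl hgr
    -- The first tree of the completion has a terminal at its root, so it is a leaf, and its shift
    -- is the next operation.
    rw [hpost] at hgr
    cases gs with
    | nil => simp at hgr
    | cons g gs =>
      cases g with
      | node r cs => simp [ParseTree.root] at hgr
      | leaf c =>
        refine ⟨y ++ z, .shift c, ParseTree.postorderForest gs ++ .reduce w.rule :: tail, P, ?_, ?_, ?_,
          fun _ => ⟨c, rfl⟩⟩
        · rw [lookahead_append, hz]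
        · rw [hgy] at hP; simpa using hP
        · rw [hPo]
          simp only [ParseTree.postorderForest, ParseTree.postorder, List.append_assoc,
            List.cons_append, List.nil_append]

theorem isPartial_of_shift (hG : StartNormal G) {fs : List (ParseTree T G.NT)}
    (hf : ForestValid G fs) {l : List (Option T)}
    (ha : .shift ∈ actionsAt G k ((lrNFA G k).eval (fs.map ParseTree.root)) l) :
    IsPartialLRParse G k (ParseTree.yieldForest fs) l (ParseTree.postorderForest fs) := by
  obtain ⟨y, op, rest, P, hy, hP, hPo, hop⟩ := exists_parse_of_action hG hf ha
  obtain ⟨b, rfl⟩ := hop rfl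
  refine ⟨y, P.postorder, hy, ⟨P, hP, rfl⟩, ?_⟩
  rw [hPo, ← hf.numShifts]
  exact IsLongestPrefix.of_shift _ _ _

/-- The action lies on some complete LR parse; following that parse over its next reductions reaches
a partial parse. -/
theorem exists_isPartial_of_action (hG : StartNormal G) {fs : List (ParseTree T G.NT)}
    (hf : ForestValid G fs) {l : List (Option T)} {a : LRAction T G.NT}
    (ha : a ∈ actionsAt G k ((lrNFA G k).eval (fs.map ParseTree.root)) l) :
    ∃ q, ParseTree.postorderForest fs <+: q ∧
      IsPartialLRParse G k (ParseTree.yieldForest fs) l q := by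
  obtain ⟨y, op, rest, P, hy, hP, hPo, -⟩ := exists_parse_of_action hG hf ha
  obtain ⟨q, h1, h2⟩ := exists_isLongestPrefix (op :: rest) (ParseTree.postorderForest fs)
  refine ⟨q, h1, y, P.postorder, hy, ⟨P, hP, rfl⟩, ?_⟩
  rwa [hPo, ← hf.numShifts]

/-- Every valid forest with an action on the lookahead is reached by a run. -/
theorem run_of_action (hG : StartNormal G) {fs : List (ParseTree T G.NT)}
    (hf : ForestValid G fs) {y : List T} {a : LRAction T G.NT}
    (ha : a ∈ actionsAt G k ((lrNFA G k).eval (fs.map ParseTree.root)) (lookahead k y)) :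
    Run G k (ParseTree.yieldForest fs ++ y) (ParseTree.postorderForest fs)
      (.running (configOf G k fs.reverse y)) := by
  -- The action only guarantees a parse of some continuation `y'` with the same lookahead as `y`.
  -- Its run passes through the forest `fs`, and up to that point `y'` can be exchanged for `y`.
  obtain ⟨y', op, rest, P, hy, hP, hPo, -⟩ := exists_parse_of_action hG hf ha
  have hrun := run_success_of_isParseTree (k := k) hG hP
  obtain ⟨c, a', hc, -, -⟩ := hrun.exists_of_prefix (p' := ParseTree.postorderForest fs)
    (op := op) ⟨rest, by rw [hPo]; simp⟩
  obtain ⟨gs, z, hg, rfl, hpg, hx⟩ := hc.exists_forest hG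
  obtain rfl := hf.postorder_injective hg hpg
  obtain rfl : y' = z := by simpa using hx
  simpa using hc.congr_rest hG hy fs.reverse [] (by simp)

theorem actions_configOf_reverse (fs : List (ParseTree T G.NT)) (y : List T) :
    (configOf G k fs.reverse y).actions k =
      actionsAt G k ((lrNFA G k).eval (fs.map ParseTree.root)) (lookahead k y) := by
  rw [actions_configOf, List.map_reverse, List.reverse_reverse]

theorem eq_take_of_append {x u y : List T} {s : ℕ} (hx : x = u ++ y)
    (hy : y = x.drop s) : u = x.take s := by
  have h1 : x.take s ++ x.drop s = u ++ x.drop s := by rw [List.take_append_drop, ← hy, ← hx]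
  exact (List.append_cancel_right h1).symm

/-- Live copies, in terms of forests. -/
theorem liveAt_iff (hG : StartNormal G) {x : List T} {s : ℕ}
    (p : List (LROp T G.NT)) :
    LiveAt G k x s p ↔ ∃ fs, ForestValid G fs ∧ p = ParseTree.postorderForest fs ∧
      ParseTree.yieldForest fs = x.take s ∧
      (actionsAt G k ((lrNFA G k).eval (fs.map ParseTree.root))
        (lookahead k (x.drop s))).Nonempty := by
  constructor
  · rintro ⟨c, hrun, hrest, ha⟩
    obtain ⟨fs, y, hf, rfl, rfl, hx⟩ := hrun.exists_forest hG
    rw [actions_configOf_reverse] at ha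
    have hy : y = x.drop s := hrest
    exact ⟨fs, hf, rfl, eq_take_of_append hx hy, hy ▸ ha⟩
  · rintro ⟨fs, hf, rfl, hy, a, ha⟩
    have := run_of_action hG hf ha
    rw [hy, List.take_append_drop] at this
    exact ⟨_, this, rfl, a, by rwa [actions_configOf_reverse]⟩

/-- Copies about to shift, in terms of forests. -/
theorem shiftReadyAt_iff (hG : StartNormal G) {x : List T} {s : ℕ}
    (p : List (LROp T G.NT)) :
    ShiftReadyAt G k x s p ↔ ∃ fs, ForestValid G fs ∧ p = ParseTree.postorderForest fs ∧
      ParseTree.yieldForest fs = x.take s ∧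
      .shift ∈ actionsAt G k ((lrNFA G k).eval (fs.map ParseTree.root))
        (lookahead k (x.drop s)) := by
  constructor
  · rintro ⟨c, hrun, hrest, ha⟩
    obtain ⟨fs, y, hf, rfl, rfl, hx⟩ := hrun.exists_forest hG
    rw [actions_configOf_reverse] at ha
    have hy : y = x.drop s := hrest
    exact ⟨fs, hf, rfl, eq_take_of_append hx hy, hy ▸ ha⟩
  · rintro ⟨fs, hf, rfl, hy, ha⟩
    have := run_of_action hG hf ha
    rw [hy, List.take_append_drop] at this
    exact ⟨_, this, rfl, by rwa [actions_configOf_reverse]⟩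

theorem IsLRParse.isPartial {u : List T} {p : List (LROp T G.NT)} (h : IsLRParse G u p) :
    IsPartialLRParse G k u (List.replicate k none) p := by
  refine ⟨[], p, lookahead_nil k, by simpa using h, ?_⟩
  obtain ⟨P, ⟨hv, -, hy⟩, rfl⟩ := h
  rw [← hy, ← hv.numShifts]
  exact IsLongestPrefix.self _

/-- The operations of the last step of a successful run are available on other inputs too. -/
theorem exists_run_of_isLRParse (hG : StartNormal G) {u y : List T} {p : List (LROp T G.NT)}
    (h : IsLRParse G u p) (hy : lookahead k y = List.replicate k none) :
    ∃ o, Run G k (u ++ y) p o := by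
  obtain ⟨P, hP, rfl⟩ := h
  have hrun := run_success_of_isParseTree (k := k) hG hP
  obtain ⟨hv, hroot, hyield⟩ := hP
  cases hv with
  | leaf a => simp [ParseTree.root] at hroot
  | node r cs hr hout hcs =>
    obtain ⟨c, a, hc, ha, hop⟩ := hrun.exists_of_prefix
      (p' := ParseTree.postorderForest cs) (op := .reduce r)
      (by simp [ParseTree.postorder])
    obtain ⟨fs, z, hf, rfl, hpf, hx⟩ := hc.exists_forest hG
    obtain rfl := ForestValid.postorder_injective hcs hf hpf
    obtain rfl : z = [] := by
      rw [← hyield] at hx; simpa [ParseTree.yield] using hx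
    rw [actions_configOf_reverse, lookahead_nil, ← hy] at ha
    have ha' : a = .reduce r := by
      cases a with
      | shift => simp [Config.op, configOf] at hop
      | reduce r' => simpa [Config.op] using hop
    have h2 := (run_of_action hG hf ha).step _ _ a (by rwa [actions_configOf_reverse])
    subst ha'
    refine ⟨Config.act k (configOf G k cs.reverse y) (.reduce r), ?_⟩
    rw [← hyield]
    simpa [ParseTree.yield, ParseTree.postorder, Config.op] using h2

/-- Consider the continuation that witnesses a partial parse. If it is empty, maximality makes the
prefix a complete parse; otherwise the operation behind the prefix is a shift, and the run for the
witnessing parse is about to shift there. -/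
theorem isPartialLRParse_iff (hG : StartNormal G) {x : List T} {s : ℕ}
    (p : List (LROp T G.NT)) :
    IsPartialLRParse G k (x.take s) (lookahead k (x.drop s)) p ↔
      ShiftReadyAt G k x s p ∨
        (lookahead k (x.drop s) = List.replicate k none ∧ IsLRParse G (x.take s) p ∧
          ∃ o, Run G k x p o) := by
  constructor
  · rintro ⟨y, q, hy, ⟨P, hP, rfl⟩, hpre, hsh, hlong⟩
    cases y with
    | nil =>
      right
      have hn : numShifts P.postorder = (x.take s).length := by
        rw [hP.1.numShifts, hP.2.2, List.append_nil]
      obtain rfl : p = P.postorder := by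
        refine List.IsPrefix.eq_of_length_le hpre (hlong _ List.prefix_rfl hn).length_le
      rw [lookahead_nil] at hy
      rw [List.append_nil] at hP
      refine ⟨hy.symm, ⟨P, hP, rfl⟩, ?_⟩
      have := exists_run_of_isLRParse hG ⟨P, hP, rfl⟩ hy.symm
      rwa [List.take_append_drop] at this
    | cons b y =>
      left
      rw [shiftReadyAt_iff hG]
      obtain ⟨r, hr⟩ := hpre
      have hn : numShifts P.postorder = (x.take s).length + (y.length + 1) := by
        rw [hP.1.numShifts, hP.2.2, List.length_append, List.length_cons]
      cases r with
      | nil => rw [List.append_nil] at hr; rw [← hr, hsh] at hn; omega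
      | cons op r =>
        -- A reduction would give a longer prefix with the same number of shifts.
        have hop : ∃ a, op = .shift a := by
          cases op with
          | shift a => exact ⟨a, rfl⟩
          | reduce R =>
            have := (hlong (p ++ [.reduce R]) ⟨r, by rw [← hr]; simp⟩
              (by rw [numShifts_append, hsh]; rfl)).length_le
            simp at this
        obtain ⟨a, rfl⟩ := hop
        have hrun := run_success_of_isParseTree (k := k) hG hP
        obtain ⟨c, a', hc, ha, hop⟩ := hrun.exists_of_prefix (p' := p)
          (op := .shift a) ⟨r, by rw [← hr]; simp⟩
        obtain ⟨fs, z, hf, rfl, rfl, hx⟩ := hc.exists_forest hG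
        obtain ⟨h1, h2⟩ := List.append_inj hx (by rw [← hsh, hf.numShifts])
        rw [actions_configOf_reverse, ← h2, hy] at ha
        have ha' : a' = .shift := by
          cases a' with
          | shift => rfl
          | reduce r' => simp [Config.op] at hop
        exact ⟨fs, hf, rfl, h1.symm, ha' ▸ ha⟩
  · rintro (h | ⟨hl, hp, -⟩)
    · obtain ⟨fs, hf, rfl, hy, ha⟩ := (shiftReadyAt_iff hG p).1 h
      rw [← hy]
      exact isPartial_of_shift hG hf ha
    · rw [hl]; exact hp.isPartial

theorem exists_isPartial_of_liveAt (hG : StartNormal G) {x : List T} {s : ℕ}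
    {p : List (LROp T G.NT)} (h : LiveAt G k x s p) :
    ∃ q, p <+: q ∧ IsPartialLRParse G k (x.take s) (lookahead k (x.drop s)) q := by
  obtain ⟨fs, hf, rfl, hy, a, ha⟩ := (liveAt_iff hG p).1 h
  rw [← hy]
  exact exists_isPartial_of_action hG hf ha

/-- Each live copy is a prefix of a partial LR parse. Two copies assigned to the same parse are both
prefixes of it, hence comparable, hence equal by `hanti`; so the copies inject into a set of at most
`t` parses. -/
theorem card_liveAt_le (hG : StartNormal G) {t : ℕ} (hX : IsXLR G k t) {x : List T} {s : ℕ} (F : Finset (List (LROp T G.NT))) (hF : ∀ p ∈ F, LiveAt G k x s p)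
    (hanti : ∀ p ∈ F, ∀ q ∈ F, p <+: q → p = q) : F.card ≤ t := by
  have h : ∀ p : F, ∃ q, p.1 <+: q ∧
      IsPartialLRParse G k (x.take s) (lookahead k (x.drop s)) q :=
    fun p => exists_isPartial_of_liveAt hG (hF p.1 p.2)
  choose f hf1 hf2 using h
  have hinj : Function.Injective f := by
    intro p q hpq
    apply Subtype.ext
    rcases List.prefix_or_prefix_of_prefix (hf1 p) (hpq ▸ hf1 q) with h | h
    · exact hanti _ p.2 _ q.2 h
    · exact (hanti _ q.2 _ p.2 h).symm
  have h1 := hX (x.take s) (lookahead k (x.drop s)) (lookahead_length _ _)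
  have h2 : (Set.range f).encard ≤ t :=
    (Set.encard_le_encard (by rintro _ ⟨p, rfl⟩; exact hf2 p)).trans h1
  rw [← Set.image_univ, hinj.encard_image, Set.encard_univ] at h2
  simpa [ENat.card_eq_coe_fintype_card] using h2

end Partial

/-! ### Pumping and the linear bound -/

section Pumping

variable {T : Type} {G : ContextFreeGrammar T} {k : ℕ}

/-- The XLR property leaves finitely many partial LR parses for `u` and `l`, and the operations of a
live forest are a prefix of one of them. The bound depends on `u`; it serves to contradict pumping
and to obtain finiteness. -/
theorem exists_length_bound (hG : StartNormal G) {t : ℕ} (hX : IsXLR G k t) (u : List T)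
    {l : List (Option T)} (hl : l.length = k) :
    ∃ B, ∀ fs, ForestValid G fs → ParseTree.yieldForest fs = u →
      (actionsAt G k ((lrNFA G k).eval (fs.map ParseTree.root)) l).Nonempty →
      (ParseTree.postorderForest fs).length ≤ B := by
  have hfin : {p | IsPartialLRParse G k u l p}.Finite :=
    Set.finite_of_encard_le_coe (hX u l hl)
  obtain ⟨B, hB⟩ := (hfin.image List.length).bddAbove
  refine ⟨B, fun fs hf hu ha => ?_⟩
  obtain ⟨a, ha⟩ := ha
  obtain ⟨q, hq, hp⟩ := exists_isPartial_of_action hG hf ha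
  exact hq.length_le.trans (hB ⟨q, hu ▸ hp, rfl⟩)

/-- `Subtree b a`: the tree `b` occurs in the tree `a`. -/
inductive Subtree {N : Type} : ParseTree T N → ParseTree T N → Prop
  | refl (a : ParseTree T N) : Subtree a a
  | child (r : ContextFreeRule T N) (cs : List (ParseTree T N)) (b c : ParseTree T N)
      (hc : c ∈ cs) (h : Subtree b c) : Subtree b (.node r cs)

theorem Subtree.trans {N : Type} {a b c : ParseTree T N} (h₁ : Subtree a b) (h₂ : Subtree b c) :
    Subtree a c := by
  induction h₂ with
  | refl => exact h₁
  | child r cs b c hc _ ih => exact .child r cs _ c hc (ih h₁)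

theorem Subtree.valid {a b : ParseTree T G.NT} (h : Subtree b a) (ha : a.Valid G) :
    b.Valid G := by
  induction h with
  | refl => exact ha
  | child r cs b c hc _ ih =>
    cases ha with
    | node _ _ hr hroot hcs => exact ih (hcs c hc)

theorem yield_infix_of_mem {N : Type} {c : ParseTree T N} {cs : List (ParseTree T N)}
    (hc : c ∈ cs) : c.yield <:+: ParseTree.yieldForest cs := by
  obtain ⟨l, r, rfl⟩ := List.append_of_mem hc
  exact ⟨ParseTree.yieldForest l, ParseTree.yieldForest r, by
    simp [yieldForest_append, ParseTree.yieldForest]⟩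

theorem Subtree.yield_infix {N : Type} {a b : ParseTree T N} (h : Subtree b a) :
    b.yield <:+: a.yield := by
  induction h with
  | refl => exact List.infix_rfl
  | child r cs b c hc _ ih =>
    exact ih.trans (by simpa [ParseTree.yield] using yield_infix_of_mem hc)

theorem Subtree.length_le {N : Type} {a b : ParseTree T N} (h : Subtree b a) :
    b.postorder.length ≤ a.postorder.length := by
  induction h with
  | refl => exact le_rfl
  | child r cs b c hc _ ih =>
    obtain ⟨l, r, rfl⟩ := List.append_of_mem hc
    simp only [ParseTree.postorder, postorderForest_append, ParseTree.postorderForest,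
      List.length_append]
    omega

/-- Replacing a subtree. -/
theorem Subtree.replace {a b : ParseTree T G.NT} (h : Subtree b a) (ha : a.Valid G)
    {b' : ParseTree T G.NT} (hb' : b'.Valid G) (hroot : b'.root = b.root)
    (hyield : b'.yield = b.yield) :
    ∃ a' : ParseTree T G.NT, a'.Valid G ∧ a'.root = a.root ∧ a'.yield = a.yield ∧
      a'.postorder.length + b.postorder.length = a.postorder.length + b'.postorder.length := by
  induction h with
  | refl a => exact ⟨b', hb', hroot, hyield, by omega⟩
  | child r cs b c hc _ ih =>
    cases ha with
    | node _ _ hr hout hcs =>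
      obtain ⟨c', hv, hcr, hcy, hcl⟩ := ih (hcs c hc) hroot hyield
      obtain ⟨l, m, rfl⟩ := List.append_of_mem hc
      refine ⟨.node r (l ++ c' :: m), .node r _ hr (by simpa [hcr] using hout) ?_, rfl, ?_, ?_⟩
      · intro d hd
        simp only [List.mem_append, List.mem_cons] at hd
        rcases hd with hd | rfl | hd
        · exact hcs d (by simp [hd])
        · exact hv
        · exact hcs d (by simp [hd])
      · simp [ParseTree.yield, yieldForest_append, ParseTree.yieldForest, hcy]
      · simp only [ParseTree.postorder, postorderForest_append, ParseTree.postorderForest,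
          List.length_append]
        omega

/-- No tree is nested in another one with the same root and the same yield. -/
def TreeReduced {N : Type} (u : ParseTree T N) : Prop :=
  ∀ (r : ContextFreeRule T N) (cs : List (ParseTree T N)) (c b : ParseTree T N),
    Subtree (.node r cs) u → c ∈ cs → Subtree b c → b.root = .nonterminal r.input →
      b.yield.length ≠ (ParseTree.node r cs).yield.length

theorem TreeReduced.subtree {N : Type} {a b : ParseTree T N} (ha : TreeReduced a)
    (h : Subtree b a) : TreeReduced b :=
  fun r cs c d hs hc hd => ha r cs c d (hs.trans h) hc hd

/-- Let `b` be the inner and `a` the outer of two nested trees with equal root and yield. Replacing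
`b` inside `a` by the tree obtained so far lengthens the postorder every time, while root and yield
stay fixed. -/
theorem exists_large_of_not_reduced {u : ParseTree T G.NT} (hu : u.Valid G)
    (h : ¬ TreeReduced u) (n : ℕ) :
    ∃ u' : ParseTree T G.NT, u'.Valid G ∧ u'.root = u.root ∧ u'.yield = u.yield ∧
      n ≤ u'.postorder.length := by
  simp only [TreeReduced, not_forall, not_not] at h
  obtain ⟨r, cs, c, b, hs, hc, hb, hroot, hlen⟩ := h
  set a : ParseTree T G.NT := .node r cs with ha
  have hba : Subtree b a := .child r cs b c hc hb
  have hyield : b.yield = a.yield := hba.yield_infix.eq_of_length hlen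
  have hlt : b.postorder.length < a.postorder.length := by
    have h1 := hb.length_le
    obtain ⟨l, m, rfl⟩ := List.append_of_mem hc
    simp only [ha, ParseTree.postorder, postorderForest_append, ParseTree.postorderForest,
      List.length_append, List.length_cons]
    omega
  have hpump : ∀ m, ∃ a' : ParseTree T G.NT, a'.Valid G ∧ a'.root = a.root ∧
      a'.yield = a.yield ∧ m ≤ a'.postorder.length := by
    intro m
    induction m with
    | zero => exact ⟨a, hs.valid hu, rfl, rfl, Nat.zero_le _⟩
    | succ m ih =>
      obtain ⟨a', hv, hr, hy, hl⟩ := ih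
      obtain ⟨a'', hv', hr', hy', hl'⟩ := hba.replace (hs.valid hu) hv (hr.trans hroot.symm)
        (hy.trans hyield.symm)
      exact ⟨a'', hv', hr', hy', by omega⟩
  -- The summand `a.postorder.length` compensates for the removal of `a` from `u`.
  obtain ⟨a', hv, hr, hy, hl⟩ := hpump (n + a.postorder.length)
  obtain ⟨u', hv', hr', hy', hl'⟩ := hs.replace hu hv hr hy
  exact ⟨u', hv', hr', hy', by omega⟩

theorem postorderForest_length {N : Type} (fs : List (ParseTree T N)) :
    (ParseTree.postorderForest fs).length = (fs.map fun c => c.postorder.length).sum := by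
  induction fs with
  | nil => rfl
  | cons c cs ih => simp [ParseTree.postorderForest, ih]

theorem yieldForest_length {N : Type} (fs : List (ParseTree T N)) :
    (ParseTree.yieldForest fs).length = (fs.map fun c => c.yield.length).sum := by
  induction fs with
  | nil => rfl
  | cons c cs ih => simp [ParseTree.yieldForest, ih]

/-- Here `f` is a size and `n` a weight. Weightless elements cost at most `D`, all others have a
reserve `h`. If the total weight is `N`, either a single element carries all of it and the bound `M`
applies to that element, or at least two elements have positive weight and each contributes its
reserve. -/
theorem sum_map_le_of_weights {α : Type*} (f n : α → ℕ) {D C h M N K : ℕ} (l : List α)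
    (h0 : ∀ c ∈ l, n c = 0 → f c ≤ D) (h1 : ∀ c ∈ l, 0 < n c → f c + h ≤ C * n c)
    (h2 : ∀ c ∈ l, n c = N → f c + K ≤ M) :
    ((l.map n).sum = 0 → (l.map f).sum ≤ l.length * D) ∧
    (0 < (l.map n).sum → (l.map f).sum + h ≤ l.length * D + C * (l.map n).sum) ∧
    (0 < (l.map n).sum → (l.map n).sum = N →
      (l.map f).sum + K ≤ l.length * D + M ∨ (l.map f).sum + 2 * h ≤ l.length * D + C * N) := by
  induction l with
  | nil => simp
  | cons c l ih =>
    obtain ⟨i0, i1, i2⟩ := ih (fun d hd => h0 d (by simp [hd])) (fun d hd => h1 d (by simp [hd]))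
      (fun d hd => h2 d (by simp [hd]))
    have g0 := h0 c (by simp)
    have g1 := h1 c (by simp)
    have g2 := h2 c (by simp)
    simp only [List.map_cons, List.sum_cons, List.length_cons, Nat.add_mul, Nat.mul_add,
      Nat.one_mul]
    generalize (l.map n).sum = S at *
    generalize (l.map f).sum = F at *
    generalize l.length * D = L at *
    rcases Nat.eq_zero_or_pos (n c) with hc | hc
    · have g0 := g0 hc
      simp only [hc, Nat.zero_add, Nat.mul_zero]
      refine ⟨fun hS => ?_, fun hS => ?_, fun hS hN => ?_⟩
      · have := i0 hS; omega
      · have := i1 hS; omega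
      · have := i2 hS hN; omega
    · have g1 := g1 hc
      rcases Nat.eq_zero_or_pos S with hS | hS
      · have i0 := i0 hS
        subst hS
        refine ⟨by omega, fun _ => by omega, fun _ hN => ?_⟩
        have := g2 (by omega)
        omega
      · have i1 := i1 hS
        refine ⟨by omega, fun _ => by omega, fun _ hN => ?_⟩
        right
        rw [← hN, Nat.mul_add]
        omega

/-- The bound on the size of a reduced tree with empty yield. -/
def emptyBound (b : ℕ) : ℕ → ℕ
  | 0 => 0
  | m + 1 => 1 + b * emptyBound b m

/-- `A` contains the nonterminals of all nodes whose yield is as long as that of the root. On a path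
of such nodes no nonterminal repeats, so passing to a child with the full yield removes `r.input`
from `A`, at the price `E` for the node and its children of empty yield. If the yield is split among
several children, their reserves pay for the node. -/
theorem TreeReduced.length_le [Fintype G.NT] [DecidableEq G.NT] {b E C : ℕ}
    (hb : ∀ r ∈ G.rules, r.output.length ≤ b)
    (hE : E = 1 + b * emptyBound b (Fintype.card G.NT))
    (hC : C = 2 * (Fintype.card G.NT * E + 1) + E)
    {u : ParseTree T G.NT} (hu : u.Valid G) :
    ∀ (_ : TreeReduced u) (A : Finset G.NT)
      (_ : ∀ r cs, Subtree (.node r cs) u →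
        (ParseTree.node r cs).yield.length = u.yield.length → r.input ∈ A),
      (u.yield.length = 0 → u.postorder.length ≤ emptyBound b A.card) ∧
      (0 < u.yield.length → u.postorder.length + C ≤ C * u.yield.length + A.card * E + 1) := by
  induction hu with
  | leaf a => intro _ A _; simp [ParseTree.yield, ParseTree.postorder]; omega
  | node r cs hr hroot hcs ih =>
    intro hred A hA
    have hrA : r.input ∈ A := hA r cs (.refl _) rfl
    have hcard : (A.erase r.input).card + 1 = A.card := Finset.card_erase_add_one hrA
    have hlen : cs.length ≤ b := by rw [← cs.length_map ParseTree.root, hroot]; exact hb r hr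
    have hredc : ∀ c ∈ cs, TreeReduced c := fun c hc => hred.subtree (.child r cs c c hc (.refl c))
    have hsame : ∀ c ∈ cs, c.yield.length = (ParseTree.node r cs).yield.length →
        ∀ r' cs', Subtree (.node r' cs') c →
          (ParseTree.node r' cs').yield.length = c.yield.length → r'.input ∈ A.erase r.input := by
      intro c hc hcl r' cs' hs hl
      refine Finset.mem_erase.2 ⟨fun he => ?_, hA r' cs' (.child r cs _ c hc hs) (hl.trans hcl)⟩
      exact hred r cs c _ (.refl _) hc hs (by simp [ParseTree.root, he]) (hl.trans hcl)
    have hyl : (ParseTree.node r cs).yield.length = (cs.map fun c => c.yield.length).sum := by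
      simp [ParseTree.yield, yieldForest_length]
    have hpl : (ParseTree.node r cs).postorder.length =
        (cs.map fun c => c.postorder.length).sum + 1 := by
      simp [ParseTree.postorder, postorderForest_length]
    have huniv : ∀ c ∈ cs, (c.yield.length = 0 →
        c.postorder.length ≤ emptyBound b (Fintype.card G.NT)) ∧ (0 < c.yield.length →
          c.postorder.length + C ≤ C * c.yield.length + Fintype.card G.NT * E + 1) := by
      intro c hc
      have := ih c hc (hredc c hc) Finset.univ (fun _ _ _ _ => Finset.mem_univ _)
      rwa [Finset.card_univ] at this
    -- The reserve is `h = C - (Fintype.card G.NT * E + 1)`, and `C` is chosen so that `2 * h = C +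
    -- E`: two children with nonempty yield recover `C` and the cost `E` of the node together with
    -- its empty children.
    have key := sum_map_le_of_weights (fun c : ParseTree T G.NT => c.postorder.length)
      (fun c => c.yield.length) (D := emptyBound b (Fintype.card G.NT)) (C := C)
      (h := Fintype.card G.NT * E + 1 + E)
      (M := C * (ParseTree.node r cs).yield.length + (A.erase r.input).card * E + 1)
      (N := (ParseTree.node r cs).yield.length) (K := C) cs
      (fun c hc h => (huniv c hc).1 h) (fun c hc h => by have := (huniv c hc).2 h; omega)
    constructor
    · intro h0
      rw [hpl, ← hcard]
      have hsum : (cs.map fun c => c.postorder.length).sum ≤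
          cs.length * emptyBound b (A.erase r.input).card := by
        refine (List.sum_le_card_nsmul _ (emptyBound b (A.erase r.input).card) ?_).trans (by simp)
        intro m hm
        obtain ⟨c, hc, rfl⟩ := List.mem_map.1 hm
        have hc0 : c.yield.length = 0 := by
          have := (yield_infix_of_mem hc).length_le
          simp only [ParseTree.yield] at h0
          omega
        exact (ih c hc (hredc c hc) _ (hsame c hc (by rw [hc0, h0]))).1 hc0
      have := Nat.mul_le_mul_right (emptyBound b (A.erase r.input).card) hlen
      simp only [emptyBound]
      omega
    · intro hpos
      have h2 := (key (fun c hc h =>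
        by
          have := (ih c hc (hredc c hc) _ (hsame c hc h)).2 (by omega)
          rw [h] at this
          exact this)).2.2 (by rw [← hyl]; exact hpos) hyl.symm
      have h3 := Nat.mul_le_mul_right (emptyBound b (Fintype.card G.NT)) hlen
      rw [hpl, ← hcard, Nat.add_mul]
      generalize C * (ParseTree.node r cs).yield.length = X at *
      generalize (A.erase r.input).card * E = Y at *
      generalize Fintype.card G.NT * E = Z at *
      rcases h2 with h2 | h2 <;> omega

theorem vertices_finite [Finite T] (G : ContextFreeGrammar T) [Finite G.NT] (k : ℕ) :
    {v : LRItem T G.NT | v.IsVertex G k}.Finite := by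
  have : Fintype T := Fintype.ofFinite T
  have hl : {l : List (Option T) | l.length = k}.Finite := List.finite_length_eq _ k
  have hp : (⋃ r ∈ (G.rules : Set (ContextFreeRule T G.NT)),
      (fun q : ℕ × List (Option T) =>
        (⟨r, r.output.take q.1, r.output.drop q.1, q.2⟩ : LRItem T G.NT)) ''
        (Set.Iic r.output.length ×ˢ {l : List (Option T) | l.length = k})).Finite :=
    Set.Finite.biUnion G.rules.finite_toSet fun r _ =>
      ((Set.finite_Iic _).prod hl).image _
  refine hp.subset ?_
  rintro ⟨r, pre, post, look⟩ ⟨hr, hout, hlook⟩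
  simp only [Set.mem_iUnion]
  have hout' : r.output = pre ++ post := hout
  refine ⟨r, hr, ⟨pre.length, look⟩, ⟨by simp [hout'], ?_⟩, by simp [hout']⟩
  obtain ⟨u, v, -, y, -, rfl⟩ := hlook
  simp

theorem eval_subset_vertices (hG : StartNormal G) (γ : List (Symbol T G.NT)) :
    (lrNFA G k).eval γ ⊆ {v | v.IsVertex G k} :=
  fun w hw => (itemContext_of_mem_eval hG γ w hw).vertex

theorem states_finite [Finite T] [Finite G.NT] (hG : StartNormal G) :
    (Set.range (lrNFA G k).eval).Finite := by
  refine (vertices_finite G k).finite_subsets.subset ?_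
  rintro _ ⟨γ, rfl⟩
  exact eval_subset_vertices hG γ

theorem eval_append (γ δ : List (Symbol T G.NT)) :
    (lrNFA G k).eval (γ ++ δ) = δ.foldl (lrNFA G k).stepSet ((lrNFA G k).eval γ) := by
  simp [εNFA.eval, εNFA.evalFrom, List.foldl_append]

theorem eval_append_congr {γ γ' : List (Symbol T G.NT)} (δ : List (Symbol T G.NT))
    (h : (lrNFA G k).eval γ = (lrNFA G k).eval γ') :
    (lrNFA G k).eval (γ ++ δ) = (lrNFA G k).eval (γ' ++ δ) := by
  rw [eval_append, eval_append, h]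

theorem eval_append_replicate {γ δ : List (Symbol T G.NT)}
    (h : (lrNFA G k).eval (γ ++ δ) = (lrNFA G k).eval γ) (m : ℕ) :
    (lrNFA G k).eval (γ ++ (List.replicate m δ).flatten) = (lrNFA G k).eval γ := by
  induction m with
  | zero => simp
  | succ m ih =>
    rw [List.replicate_succ, List.flatten_cons, ← List.append_assoc]
    rw [eval_append_congr _ h, ih]

theorem postorder_ne_nil {N : Type} (c : ParseTree T N) : c.postorder ≠ [] := by
  cases c <;> simp [ParseTree.postorder]

/-- In a live forest, no part with empty yield leads from a state to itself. -/
theorem eq_nil_of_loop (hG : StartNormal G) {t : ℕ} (hX : IsXLR G k t)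
    {f₁ f₂ f₃ : List (ParseTree T G.NT)} (hf : ForestValid G (f₁ ++ f₂ ++ f₃))
    {l : List (Option T)} (hl : l.length = k)
    (ha : (actionsAt G k ((lrNFA G k).eval ((f₁ ++ f₂ ++ f₃).map ParseTree.root)) l).Nonempty)
    (hy : ParseTree.yieldForest f₂ = [])
    (hloop : (lrNFA G k).eval ((f₁ ++ f₂).map ParseTree.root) =
      (lrNFA G k).eval (f₁.map ParseTree.root)) : f₂ = [] := by
  by_contra hne
  -- Repeating `f₂` changes neither the yield nor the state, so the action stays available, while
  -- the operation sequence grows beyond `B`.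
  obtain ⟨B, hB⟩ := exists_length_bound hG hX (ParseTree.yieldForest (f₁ ++ f₂ ++ f₃)) hl
  have hlen2 : ∀ m, m ≤ (ParseTree.postorderForest (List.replicate m f₂).flatten).length ∧
      ParseTree.yieldForest (List.replicate m f₂).flatten = [] := by
    intro m
    induction m with
    | zero => simp [ParseTree.yieldForest]
    | succ m ih =>
      rw [List.replicate_succ, List.flatten_cons]
      refine ⟨?_, by rw [yieldForest_append, hy, ih.2]; rfl⟩
      rw [postorderForest_append, List.length_append]
      obtain ⟨c, cs, rfl⟩ := List.exists_cons_of_ne_nil hne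
      have := List.length_pos_of_ne_nil (postorder_ne_nil c)
      simp only [ParseTree.postorderForest, List.length_append]
      omega
  have hsub : ∀ c ∈ f₁ ++ (List.replicate (B + 1) f₂).flatten ++ f₃, c ∈ f₁ ++ f₂ ++ f₃ := by
    intro c hc
    simp only [List.mem_append, List.mem_flatten, List.mem_replicate] at hc ⊢
    rcases hc with (hc | ⟨_, ⟨_, rfl⟩, hc⟩) | hc <;> simp [hc]
  have := hB (f₁ ++ (List.replicate (B + 1) f₂).flatten ++ f₃)
    (fun c hc => hf c (hsub c hc))
    (by simp [yieldForest_append, (hlen2 (B + 1)).2, hy]) (by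
      suffices h : (lrNFA G k).eval
          ((f₁ ++ (List.replicate (B + 1) f₂).flatten ++ f₃).map ParseTree.root) =
          (lrNFA G k).eval ((f₁ ++ f₂ ++ f₃).map ParseTree.root) by rwa [h]
      rw [List.map_append, List.map_append (l₁ := f₁ ++ f₂)]
      refine eval_append_congr _ ?_
      rw [hloop, List.map_append, List.map_flatten, List.map_replicate]
      exact eval_append_replicate (by rw [← hloop, List.map_append]) _)
  simp only [postorderForest_append, List.length_append] at this
  have := (hlen2 (B + 1)).1
  omega

/-- A pumped tree has the same root, hence leads to the same automaton state, and it has the same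
yield. The enlarged forest would therefore be live on the same lookahead and violate the length
bound. -/
theorem TreeReduced.of_live (hG : StartNormal G) {t : ℕ} (hX : IsXLR G k t)
    {fs : List (ParseTree T G.NT)} (hf : ForestValid G fs)
    {l : List (Option T)} (hl : l.length = k)
    (ha : (actionsAt G k ((lrNFA G k).eval (fs.map ParseTree.root)) l).Nonempty) :
    ∀ u ∈ fs, TreeReduced u := by
  intro u hu
  by_contra hred
  obtain ⟨B, hB⟩ := exists_length_bound hG hX (ParseTree.yieldForest fs) hl
  obtain ⟨u', hv, hr, hy, hlen⟩ := exists_large_of_not_reduced (hf u hu) hred (B + 1)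
  obtain ⟨f₁, f₂, rfl⟩ := List.append_of_mem hu
  have := hB (f₁ ++ u' :: f₂) (fun c hc => by
      simp only [List.mem_append, List.mem_cons] at hc
      rcases hc with hc | rfl | hc
      · exact hf c (by simp [hc])
      · exact hv
      · exact hf c (by simp [hc]))
    (by simp [yieldForest_append, ParseTree.yieldForest, hy]) (by simpa [hr] using ha)
  simp only [postorderForest_append, ParseTree.postorderForest, List.length_append] at this
  omega

/-- Pigeonhole over the initial parts of the forest: two of them with the same state and the same
length of yield would enclose a loop with empty yield, which `eq_nil_of_loop` excludes. `Q` is the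
number of states. -/
theorem exists_stack_bound [Finite T] [Finite G.NT] (hG : StartNormal G) {t : ℕ}
    (hX : IsXLR G k t) : ∃ Q, ∀ (fs : List (ParseTree T G.NT)) (l : List (Option T)),
      ForestValid G fs → l.length = k →
      (actionsAt G k ((lrNFA G k).eval (fs.map ParseTree.root)) l).Nonempty →
      fs.length ≤ Q * ((ParseTree.yieldForest fs).length + 1) := by
  have hfin := states_finite (k := k) hG
  refine ⟨hfin.toFinset.card, fun fs l hf hl ha => ?_⟩
  set n := (ParseTree.yieldForest fs).length
  have hcard := Finset.card_le_card_of_injOn (s := Finset.range (fs.length + 1))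
    (t := hfin.toFinset ×ˢ Finset.range (n + 1))
    (fun i => ((lrNFA G k).eval ((fs.take i).map ParseTree.root),
      (ParseTree.yieldForest (fs.take i)).length)) (by
      intro i _
      simp only [Finset.coe_product, Set.mem_prod, Finset.mem_coe, Set.Finite.mem_toFinset,
        Finset.mem_range]
      refine ⟨⟨_, rfl⟩, Nat.lt_succ_of_le ?_⟩
      have := congrArg (fun f => (ParseTree.yieldForest f).length) (List.take_append_drop i fs)
      simp only [yieldForest_append, List.length_append] at this
      omega) (by
      have main : ∀ i j, i ≤ j → j ≤ fs.length →
          (lrNFA G k).eval ((fs.take i).map ParseTree.root) =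
            (lrNFA G k).eval ((fs.take j).map ParseTree.root) →
          (ParseTree.yieldForest (fs.take i)).length = (ParseTree.yieldForest (fs.take j)).length →
          i = j := by
        intro i j hij hj h1 h2
        obtain ⟨d, rfl⟩ := Nat.exists_eq_add_of_le hij
        have e1 : fs.take (i + d) = fs.take i ++ (fs.drop i).take d := List.take_add
        have e2 : fs = fs.take i ++ (fs.drop i).take d ++ fs.drop (i + d) := by
          rw [← e1, List.take_append_drop]
        rw [e1, yieldForest_append, List.length_append] at h2
        have := eq_nil_of_loop hG hX (f₁ := fs.take i) (f₂ := (fs.drop i).take d)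
          (f₃ := fs.drop (i + d)) (e2 ▸ hf) hl (e2 ▸ ha)
          (List.eq_nil_of_length_eq_zero (by omega)) (by rw [← e1, ← h1])
        have := congrArg List.length this
        simp only [List.length_take, List.length_drop, List.length_nil] at this
        omega
      intro i hi j hj h
      simp only [Prod.mk.injEq] at h
      simp only [Finset.coe_range, Set.mem_Iio] at hi hj
      rcases le_total i j with hij | hij
      · exact main i j hij (by omega) h.1 h.2
      · exact (main j i hij (by omega) h.1.symm h.2.symm).symm)
  rw [Finset.card_product, Finset.card_range, Finset.card_range] at hcard
  omega

/-- The operations of a live copy are linearly many. -/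
theorem exists_live_bound [Finite T] [Finite G.NT] (hG : StartNormal G) {t : ℕ}
    (hX : IsXLR G k t) : ∃ C, ∀ (fs : List (ParseTree T G.NT)) (l : List (Option T)),
      ForestValid G fs → l.length = k →
      (actionsAt G k ((lrNFA G k).eval (fs.map ParseTree.root)) l).Nonempty →
      (ParseTree.postorderForest fs).length ≤ C * ((ParseTree.yieldForest fs).length + 1) := by
  classical
  have : Fintype G.NT := Fintype.ofFinite _
  obtain ⟨Q, hQ⟩ := exists_stack_bound hG hX
  obtain ⟨b, hb⟩ : ∃ b, ∀ r ∈ G.rules, r.output.length ≤ b :=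
    ⟨G.rules.sup fun r => r.output.length, fun r hr =>
      Finset.le_sup (f := fun r : ContextFreeRule T G.NT => r.output.length) hr⟩
  set D := emptyBound b (Fintype.card G.NT) with hD
  set E := 1 + b * D with hE
  set C := 2 * (Fintype.card G.NT * E + 1) + E with hC
  refine ⟨C + D * Q, fun fs l hf hl ha => ?_⟩
  have hred := TreeReduced.of_live hG hX hf hl ha
  -- A tree with nonempty yield is bounded by `C` times its yield, since the additive term in
  -- `TreeReduced.length_le` is at most `C`; a tree with empty yield costs at most `D`.
  have hs : ∀ gs : List (ParseTree T G.NT), (∀ c ∈ gs, c ∈ fs) →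
      (ParseTree.postorderForest gs).length ≤
        C * (ParseTree.yieldForest gs).length + D * gs.length := by
    intro gs
    induction gs with
    | nil => simp [ParseTree.postorderForest]
    | cons c gs ih =>
      intro h
      have h1 := ih fun d hd => h d (by simp [hd])
      have h2 := TreeReduced.length_le hb hE hC (hf c (h c (by simp))) (hred c (h c (by simp)))
        Finset.univ (fun _ _ _ _ => Finset.mem_univ _)
      rw [Finset.card_univ] at h2
      simp only [ParseTree.postorderForest, ParseTree.yieldForest, List.length_append,
        List.length_cons, Nat.mul_add, Nat.mul_one]
      rcases Nat.eq_zero_or_pos c.yield.length with h0 | h0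
      · have := h2.1 h0; omega
      · have := h2.2 h0; omega
  have h1 := hs fs fun c hc => hc
  have h2 := Nat.mul_le_mul_left D (hQ fs l hf hl ha)
  rw [← Nat.mul_assoc] at h2
  rw [Nat.add_mul]
  have h3 := Nat.mul_le_mul_left C (Nat.le_add_right (ParseTree.yieldForest fs).length 1)
  omega

/-- Every run performs linearly many operations. -/
theorem exists_run_bound [Finite T] [Finite G.NT] (hG : StartNormal G) {t : ℕ}
    (hX : IsXLR G k t) : ∃ C, ∀ (x : List T) (p : List (LROp T G.NT)) (o : Outcome G),
      Run G k x p o → p.length ≤ C * (x.length + 1) := by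
  obtain ⟨C, hC⟩ := exists_live_bound hG hX
  have hlive : ∀ (x : List T) (p : List (LROp T G.NT)) (c : Config G) (a : LRAction T G.NT),
      Run G k x p (.running c) → a ∈ c.actions k → p.length ≤ C * (x.length + 1) := by
    intro x p c a h ha
    obtain ⟨fs, y, hf, rfl, rfl, rfl⟩ := h.exists_forest hG
    rw [actions_configOf_reverse] at ha
    refine (hC fs _ hf (lookahead_length _ _) ⟨a, ha⟩).trans (Nat.mul_le_mul_left _ ?_)
    simp
  -- The extra `1` pays for the last operation, after which the copy need not be live.
  refine ⟨C + 1, fun x p o h => ?_⟩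
  rw [Nat.add_mul]
  induction h with
  | init => simp
  | noAction p c h ha ih => exact ih
  | step p c a h ha _ =>
    have h1 := hlive x p c a h ha
    have h2 : (c.op a).length ≤ 1 := by
      cases a with
      | shift => simp only [Config.op]; cases c.rest <;> simp
      | reduce r => simp [Config.op]
    rw [List.length_append]
    omega

end Pumping

/-! ### Reduction sequences -/

section Reductions

variable {T : Type} {G : ContextFreeGrammar T} {k : ℕ}

/-- State stacks, tops first. -/
abbrev StateStack (G : ContextFreeGrammar T) : Type := List (Set (LRItem T G.NT))

/-- `Red G k l st ρ res`: on lookahead `l`, the reductions `ρ` lead from the stack `st` to a stack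
on which `Shift` is possible (`res = some _`) or to a completed parse (`res = none`). -/
inductive Red (G : ContextFreeGrammar T) (k : ℕ) (l : List (Option T)) :
    StateStack G → List (LROp T G.NT) → Option (StateStack G) → Prop
  | ready (S : Set (LRItem T G.NT)) (st : StateStack G) (h : .shift ∈ actionsAt G k S l) :
      Red G k l (S :: st) [] (some (S :: st))
  | accept (S : Set (LRItem T G.NT)) (st : StateStack G) (r : ContextFreeRule T G.NT)
      (h : .reduce r ∈ actionsAt G k S l) (hr : r.input = G.initial) :
      Red G k l (S :: st) [.reduce r] none
  | step (S : Set (LRItem T G.NT)) (st : StateStack G) (r : ContextFreeRule T G.NT)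
      (q : Set (LRItem T G.NT)) (st' : StateStack G) (ρ : List (LROp T G.NT))
      (res : Option (StateStack G)) (h : .reduce r ∈ actionsAt G k S l)
      (hr : r.input ≠ G.initial) (hd : (S :: st).drop r.output.length = q :: st')
      (hrec : Red G k l (dfaStep G k q (.nonterminal r.input) :: q :: st') ρ res) :
      Red G k l (S :: st) (.reduce r :: ρ) res

/-- The state stack above which a forest has been pushed. -/
def forestStack (G : ContextFreeGrammar T) (k : ℕ) (fs : List (ParseTree T G.NT)) :
    StateStack G :=
  stackStates G k (fs.map ParseTree.root).reverse

theorem forestStack_eq_cons (fs : List (ParseTree T G.NT)) :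
    forestStack G k fs =
      (lrNFA G k).eval (fs.map ParseTree.root) :: (forestStack G k fs).tail := by
  unfold forestStack
  rw [stackStates_eq_cons, List.reverse_reverse, List.tail_cons]

theorem forestStack_append (fs gs : List (ParseTree T G.NT)) :
    (forestStack G k (fs ++ gs)).drop gs.length = forestStack G k fs := by
  unfold forestStack
  rw [stackStates_drop _ _ (by simp), List.map_append, List.reverse_append]
  rw [List.drop_left' (by simp)]

theorem forestStack_concat (fs : List (ParseTree T G.NT)) (c : ParseTree T G.NT) :
    forestStack G k (fs ++ [c]) =
      dfaStep G k ((lrNFA G k).eval (fs.map ParseTree.root)) c.root :: forestStack G k fs := by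
  unfold forestStack
  rw [List.map_append, List.reverse_append, List.map_singleton, List.reverse_singleton,
    List.singleton_append, stackStates_cons, List.reverse_reverse]

theorem exists_forest_of_reduce (hG : StartNormal G) {fs : List (ParseTree T G.NT)}
    (hf : ForestValid G fs) {l : List (Option T)} {r : ContextFreeRule T G.NT}
    (ha : .reduce r ∈ actionsAt G k ((lrNFA G k).eval (fs.map ParseTree.root)) l) :
    ∃ gs cs, fs = gs ++ cs ∧ cs.length = r.output.length ∧ ForestValid G gs ∧
      (ParseTree.node r cs).Valid G ∧
      (r.input = G.initial → gs = [] ∧ l = List.replicate k none) := by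
  obtain ⟨cs, rem, h1, h2, h3, h4⟩ := exists_handle (syn := fs.reverse) hG hf.reverse
    (by rwa [List.map_reverse, List.reverse_reverse])
  have hfs : fs = rem.reverse ++ cs := by rw [← List.reverse_reverse fs, h1]; simp
  refine ⟨rem.reverse, cs, hfs, h2, fun c hc => hf c (hfs ▸ by simp at hc; simp [hc]), h3,
    fun h => ?_⟩
  obtain ⟨rfl, hl⟩ := h4 h
  exact ⟨rfl, hl⟩

/-- The result of a reduction on the stack of a forest. -/
theorem forestStack_reduce {gs cs : List (ParseTree T G.NT)} {r : ContextFreeRule T G.NT}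
    (hlen : cs.length = r.output.length) {q : Set (LRItem T G.NT)} {st : StateStack G}
    (hd : (forestStack G k (gs ++ cs)).drop r.output.length = q :: st) :
    forestStack G k (gs ++ [.node r cs]) =
      dfaStep G k q (.nonterminal r.input) :: q :: st := by
  rw [← hlen, forestStack_append] at hd
  rw [forestStack_concat, hd]
  rw [forestStack_eq_cons] at hd
  rw [(List.cons_eq_cons.1 hd).1]
  rfl

theorem postorderForest_reduce (gs cs : List (ParseTree T G.NT)) (r : ContextFreeRule T G.NT) :
    ParseTree.postorderForest (gs ++ [.node r cs]) =
      ParseTree.postorderForest (gs ++ cs) ++ [.reduce r] := by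
  simp [postorderForest_append, ParseTree.postorderForest, ParseTree.postorder]

theorem yieldForest_reduce (gs cs : List (ParseTree T G.NT)) (r : ContextFreeRule T G.NT) :
    ParseTree.yieldForest (gs ++ [.node r cs]) = ParseTree.yieldForest (gs ++ cs) := by
  simp [yieldForest_append, ParseTree.yieldForest, ParseTree.yield]

/-- A reduction on the state stack of a forest is a reduction of the forest, since the handle lies
on top. So reductions of bare state stacks, which are all that the machine sees, belong to actual
parses. -/
theorem Red.forest (hG : StartNormal G) {l : List (Option T)} {st : StateStack G}
    {ρ : List (LROp T G.NT)} {res : Option (StateStack G)} (h : Red G k l st ρ res) :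
    ∀ fs, ForestValid G fs → forestStack G k fs = st →
      (∀ st', res = some st' → ∃ fs', ForestValid G fs' ∧
        ParseTree.yieldForest fs' = ParseTree.yieldForest fs ∧
        ParseTree.postorderForest fs' = ParseTree.postorderForest fs ++ ρ ∧
        forestStack G k fs' = st' ∧
        .shift ∈ actionsAt G k ((lrNFA G k).eval (fs'.map ParseTree.root)) l) ∧
      (res = none → l = List.replicate k none ∧
        IsLRParse G (ParseTree.yieldForest fs) (ParseTree.postorderForest fs ++ ρ)) := by
  induction h with
  | ready S st h =>
    intro fs hf hst
    have hS : (lrNFA G k).eval (fs.map ParseTree.root) = S := by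
      rw [forestStack_eq_cons] at hst; exact (List.cons_eq_cons.1 hst).1
    refine ⟨?_, by simp⟩
    rintro _ ⟨⟩
    exact ⟨fs, hf, rfl, by simp, hst, hS ▸ h⟩
  | accept S st r h hr =>
    intro fs hf hst
    have hS : (lrNFA G k).eval (fs.map ParseTree.root) = S := by
      rw [forestStack_eq_cons] at hst; exact (List.cons_eq_cons.1 hst).1
    refine ⟨by simp, fun _ => ?_⟩
    obtain ⟨gs, cs, rfl, hlen, hgs, hv, hin⟩ := exists_forest_of_reduce hG hf (hS ▸ h)
    obtain ⟨rfl, hl⟩ := hin hr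
    exact ⟨hl, .node r cs, ⟨hv, by simp [ParseTree.root, hr], by simp [ParseTree.yield]⟩,
      by simp [ParseTree.postorder]⟩
  | step S st r q st' ρ res h hr hd _ ih =>
    intro fs hf hst
    have hS : (lrNFA G k).eval (fs.map ParseTree.root) = S := by
      rw [forestStack_eq_cons] at hst; exact (List.cons_eq_cons.1 hst).1
    obtain ⟨gs, cs, rfl, hlen, hgs, hv, hin⟩ := exists_forest_of_reduce hG hf (hS ▸ h)
    rw [← hst] at hd
    have := ih (gs ++ [.node r cs]) (hgs.append (ForestValid.singleton hv))
      (forestStack_reduce hlen hd)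
    rw [postorderForest_reduce, yieldForest_reduce] at this
    simpa using this

/-- Stopping before a shift or at acceptance is stopping exactly where a partial LR parse with this
lookahead ends. Through this fact the XLR property bounds the lists of continuations. -/
theorem Red.isPartial (hG : StartNormal G) {l : List (Option T)}
    {fs : List (ParseTree T G.NT)} (hf : ForestValid G fs)
    {ρ : List (LROp T G.NT)} {res : Option (StateStack G)}
    (h : Red G k l (forestStack G k fs) ρ res) :
    IsPartialLRParse G k (ParseTree.yieldForest fs) l (ParseTree.postorderForest fs ++ ρ) := by
  obtain ⟨h1, h2⟩ := h.forest hG fs hf rfl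
  cases res with
  | none =>
    obtain ⟨rfl, hp⟩ := h2 rfl
    exact hp.isPartial
  | some st =>
    obtain ⟨fs', hf', hy, hp, -, ha⟩ := h1 st rfl
    rw [← hy, ← hp]
    exact isPartial_of_shift hG hf' ha

theorem Red.actions {l : List (Option T)} {fs : List (ParseTree T G.NT)}
    {ρ : List (LROp T G.NT)} {res : Option (StateStack G)}
    (h : Red G k l (forestStack G k fs) ρ res) :
    (actionsAt G k ((lrNFA G k).eval (fs.map ParseTree.root)) l).Nonempty := by
  rw [forestStack_eq_cons] at h
  cases h with
  | ready _ _ h => exact ⟨_, h⟩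
  | accept _ _ r h => exact ⟨_, h⟩
  | step _ _ r _ _ _ _ h => exact ⟨_, h⟩

/-! ### The copies at a cursor position -/

/-- The operation sequence `p` of a copy at cursor position `s` of `x` that is about to shift on the
stack `st` (`res = some st`) or has just completed a parse (`res = none`). -/
def CopyAt (G : ContextFreeGrammar T) (k : ℕ) (x : List T) (s : ℕ) (p : List (LROp T G.NT))
    (res : Option (StateStack G)) : Prop :=
  ∃ fs ρ, ForestValid G fs ∧ ParseTree.yieldForest fs = x.take s ∧
    p = ParseTree.postorderForest fs ++ ρ ∧
    Red G k (lookahead k (x.drop s)) (forestStack G k fs) ρ res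

theorem exists_split_last_shift {N : Type} (p : List (LROp T N)) :
    numShifts p = 0 ∨ ∃ p₀ a σ, p = p₀ ++ .shift a :: σ ∧ numShifts σ = 0 := by
  induction p with
  | nil => exact .inl rfl
  | cons o p ih =>
    rcases ih with h | ⟨p₀, a, σ, rfl, h⟩
    · cases o with
      | shift a => exact .inr ⟨[], a, p, rfl, h⟩
      | reduce r => exact .inl (by simpa [numShifts] using h)
    · exact .inr ⟨o :: p₀, a, σ, rfl, h⟩

theorem Run.running_of_prefix {x : List T} {p p' : List (LROp T G.NT)} {c : Config G}
    (h : Run G k x p (.running c)) (hp : p' <+: p) : ∃ c', Run G k x p' (.running c') := by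
  obtain ⟨r, rfl⟩ := hp
  cases r with
  | nil => exact ⟨c, by simpa using h⟩
  | cons op r =>
    obtain ⟨c', _, h', -⟩ := h.exists_of_prefix (p' := p') (op := op) ⟨r, by simp⟩
    exact ⟨c', h'⟩

/-- Reductions performed by a run can be prepended. -/
theorem Red.of_run (hG : StartNormal G) {x : List T} {fs : List (ParseTree T G.NT)} {y : List T}
    {ρ : List (LROp T G.NT)} {res : Option (StateStack G)}
    (hrun : Run G k x (ParseTree.postorderForest fs) (.running (configOf G k fs.reverse y)))
    (hf : ForestValid G fs)
    (h : Red G k (lookahead k y) (forestStack G k fs) ρ res) (σ : List (LROp T G.NT)) :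
    numShifts σ = 0 → ∀ gs, ForestValid G gs →
      ParseTree.postorderForest fs = ParseTree.postorderForest gs ++ σ →
      Red G k (lookahead k y) (forestStack G k gs) (σ ++ ρ) res := by
  induction σ with
  | nil =>
    intro _ gs hg hp
    obtain rfl := hf.postorder_injective hg (by simpa using hp)
    simpa using h
  | cons o σ ih =>
    intro hσ gs hg hp
    cases o with
    | shift a => simp [numShifts] at hσ
    | reduce r =>
      obtain ⟨c, a, hc, ha, hop⟩ := hrun.exists_of_prefix (p' := ParseTree.postorderForest gs)
        (op := .reduce r) ⟨σ, by rw [hp]; simp⟩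
      obtain ⟨gs', z, hg', rfl, hpg, hx⟩ := hc.exists_forest hG
      obtain rfl := hg.postorder_injective hg' hpg
      obtain rfl : a = .reduce r := by
        cases a with
        | shift => simp only [Config.op] at hop; split at hop <;> simp at hop
        | reduce r' => simpa [Config.op] using hop
      obtain ⟨fs', y', hf', hcf, hpf, hxf, hroot⟩ := hrun.status hG
      obtain rfl := hf.postorder_injective hf' hpf
      obtain rfl : y = y' := by
        simp only [configOf, Config.mk.injEq] at hcf; exact hcf.2.2
      -- No shift lies between `gs` and `fs`, so the cursor is at the same place.
      obtain rfl : z = y := by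
        have h1 := hf.numShifts
        have h2 := hg.numShifts
        rw [hp, numShifts_append, hσ, h2] at h1
        exact (List.append_inj (hx.symm.trans hxf) (by omega)).2
      rw [actions_configOf_reverse] at ha
      obtain ⟨gs₀, cs, rfl, hlen, hgs₀, hv, -⟩ := exists_forest_of_reduce hG hg ha
      have hrec := ih (by simpa [numShifts] using hσ) (gs₀ ++ [.node r cs])
        (hgs₀.append (ForestValid.singleton hv)) (by rw [postorderForest_reduce, hp]; simp)
      have hst := forestStack_append (G := G) (k := k) gs₀ cs
      rw [hlen, forestStack_eq_cons gs₀, forestStack_eq_cons (gs₀ ++ cs)] at hst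
      rw [forestStack_concat, forestStack_eq_cons gs₀] at hrec
      rw [forestStack_eq_cons (gs₀ ++ cs)]
      refine Red.step _ _ r _ _ _ _ ha ?_ hst hrec
      -- A reduction to the start symbol would have halted the run, but the run is still going on
      -- after it.
      intro hin
      obtain ⟨c', hc'⟩ := hrun.running_of_prefix
        (p' := ParseTree.postorderForest (gs₀ ++ [.node r cs]))
        ⟨σ, by rw [postorderForest_reduce, hp]; simp⟩
      obtain ⟨gs₁, -, hg₁, -, hp₁, -, hroot₁⟩ := hc'.status hG
      obtain rfl := ForestValid.postorder_injective
        (hgs₀.append (ForestValid.singleton hv)) hg₁ hp₁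
      exact hroot₁ (.node r cs) (by simp) (by simp [ParseTree.root, hin])

/-- With nothing read, all operations so far are reductions, so the forest in `CopyAt` may be taken
empty. -/
theorem copyAt_zero (hG : StartNormal G) (x : List T) (p : List (LROp T G.NT))
    (res : Option (StateStack G)) :
    CopyAt G k x 0 p res ↔ Red G k (lookahead k x) [dfaStart G k] p res := by
  constructor
  · rintro ⟨fs, ρ, hf, hy, rfl, h⟩
    obtain ⟨a, ha⟩ := h.actions
    have hrun := run_of_action hG hf ha
    have hn := hf.numShifts
    rw [hy] at hn
    simpa [forestStack, stackStates] using
      Red.of_run hG hrun hf h _ hn [] ForestValid.nil rfl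
  · intro h
    exact ⟨[], p, ForestValid.nil, by simp [ParseTree.yieldForest], rfl, by
      simpa [forestStack, stackStates] using h⟩

/-- The recursion followed by the machine comes from splitting at the last shift. By `Red.of_run`
the reductions already contained in the intermediate forest can be moved to the sequence behind that
shift. -/
theorem copyAt_succ (hG : StartNormal G) {x : List T} {s : ℕ} (hs : s < x.length)
    (p : List (LROp T G.NT)) (res : Option (StateStack G)) :
    CopyAt G k x (s + 1) p res ↔ ∃ p₀ q st ρ, CopyAt G k x s p₀ (some (q :: st)) ∧
      p = p₀ ++ .shift x[s] :: ρ ∧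
      Red G k (lookahead k (x.drop (s + 1)))
        (dfaStep G k q (.terminal x[s]) :: q :: st) ρ res := by
  have htake : x.take (s + 1) = x.take s ++ [x[s]] := by
    rw [List.take_succ_eq_append_getElem hs]
  constructor
  · rintro ⟨fs, ρ, hf, hy, rfl, h⟩
    obtain ⟨a, ha⟩ := h.actions
    have hrun := run_of_action hG hf ha
    have hn := hf.numShifts
    rcases exists_split_last_shift (ParseTree.postorderForest fs) with h0 | ⟨p₀, b, σ, hp, hσ⟩
    · rw [h0, hy, htake] at hn; simp at hn; omega
    · obtain ⟨c, a', hc, ha', hop⟩ := hrun.exists_of_prefix (p' := p₀) (op := .shift b)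
        ⟨σ, by rw [hp]; simp⟩
      obtain ⟨f₀, z, hf₀, rfl, rfl, hx⟩ := hc.exists_forest hG
      obtain rfl : a' = .shift := by
        cases a' with
        | shift => rfl
        | reduce r => simp [Config.op] at hop
      have hlen : (ParseTree.yieldForest f₀).length = s := by
        rw [hp, numShifts_append, hf₀.numShifts, hy] at hn
        simp only [numShifts, hσ, List.length_take] at hn
        omega
      rw [hy, List.take_append_drop] at hx
      have hy₀ : ParseTree.yieldForest f₀ = x.take s := by rw [hx, ← hlen, List.take_left]
      have hz : z = x.drop s := by conv_rhs => rw [hx, ← hlen, List.drop_left]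
      rw [actions_configOf_reverse, hz] at ha'
      have hb : b = x[s] := by
        simp only [Config.op, configOf] at hop
        rw [hz, List.drop_eq_getElem_cons hs] at hop
        simpa using hop.symm
      subst hb
      have hred := Red.of_run hG hrun hf h σ hσ (f₀ ++ [.leaf x[s]])
        (hf₀.append (ForestValid.singleton (.leaf _)))
        (by rw [hp]; simp [postorderForest_append, ParseTree.postorderForest,
          ParseTree.postorder])
      rw [forestStack_concat, forestStack_eq_cons f₀] at hred
      refine ⟨ParseTree.postorderForest f₀, _, _, σ ++ ρ,
        ⟨f₀, [], hf₀, hy₀, by simp, ?_⟩, by rw [hp]; simp, hred⟩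
      rw [forestStack_eq_cons]
      exact .ready _ _ ha'
  · rintro ⟨p₀, q, st, ρ, ⟨fs, ρ₀, hf, hy, rfl, h⟩, rfl, hred⟩
    obtain ⟨fs', hf', hy', hp', hst, ha⟩ := (h.forest hG fs hf rfl).1 _ rfl
    refine ⟨fs' ++ [.leaf x[s]], ρ, hf'.append (ForestValid.singleton (.leaf _)), ?_, ?_, ?_⟩
    · rw [htake, yieldForest_append, hy', hy]; rfl
    · rw [postorderForest_append, hp']; simp [ParseTree.postorderForest, ParseTree.postorder]
    · rw [forestStack_concat, hst]
      rw [forestStack_eq_cons] at hst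
      rw [(List.cons_eq_cons.1 hst).1]
      exact hred

/-- An LR parse ends with the reduction to the start symbol, and the stack before that reduction
holds the children of the root. -/
theorem copyAt_length_none (hG : StartNormal G) (x : List T) (p : List (LROp T G.NT)) :
    CopyAt G k x x.length p none ↔ IsLRParse G x p := by
  constructor
  · rintro ⟨fs, ρ, hf, hy, rfl, h⟩
    have := ((h.forest hG fs hf rfl).2 rfl).2
    rwa [hy, List.take_length] at this
  · rintro ⟨P, hP, rfl⟩
    have hrun := run_success_of_isParseTree (k := k) hG hP
    obtain ⟨hv, hroot, hyield⟩ := hP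
    cases hv with
    | leaf a => simp [ParseTree.root] at hroot
    | node r cs hr hout hcs =>
      obtain ⟨c, a, hc, ha, hop⟩ := hrun.exists_of_prefix
        (p' := ParseTree.postorderForest cs) (op := .reduce r) (by simp [ParseTree.postorder])
      obtain ⟨fs, z, hf, rfl, hpf, hx⟩ := hc.exists_forest hG
      obtain rfl := ForestValid.postorder_injective hcs hf hpf
      have hy : ParseTree.yieldForest cs = x := by simpa [ParseTree.yield] using hyield
      obtain rfl : z = [] := by rw [← hy] at hx; simpa using hx
      obtain rfl : a = .reduce r := by
        cases a with
        | shift => simp [Config.op, configOf] at hop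
        | reduce r' => simpa [Config.op] using hop
      rw [actions_configOf_reverse] at ha
      refine ⟨cs, [.reduce r], hcs, by simp [hy], by simp [ParseTree.postorder], ?_⟩
      rw [forestStack_eq_cons]
      exact .accept _ _ _ (by simpa using ha) (by simpa [ParseTree.root] using hroot)

theorem CopyAt.isPartial (hG : StartNormal G) {x : List T} {s : ℕ} {p : List (LROp T G.NT)}
    {res : Option (StateStack G)} (h : CopyAt G k x s p res) :
    IsPartialLRParse G k (x.take s) (lookahead k (x.drop s)) p := by
  obtain ⟨fs, ρ, hf, hy, rfl, h⟩ := h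
  rw [← hy]
  exact h.isPartial hG hf

end Reductions

-- Reductions split at a state, and the tables attached to stacks

section Tables

variable {T : Type} {G : ContextFreeGrammar T} {k : ℕ}

/-- The stack is the state stack of a valid forest. -/
def IsStack (G : ContextFreeGrammar T) (k : ℕ) (st : StateStack G) : Prop :=
  ∃ fs, ForestValid G fs ∧ forestStack G k fs = st

/-- The symbol is the root of a valid tree. -/
def Productive (G : ContextFreeGrammar T) (Y : Symbol T G.NT) : Prop :=
  ∃ c : ParseTree T G.NT, c.Valid G ∧ c.root = Y

theorem productive_terminal (a : T) : Productive G (.terminal a) := ⟨.leaf a, .leaf a, rfl⟩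

theorem isStack_start : IsStack G k [dfaStart G k] :=
  ⟨[], ForestValid.nil, rfl⟩

theorem IsStack.eval_mem {q : Set (LRItem T G.NT)} {st : StateStack G}
    (h : IsStack G k (q :: st)) : q ∈ Set.range (lrNFA G k).eval := by
  obtain ⟨fs, -, h⟩ := h
  rw [forestStack_eq_cons] at h
  exact ⟨_, (List.cons_eq_cons.1 h).1⟩

theorem IsStack.tail {S : Set (LRItem T G.NT)} {st : StateStack G} (h : IsStack G k (S :: st))
    (hst : st ≠ []) : IsStack G k st := by
  obtain ⟨fs, hf, h⟩ := h
  induction fs using List.reverseRecOn with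
  | nil => simp [forestStack, stackStates] at h; exact absurd h.2.symm (by simpa using hst)
  | append_singleton fs c _ =>
    rw [forestStack_concat] at h
    exact ⟨fs, fun d hd => hf d (by simp [hd]), (List.cons_eq_cons.1 h).2⟩

theorem IsStack.of_append {v st : StateStack G} (h : IsStack G k (v ++ st)) (hst : st ≠ []) :
    IsStack G k st := by
  induction v with
  | nil => exact h
  | cons S v ih => exact ih (h.tail (by simp [hst]))

theorem IsStack.push {q : Set (LRItem T G.NT)} {st : StateStack G} (h : IsStack G k (q :: st))
    {Y : Symbol T G.NT} (hY : Productive G Y) : IsStack G k (dfaStep G k q Y :: q :: st) := by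
  obtain ⟨fs, hf, h⟩ := h
  obtain ⟨c, hc, rfl⟩ := hY
  refine ⟨fs ++ [c], hf.append (ForestValid.singleton hc), ?_⟩
  rw [forestStack_concat, h]
  rw [forestStack_eq_cons] at h
  rw [(List.cons_eq_cons.1 h).1]

theorem IsStack.reduce (hG : StartNormal G) {S : Set (LRItem T G.NT)} {st : StateStack G}
    (h : IsStack G k (S :: st)) {l : List (Option T)} {r : ContextFreeRule T G.NT}
    (ha : .reduce r ∈ actionsAt G k S l) :
    Productive G (.nonterminal r.input) ∧ r ∈ G.rules ∧
      IsStack G k ((S :: st).drop r.output.length) := by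
  obtain ⟨fs, hf, h⟩ := h
  have hS : (lrNFA G k).eval (fs.map ParseTree.root) = S := by
    rw [forestStack_eq_cons] at h; exact (List.cons_eq_cons.1 h).1
  obtain ⟨gs, cs, rfl, hlen, hgs, hv, -⟩ := exists_forest_of_reduce hG hf (hS ▸ ha)
  refine ⟨⟨_, hv, rfl⟩, ?_, gs, hgs, ?_⟩
  · cases hv; assumption
  · rw [← h, ← hlen, forestStack_append]

theorem Red.isStack (hG : StartNormal G) {l : List (Option T)} {st st' : StateStack G}
    {ρ : List (LROp T G.NT)} (h : Red G k l st ρ (some st')) (hst : IsStack G k st) :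
    IsStack G k st' := by
  obtain ⟨fs, hf, rfl⟩ := hst
  obtain ⟨fs', hf', -, -, h', -⟩ := (h.forest hG fs hf rfl).1 _ rfl
  exact ⟨fs', hf', h'⟩

/-! ### Reductions relative to a state -/

/-- The outcomes of a reduction sequence that is followed only as long as it stays above a given
state: `pop d X` means that `d` states are to be popped, beginning with the given one, and that
`X` is to be pushed. -/
inductive VOut (G : ContextFreeGrammar T) : Type
  | ready (v : StateStack G) : VOut G
  | accept : VOut G
  | pop (d : ℕ) (X : G.NT) : VOut G

/-- Reductions above the state `q`, on which the states `v` have been pushed. -/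
inductive VRed (G : ContextFreeGrammar T) (k : ℕ) (q : Set (LRItem T G.NT))
    (l : List (Option T)) : StateStack G → List (LROp T G.NT) → VOut G → Prop
  | ready (v : StateStack G) (h : .shift ∈ actionsAt G k (v.headD q) l) :
      VRed G k q l v [] (.ready v)
  | accept (v : StateStack G) (r : ContextFreeRule T G.NT)
      (h : .reduce r ∈ actionsAt G k (v.headD q) l) (hr : r.input = G.initial) :
      VRed G k q l v [.reduce r] .accept
  | step (v : StateStack G) (r : ContextFreeRule T G.NT) (ρ : List (LROp T G.NT)) (o : VOut G)
      (h : .reduce r ∈ actionsAt G k (v.headD q) l) (hr : r.input ≠ G.initial)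
      (hv : r.output.length ≤ v.length)
      (hrec : VRed G k q l (dfaStep G k ((v.drop r.output.length).headD q)
        (.nonterminal r.input) :: v.drop r.output.length) ρ o) :
      VRed G k q l v (.reduce r :: ρ) o
  | pop (v : StateStack G) (r : ContextFreeRule T G.NT)
      (h : .reduce r ∈ actionsAt G k (v.headD q) l) (hr : r.input ≠ G.initial)
      (hv : v.length < r.output.length) :
      VRed G k q l v [.reduce r] (.pop (r.output.length - v.length) r.input)

/-- What remains to be done after an outcome, above the stack `base`. -/
def VOut.Then (k : ℕ) (l : List (Option T)) (base : StateStack G) :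
    VOut G → List (LROp T G.NT) → Option (StateStack G) → Prop
  | .ready v, ρ, res => ρ = [] ∧ res = some (v ++ base)
  | .accept, ρ, res => ρ = [] ∧ res = none
  | .pop d X, ρ, res => ∃ q st, base.drop d = q :: st ∧
      Red G k l (dfaStep G k q (.nonterminal X) :: q :: st) ρ res

theorem append_cons_eq (v st : StateStack G) (q : Set (LRItem T G.NT)) :
    v ++ q :: st = v.headD q :: (v ++ q :: st).tail := by
  cases v <;> simp

theorem VRed.red {q : Set (LRItem T G.NT)} {st : StateStack G} {l : List (Option T)}
    {v : StateStack G} {ρ₁ ρ₂ : List (LROp T G.NT)} {o : VOut G} (h : VRed G k q l v ρ₁ o)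
    {res : Option (StateStack G)} (ho : o.Then k l (q :: st) ρ₂ res) :
    Red G k l (v ++ q :: st) (ρ₁ ++ ρ₂) res := by
  induction h with
  | ready v h =>
    obtain ⟨rfl, rfl⟩ := ho
    rw [append_cons_eq]
    exact .ready _ _ h
  | accept v r h hr =>
    obtain ⟨rfl, rfl⟩ := ho
    rw [append_cons_eq]
    exact .accept _ _ r h hr
  | step v r ρ o h hr hv _ ih =>
    have := ih ho
    rw [List.cons_append, append_cons_eq (v.drop _)] at this
    rw [append_cons_eq]
    refine .step _ _ r _ _ _ _ h hr ?_ this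
    rw [← append_cons_eq, ← append_cons_eq, List.drop_append_of_le_length hv]
  | pop v r h hr hv =>
    obtain ⟨q', st', hd, hrec⟩ := ho
    rw [append_cons_eq]
    refine .step _ _ r _ _ _ _ h hr ?_ hrec
    rw [← append_cons_eq, ← hd, List.drop_append, List.drop_of_length_le hv.le, List.nil_append]

/-- Cut the sequence behind the first reduction whose handle reaches below `v`; if there is none, it
stays above `q` to its end. -/
theorem Red.exists_vred {q : Set (LRItem T G.NT)} {st : StateStack G} {l : List (Option T)}
    {st₀ : StateStack G} {ρ : List (LROp T G.NT)} {res : Option (StateStack G)}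
    (h : Red G k l st₀ ρ res) : ∀ v, st₀ = v ++ q :: st →
      ∃ ρ₁ ρ₂ o, ρ = ρ₁ ++ ρ₂ ∧ VRed G k q l v ρ₁ o ∧ o.Then k l (q :: st) ρ₂ res := by
  induction h with
  | ready S st₁ h =>
    intro v hv
    have hS : S = v.headD q := by rw [append_cons_eq] at hv; exact (List.cons_eq_cons.1 hv).1
    exact ⟨[], [], .ready v, rfl, .ready v (hS ▸ h), rfl, by rw [hv]⟩
  | accept S st₁ r h hr =>
    intro v hv
    have hS : S = v.headD q := by rw [append_cons_eq] at hv; exact (List.cons_eq_cons.1 hv).1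
    exact ⟨[.reduce r], [], .accept, rfl, .accept v r (hS ▸ h) hr, rfl, rfl⟩
  | step S st₁ r q' st' ρ res h hr hd hrec ih =>
    intro v hv
    have hS : S = v.headD q := by rw [append_cons_eq] at hv; exact (List.cons_eq_cons.1 hv).1
    rw [hv] at hd
    rcases le_or_gt r.output.length v.length with hle | hlt
    · rw [List.drop_append_of_le_length hle, append_cons_eq] at hd
      obtain ⟨rfl, hst'⟩ := List.cons_eq_cons.1 hd
      obtain ⟨ρ₁, ρ₂, o, rfl, h1, h2⟩ := ih
        (dfaStep G k ((v.drop r.output.length).headD q) (.nonterminal r.input) ::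
          v.drop r.output.length) (by rw [List.cons_append, append_cons_eq, hst'])
      exact ⟨.reduce r :: ρ₁, ρ₂, o, rfl, .step v r ρ₁ o (hS ▸ h) hr hle h1, h2⟩
    · rw [List.drop_append, List.drop_of_length_le hlt.le, List.nil_append] at hd
      exact ⟨[.reduce r], ρ, _, rfl, .pop v r (hS ▸ h) hr hlt, q', st', hd, hrec⟩

/-- Only an outcome `pop` can be continued. -/
def VOut.IsPop : VOut G → Prop
  | .pop _ _ => True
  | _ => False

theorem VOut.Then.eq_nil {l : List (Option T)} {base : StateStack G} {o : VOut G}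
    {ρ : List (LROp T G.NT)} {res : Option (StateStack G)} (h : o.Then k l base ρ res)
    (ho : ¬ o.IsPop) : ρ = [] := by
  cases o with
  | ready v => exact h.1
  | accept => exact h.1
  | pop d X => exact absurd trivial ho

/-- The productions in the sequence determine the heights of the stack, hence the point at which `q`
is popped. So no sequence arises from two different outcomes, which keeps the generated lists free
of repetitions. Only a `pop` may be followed by further operations. -/
theorem VRed.unique {q : Set (LRItem T G.NT)} {l : List (Option T)}
    {v : StateStack G} {ρ₁ : List (LROp T G.NT)} {o : VOut G} (h : VRed G k q l v ρ₁ o) :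
    ∀ {ρ₁' ρ₂ ρ₂' : List (LROp T G.NT)} {o' : VOut G}, VRed G k q l v ρ₁' o' →
      (¬ o.IsPop → ρ₂ = []) → (¬ o'.IsPop → ρ₂' = []) → ρ₁ ++ ρ₂ = ρ₁' ++ ρ₂' →
      ρ₁ = ρ₁' ∧ o = o' := by
  induction h with
  | ready v h =>
    intro ρ₁' ρ₂ ρ₂' o' h' h2 h2' heq
    have := h2 (by simp [VOut.IsPop]); subst this
    cases h' with
    | ready => exact ⟨rfl, rfl⟩
    | accept _ r => simp at heq
    | step _ r => simp at heq
    | pop _ r => simp at heq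
  | accept v r h hr =>
    intro ρ₁' ρ₂ ρ₂' o' h' h2 h2' heq
    have := h2 (by simp [VOut.IsPop]); subst this
    cases h' with
    | ready => have := h2' (by simp [VOut.IsPop]); subst this; simp at heq
    | accept _ r' => simp at heq; simp [heq.1]
    | step _ r' ρ' _ h' hr' => simp at heq; exact absurd (heq.1 ▸ hr) hr'
    | pop _ r' h' hr' => simp at heq; exact absurd (heq.1 ▸ hr) hr'
  | step v r ρ o h hr hv _ ih =>
    intro ρ₁' ρ₂ ρ₂' o' h' h2 h2' heq
    cases h' with
    | ready => have := h2' (by simp [VOut.IsPop]); subst this; simp at heq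
    | accept _ r' h' hr' => simp at heq; exact absurd (heq.1 ▸ hr') hr
    | step _ r' ρ' _ h' hr' hv' hrec =>
      simp only [List.cons_append, List.cons.injEq, LROp.reduce.injEq] at heq
      obtain ⟨rfl, heq⟩ := heq
      obtain ⟨rfl, rfl⟩ := ih hrec h2 h2' heq
      exact ⟨rfl, rfl⟩
    | pop _ r' h' hr' hv' =>
      simp only [List.cons_append, List.cons.injEq, LROp.reduce.injEq] at heq
      obtain ⟨rfl, heq⟩ := heq
      omega
  | pop v r h hr hv =>
    intro ρ₁' ρ₂ ρ₂' o' h' h2 h2' heq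
    cases h' with
    | ready => have := h2' (by simp [VOut.IsPop]); subst this; simp at heq
    | accept _ r' h' hr' => simp at heq; exact absurd (heq.1 ▸ hr') hr
    | step _ r' ρ' _ h' hr' hv' hrec =>
      simp only [List.cons_append, List.cons.injEq, LROp.reduce.injEq] at heq
      obtain ⟨rfl, heq⟩ := heq
      omega
    | pop _ r' h' hr' hv' =>
      simp only [List.cons_append, List.cons.injEq, LROp.reduce.injEq] at heq
      obtain ⟨rfl, heq⟩ := heq
      exact ⟨rfl, rfl⟩

/-- The state `q` itself is among the popped ones, and a single production reaches no deeper than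
its length. Therefore a table entry depends on boundedly many cells below. -/
theorem VRed.pop_spec (hG : StartNormal G) {q : Set (LRItem T G.NT)} {st : StateStack G}
    {l : List (Option T)} {v : StateStack G} {ρ : List (LROp T G.NT)} {o : VOut G}
    (h : VRed G k q l v ρ o) (hst : IsStack G k (v ++ q :: st)) {d : ℕ} {X : G.NT}
    (ho : o = .pop d X) :
    Productive G (.nonterminal X) ∧ 0 < d ∧ ∃ r ∈ G.rules, d ≤ r.output.length := by
  induction h with
  | ready => cases ho
  | accept => cases ho
  | step v r ρ o h hr hv _ ih =>
    refine ih ?_ ho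
    rw [append_cons_eq] at hst
    obtain ⟨hp, -, hs⟩ := hst.reduce hG h
    rw [← append_cons_eq, List.drop_append_of_le_length hv, append_cons_eq] at hs
    rw [List.cons_append, append_cons_eq (v.drop _)]
    exact hs.push hp
  | pop v r h hr hv =>
    cases ho
    rw [append_cons_eq] at hst
    obtain ⟨hp, hr, -⟩ := hst.reduce hG h
    exact ⟨hp, by omega, r, hr, by omega⟩

theorem mem_rules_of_action {S : Set (LRItem T G.NT)} {l : List (Option T)}
    {r : ContextFreeRule T G.NT} (h : .reduce r ∈ actionsAt G k S l) : r ∈ G.rules := by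
  obtain ⟨w, -, h⟩ := h
  cases h with
  | reduce hv _ => exact hv.1

theorem VRed.mem_rules {q : Set (LRItem T G.NT)} {l : List (Option T)} {v : StateStack G}
    {ρ : List (LROp T G.NT)} {o : VOut G} (h : VRed G k q l v ρ o) :
    ∀ op ∈ ρ, op ∈ LROp.reduce '' (G.rules : Set (ContextFreeRule T G.NT)) := by
  induction h with
  | ready => simp
  | accept v r h => simpa using mem_rules_of_action h
  | step v r ρ o h _ _ _ ih =>
    intro op hop
    rcases List.mem_cons.1 hop with rfl | hop
    · exact ⟨r, mem_rules_of_action h, rfl⟩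
    · exact ih op hop
  | pop v r h => simpa using mem_rules_of_action h

theorem eval_eq_headD {fs : List (ParseTree T G.NT)} {v st : StateStack G}
    {q : Set (LRItem T G.NT)} (h : forestStack G k fs = v ++ q :: st) :
    (lrNFA G k).eval (fs.map ParseTree.root) = v.headD q := by
  rw [forestStack_eq_cons, append_cons_eq] at h
  exact (List.cons_eq_cons.1 h).1

/-- Every stack on the way, before a reduction or at the end with a shift available, belongs to a
live forest with yield `u`, to which `B` applies. The stack after a last reduction need not be live,
whence `B + 1`. -/
theorem VRed.length_le (hG : StartNormal G) {q : Set (LRItem T G.NT)} {st : StateStack G}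
    {l : List (Option T)} {v : StateStack G} {ρ : List (LROp T G.NT)} {o : VOut G}
    (h : VRed G k q l v ρ o) {u : List T} {B : ℕ}
    (hB : ∀ fs, ForestValid G fs → ParseTree.yieldForest fs = u →
      (actionsAt G k ((lrNFA G k).eval (fs.map ParseTree.root)) l).Nonempty →
      (ParseTree.postorderForest fs).length ≤ B) :
    ∀ fs, ForestValid G fs → ParseTree.yieldForest fs = u →
      forestStack G k fs = v ++ q :: st →
      (ParseTree.postorderForest fs).length + ρ.length ≤ B + 1 := by
  induction h with
  | ready v h =>
    intro fs hf hy hst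
    have := hB fs hf hy ⟨_, eval_eq_headD hst ▸ h⟩
    simp; omega
  | accept v r h =>
    intro fs hf hy hst
    have := hB fs hf hy ⟨_, eval_eq_headD hst ▸ h⟩
    simp; omega
  | pop v r h =>
    intro fs hf hy hst
    have := hB fs hf hy ⟨_, eval_eq_headD hst ▸ h⟩
    simp; omega
  | step v r ρ o h hr hv _ ih =>
    intro fs hf hy hst
    obtain ⟨gs, cs, rfl, hlen, hgs, hval, -⟩ :=
      exists_forest_of_reduce hG hf (eval_eq_headD hst ▸ h)
    have hd : (forestStack G k (gs ++ cs)).drop r.output.length =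
        (v.drop r.output.length).headD q :: (v.drop r.output.length ++ q :: st).tail := by
      rw [hst, List.drop_append_of_le_length hv, ← append_cons_eq]
    have := ih (gs ++ [.node r cs]) (hgs.append (ForestValid.singleton hval))
      (by rw [yieldForest_reduce, hy])
      (by rw [forestStack_reduce hlen hd, ← append_cons_eq, List.cons_append])
    rw [postorderForest_reduce, List.length_append] at this
    simp only [List.length_cons, List.length_nil] at *
    omega

theorem finite_lists_of_length_le {α : Type*} {S : Set α} (hS : S.Finite) (n : ℕ) :
    {l : List α | (∀ a ∈ l, a ∈ S) ∧ l.length ≤ n}.Finite := by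
  have : Finite S := hS
  refine ((List.finite_length_le S n).image (List.map Subtype.val)).subset ?_
  rintro l ⟨h1, h2⟩
  lift l to List S using h1
  exact ⟨l, by simpa using h2, rfl⟩

/-- The sequences are bounded in length and use the productions of `G` only, and each has one
outcome. Being finitely many, they can be built into the program as constants. -/
theorem vred_finite (hG : StartNormal G) {t : ℕ} (hX : IsXLR G k t) {q : Set (LRItem T G.NT)}
    {st : StateStack G} {l : List (Option T)} (hl : l.length = k) {v : StateStack G}
    (hst : IsStack G k (v ++ q :: st)) :
    {o : List (LROp T G.NT) × VOut G | VRed G k q l v o.1 o.2}.Finite := by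
  obtain ⟨fs, hf, hst⟩ := hst
  obtain ⟨B, hB⟩ := exists_length_bound hG hX (ParseTree.yieldForest fs) hl
  refine Set.Finite.of_finite_image (f := Prod.fst)
    ((finite_lists_of_length_le (G.rules.finite_toSet.image LROp.reduce) (B + 1)).subset ?_) ?_
  · rintro _ ⟨⟨ρ, o⟩, h, rfl⟩
    have h' : VRed G k q l v ρ o := h
    have := h'.length_le hG hB fs hf rfl hst
    exact ⟨h'.mem_rules, by simp only; omega⟩
  · rintro ⟨ρ, o⟩ h ⟨ρ', o'⟩ h' heq
    obtain rfl : ρ = ρ' := heq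
    have h1 : VRed G k q l v ρ o := h
    have h2 : VRed G k q l v ρ o' := h'
    rw [(h1.unique h2 (ρ₂ := []) (ρ₂' := []) (fun _ => rfl) (fun _ => rfl) rfl).2]

open Classical in
/-- The reduction sequences above `q` and their outcomes. -/
noncomputable def vouts (G : ContextFreeGrammar T) (k : ℕ) (q : Set (LRItem T G.NT))
    (l : List (Option T)) (v : StateStack G) : List (List (LROp T G.NT) × VOut G) :=
  if h : {o : List (LROp T G.NT) × VOut G | VRed G k q l v o.1 o.2}.Finite then h.toFinset.toList
  else []

/-- A copy: its operations (since some moment), and its result, split at a stack that is stored in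
memory. -/
structure Entry (G : ContextFreeGrammar T) : Type where
  ops : List (LROp T G.NT)
  base : StateStack G
  virt : Option (StateStack G)

/-- The result of a copy. -/
def Entry.res (e : Entry G) : Option (StateStack G) := e.virt.map (· ++ e.base)

/-- Further operations in front. -/
def Entry.prepend (ρ : List (LROp T G.NT)) (e : Entry G) : Entry G := { e with ops := ρ ++ e.ops }

/-- `L` lists the pairs in the relation `R`, each of them once. -/
def ListSpec (L : List (Entry G))
    (R : List (LROp T G.NT) → Option (StateStack G) → Prop) : Prop :=
  (L.map Entry.ops).Nodup ∧ ∀ ρ res, R ρ res ↔ ∃ e ∈ L, e.ops = ρ ∧ e.res = res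

/-- The copies that arise from an outcome. -/
def outEntries (base : StateStack G) (tab : ℕ → G.NT → List (Entry G))
    (o : List (LROp T G.NT) × VOut G) : List (Entry G) :=
  match o.2 with
  | .ready v => [⟨o.1, base, some v⟩]
  | .accept => [⟨o.1, base, none⟩]
  | .pop d X => (tab d X).map (Entry.prepend o.1)

/-- The reductions possible after replacing the top `d` states of `st` by the symbol `Y`. -/
def TabRel (G : ContextFreeGrammar T) (k : ℕ) (l : List (Option T)) (st : StateStack G) (d : ℕ)
    (Y : Symbol T G.NT) (ρ : List (LROp T G.NT)) (res : Option (StateStack G)) : Prop :=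
  Productive G Y ∧ ∃ q st', st.drop d = q :: st' ∧
    Red G k l (dfaStep G k q Y :: q :: st') ρ res

/-- The list for a stack is assembled from precomputed outcomes: a finished outcome is one entry,
and `pop d X` contributes the row of `X` in the table `d` levels down, with its own operations in
front. Completeness is the splitting of reduction sequences at `q`; absence of repetitions is
`VRed.unique`. -/
theorem listSpec_vouts (hG : StartNormal G) {t : ℕ} (hX : IsXLR G k t) {q : Set (LRItem T G.NT)}
    {st : StateStack G} {l : List (Option T)} (hl : l.length = k) {v : StateStack G}
    (hst : IsStack G k (v ++ q :: st)) {tab : ℕ → G.NT → List (Entry G)}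
    (htab : ∀ d X, 0 < d → (∃ r ∈ G.rules, d ≤ r.output.length) →
      ListSpec (tab d X) (TabRel G k l (q :: st) d (.nonterminal X))) :
    ListSpec ((vouts G k q l v).flatMap (outEntries (q :: st) tab))
      (Red G k l (v ++ q :: st)) := by
  have hfin := vred_finite hG hX hl hst
  have hmem : ∀ o, o ∈ vouts G k q l v ↔ VRed G k q l v o.1 o.2 := by
    intro o; simp [vouts, hfin]
  have hnd : (vouts G k q l v).Nodup := by
    rw [vouts, dif_pos hfin]; exact Finset.nodup_toList _
  have hent : ∀ o, VRed G k q l v o.1 o.2 → ∀ ρ res,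
      (∃ e ∈ outEntries (q :: st) tab o, e.ops = ρ ∧ e.res = res) ↔
        ∃ ρ₂, ρ = o.1 ++ ρ₂ ∧ o.2.Then k l (q :: st) ρ₂ res := by
    rintro ⟨ρ₁, o⟩ ho ρ res
    cases o with
    | ready v => simp [outEntries, VOut.Then, Entry.res, eq_comm]
    | accept => simp [outEntries, VOut.Then, Entry.res, eq_comm]
    | pop d X =>
      obtain ⟨hp, hd, hr⟩ := ho.pop_spec hG hst rfl
      have h2 := (htab d X hd hr).2
      constructor
      · rintro ⟨e, he, rfl, rfl⟩
        obtain ⟨e', he', rfl⟩ := List.mem_map.1 he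
        exact ⟨e'.ops, rfl, ((h2 _ _).2 ⟨e', he', rfl, rfl⟩).2⟩
      · rintro ⟨ρ₂, rfl, h⟩
        obtain ⟨e, he, rfl, rfl⟩ := (h2 ρ₂ res).1 ⟨hp, h⟩
        exact ⟨e.prepend ρ₁, List.mem_map.2 ⟨e, he, rfl⟩, rfl, rfl⟩
  constructor
  · rw [List.map_flatMap, List.nodup_flatMap]
    constructor
    · rintro ⟨ρ₁, o⟩ ho
      rw [hmem] at ho
      cases o with
      | ready v => simp [outEntries]
      | accept => simp [outEntries]
      | pop d X =>
        obtain ⟨hp, hd, hr⟩ := ho.pop_spec hG hst rfl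
        have h1 := (htab d X hd hr).1
        simp only [outEntries, List.map_map]
        have : Entry.ops ∘ Entry.prepend (G := G) ρ₁ = (ρ₁ ++ ·) ∘ Entry.ops := rfl
        rw [this, ← List.map_map]
        exact h1.map (List.append_right_injective ρ₁)
    · refine hnd.pairwise_of_forall_ne fun o ho o' ho' hne => ?_
      rw [Function.onFun, List.disjoint_left]
      intro ρ h h'
      obtain ⟨e, he, rfl⟩ := List.mem_map.1 h
      obtain ⟨e', he', heq⟩ := List.mem_map.1 h'
      rw [hmem] at ho ho'
      obtain ⟨ρ₂, h1, h2⟩ := (hent o ho e.ops e.res).1 ⟨e, he, rfl, rfl⟩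
      obtain ⟨ρ₂', h1', h2'⟩ := (hent o' ho' e'.ops e'.res).1 ⟨e', he', rfl, rfl⟩
      exact hne (Prod.ext_iff.2 (ho.unique ho' h2.eq_nil h2'.eq_nil
        (by rw [← h1, ← h1', heq])))
  · intro ρ res
    simp only [List.mem_flatMap]
    constructor
    · intro h
      obtain ⟨ρ₁, ρ₂, o, rfl, h1, h2⟩ := h.exists_vred v rfl
      obtain ⟨e, he, h3⟩ := (hent (ρ₁, o) h1 (ρ₁ ++ ρ₂) res).2 ⟨ρ₂, rfl, h2⟩
      exact ⟨e, ⟨(ρ₁, o), (hmem _).2 h1, he⟩, h3⟩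
    · rintro ⟨e, ⟨o, ho, he⟩, h3⟩
      rw [hmem] at ho
      obtain ⟨ρ₂, rfl, h⟩ := (hent o ho ρ res).1 ⟨e, he, h3⟩
      exact ho.red h

/-- The outcomes from which the table entry for `Y` above the state `q` is computed. -/
noncomputable def tableOuts (G : ContextFreeGrammar T) (k : ℕ) (q : Set (LRItem T G.NT))
    (Y : Symbol T G.NT) (l : List (Option T)) : List (List (LROp T G.NT) × VOut G) :=
  open Classical in
  if Productive G Y ∧ ∃ st, IsStack G k (q :: st) then vouts G k q l [dfaStep G k q Y] else []

theorem listSpec_tableOuts (hG : StartNormal G) {t : ℕ} (hX : IsXLR G k t)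
    {q : Set (LRItem T G.NT)} {st : StateStack G} {l : List (Option T)} (hl : l.length = k)
    (hst : IsStack G k (q :: st)) {tab : ℕ → G.NT → List (Entry G)}
    (htab : ∀ d X, 0 < d → (∃ r ∈ G.rules, d ≤ r.output.length) →
      ListSpec (tab d X) (TabRel G k l (q :: st) d (.nonterminal X)))
    (Y : Symbol T G.NT) :
    ListSpec ((tableOuts G k q Y l).flatMap (outEntries (q :: st) tab))
      (TabRel G k l (q :: st) 0 Y) := by
  by_cases hY : Productive G Y
  · rw [tableOuts, if_pos ⟨hY, st, hst⟩]
    have := listSpec_vouts hG hX hl (v := [dfaStep G k q Y]) (hst.push hY) htab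
    refine ⟨this.1, fun ρ res => ?_⟩
    rw [← this.2]
    simp only [TabRel, List.drop_zero, List.cons.injEq, List.cons_append, List.nil_append]
    constructor
    · rintro ⟨-, q', st', ⟨rfl, rfl⟩, h⟩; exact h
    · exact fun h => ⟨hY, _, _, ⟨rfl, rfl⟩, h⟩
  -- For an unproductive symbol both the list and the relation are empty.
  · rw [tableOuts, if_neg fun h => hY h.1]
    exact ⟨by simp, fun ρ res => ⟨fun h => absurd h.1 hY, by simp⟩⟩

/-- With the common history `p₀` in front, the entries are distinct partial LR parses for one input
and one lookahead. -/
theorem ListSpec.length_le {t : ℕ} (hX : IsXLR G k t) {u : List T} {l : List (Option T)}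
    (hl : l.length = k) {p₀ : List (LROp T G.NT)} {L : List (Entry G)}
    {R : List (LROp T G.NT) → Option (StateStack G) → Prop} (h : ListSpec L R)
    (hR : ∀ ρ res, R ρ res → IsPartialLRParse G k u l (p₀ ++ ρ)) : L.length ≤ t := by
  classical
  have hnd : ((L.map Entry.ops).map (p₀ ++ ·)).Nodup := h.1.map (List.append_right_injective p₀)
  have h1 := hX u l hl
  have h2 : (((L.map Entry.ops).map (p₀ ++ ·)).toFinset : Set (List (LROp T G.NT))).encard ≤ t := by
    refine (Set.encard_le_encard ?_).trans h1
    intro p hp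
    simp only [List.coe_toFinset, List.mem_map] at hp
    obtain ⟨_, ⟨e, he, rfl⟩, rfl⟩ := hp
    exact hR _ _ ((h.2 e.ops e.res).2 ⟨e, he, rfl, rfl⟩)
  rw [Set.encard_coe_eq_coe_finsetCard, List.toFinset_card_of_nodup hnd] at h2
  simpa using h2

theorem ListSpec.length_le_of_red (hG : StartNormal G) {t : ℕ} (hX : IsXLR G k t)
    {l : List (Option T)} (hl : l.length = k) {st : StateStack G} (hst : IsStack G k st)
    {L : List (Entry G)} (h : ListSpec L (Red G k l st)) : L.length ≤ t := by
  obtain ⟨fs, hf, rfl⟩ := hst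
  exact h.length_le hX hl fun ρ res hr => hr.isPartial hG hf

theorem IsStack.drop {st : StateStack G} (hst : st = [] ∨ IsStack G k st) (d : ℕ) :
    st.drop d = [] ∨ IsStack G k (st.drop d) := by
  by_cases h : st.drop d = []
  · exact .inl h
  · rcases hst with rfl | hst
    · simp at h
    · rw [← List.take_append_drop d st] at hst
      exact .inr (hst.of_append h)

theorem ListSpec.length_le_of_tabRel (hG : StartNormal G) {t : ℕ} (hX : IsXLR G k t)
    {l : List (Option T)} (hl : l.length = k) {st : StateStack G}
    (hst : st = [] ∨ IsStack G k st) {d : ℕ} {Y : Symbol T G.NT}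
    {L : List (Entry G)} (h : ListSpec L (TabRel G k l st d Y)) : L.length ≤ t := by
  by_cases hne : Productive G Y ∧ ∃ q st', st.drop d = q :: st'
  · obtain ⟨hY, q, st', hd⟩ := hne
    have hst' : IsStack G k (q :: st') := by
      rcases IsStack.drop hst d with h | h
      · rw [h] at hd; cases hd
      · rwa [hd] at h
    refine ListSpec.length_le_of_red hG hX hl (hst'.push hY) ⟨h.1, fun ρ res => ?_⟩
    rw [← h.2]
    constructor
    · exact fun h => ⟨hY, _, _, hd, h⟩
    · rintro ⟨-, q₁, st₁, hd₁, h⟩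
      rw [hd] at hd₁
      obtain ⟨rfl, rfl⟩ := List.cons_eq_cons.1 hd₁
      exact h
  · have : L = [] := List.eq_nil_iff_forall_not_mem.2 fun e he => by
      obtain ⟨hY, q, st', hd, -⟩ := (h.2 e.ops e.res).2 ⟨e, he, rfl, rfl⟩
      exact hne ⟨hY, q, st', hd⟩
    simp [this]

theorem ListSpec.length_le_of_copyAt (hG : StartNormal G) {t : ℕ} (hX : IsXLR G k t)
    {x : List T} {s : ℕ} {L : List (Entry G)} (h : ListSpec L (CopyAt G k x s)) :
    L.length ≤ t :=
  h.length_le (p₀ := []) hX (lookahead_length k (x.drop s)) fun _ _ hr => hr.isPartial hG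

end Tables

/-! ### A structured language for the random access machine -/

section Language

/-- Structured commands. -/
inductive Cmd : Type
  | skip : Cmd
  | set (r c : ℕ) : Cmd
  | copy (r r' : ℕ) : Cmd
  | inc (r : ℕ) : Cmd
  | load (r a d : ℕ) : Cmd
  | store (a d r : ℕ) : Cmd
  | seq (a b : Cmd) : Cmd
  /-- `if R[r] = R[r'] then a else b` -/
  | ite (r r' : ℕ) (a b : Cmd) : Cmd
  /-- `while R[r] ≠ R[r'] do a` -/
  | loop (r r' : ℕ) (a : Cmd) : Cmd

/-- The data of a machine state. -/
structure Store : Type where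
  reg : ℕ → ℕ
  mem : ℕ → ℕ

/-- One step of the execution of a list of commands. -/
def cmdStep : List Cmd × Store → List Cmd × Store
  | ([], σ) => ([], σ)
  | (.skip :: L, σ) => (L, σ)
  | (.set r c :: L, σ) => (L, ⟨Function.update σ.reg r c, σ.mem⟩)
  | (.copy r r' :: L, σ) => (L, ⟨Function.update σ.reg r (σ.reg r'), σ.mem⟩)
  | (.inc r :: L, σ) => (L, ⟨Function.update σ.reg r (σ.reg r + 1), σ.mem⟩)
  | (.load r a d :: L, σ) => (L, ⟨Function.update σ.reg r (σ.mem (σ.reg a + d)), σ.mem⟩)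
  | (.store a d r :: L, σ) => (L, ⟨σ.reg, Function.update σ.mem (σ.reg a + d) (σ.reg r)⟩)
  | (.seq a b :: L, σ) => (a :: b :: L, σ)
  | (.ite r r' a b :: L, σ) => (if σ.reg r = σ.reg r' then a :: L else b :: L, σ)
  | (.loop r r' a :: L, σ) => (if σ.reg r = σ.reg r' then L else a :: .loop r r' a :: L, σ)

/-- Started in `σ`, the command `c` terminates within `n` steps in a store that satisfies `Q`. -/
def Cmd.Tri (c : Cmd) (n : ℕ) (σ : Store) (Q : Store → Prop) : Prop :=
  ∀ L, ∃ m ≤ n, ∃ σ', cmdStep^[m] (c :: L, σ) = (L, σ') ∧ Q σ'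

theorem Cmd.Tri.mono {c : Cmd} {n n' : ℕ} {σ : Store} {Q Q' : Store → Prop} (h : c.Tri n σ Q)
    (hn : n ≤ n') (hQ : ∀ τ, Q τ → Q' τ) : c.Tri n' σ Q' := by
  intro L
  obtain ⟨m, hm, σ', h1, h2⟩ := h L
  exact ⟨m, hm.trans hn, σ', h1, hQ _ h2⟩

theorem Cmd.Tri.seq {a b : Cmd} {n m : ℕ} {σ : Store} {Q : Store → Prop}
    (h : a.Tri n σ fun τ => b.Tri m τ Q) : (Cmd.seq a b).Tri (n + m + 1) σ Q := by
  intro L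
  obtain ⟨i, hi, τ, h1, h2⟩ := h (b :: L)
  obtain ⟨j, hj, υ, h3, h4⟩ := h2 L
  refine ⟨j + i + 1, by omega, υ, ?_, h4⟩
  rw [Function.iterate_succ_apply, Function.iterate_add_apply]
  simp only [cmdStep]
  rw [h1, h3]

theorem Cmd.Tri.ite_eq {a b : Cmd} {n : ℕ} {σ : Store} {Q : Store → Prop} {r r' : ℕ}
    (hr : σ.reg r = σ.reg r') (h : a.Tri n σ Q) : (Cmd.ite r r' a b).Tri (n + 1) σ Q := by
  intro L
  obtain ⟨i, hi, τ, h1, h2⟩ := h L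
  refine ⟨i + 1, by omega, τ, ?_, h2⟩
  rw [Function.iterate_succ_apply]
  simp only [cmdStep, if_pos hr, h1]

theorem Cmd.Tri.ite_ne {a b : Cmd} {n : ℕ} {σ : Store} {Q : Store → Prop} {r r' : ℕ}
    (hr : σ.reg r ≠ σ.reg r') (h : b.Tri n σ Q) : (Cmd.ite r r' a b).Tri (n + 1) σ Q := by
  intro L
  obtain ⟨i, hi, τ, h1, h2⟩ := h L
  refine ⟨i + 1, by omega, τ, ?_, h2⟩
  rw [Function.iterate_succ_apply]
  simp only [cmdStep, if_neg hr, h1]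

theorem Cmd.Tri.loop_done {a : Cmd} {σ : Store} {Q : Store → Prop} {r r' : ℕ}
    (hr : σ.reg r = σ.reg r') (h : Q σ) : (Cmd.loop r r' a).Tri 1 σ Q := by
  intro L
  exact ⟨1, le_rfl, σ, by simp [cmdStep, hr], h⟩

theorem Cmd.Tri.loop_step {a : Cmd} {n m : ℕ} {σ : Store} {Q : Store → Prop} {r r' : ℕ}
    (hr : σ.reg r ≠ σ.reg r') (h : a.Tri n σ fun τ => (Cmd.loop r r' a).Tri m τ Q) :
    (Cmd.loop r r' a).Tri (n + m + 1) σ Q := by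
  intro L
  obtain ⟨i, hi, τ, h1, h2⟩ := h (.loop r r' a :: L)
  obtain ⟨j, hj, υ, h3, h4⟩ := h2 L
  refine ⟨j + i + 1, by omega, υ, ?_, h4⟩
  rw [Function.iterate_succ_apply, Function.iterate_add_apply]
  simp only [cmdStep, if_neg hr]
  rw [h1, h3]

/-- A loop that processes a list. -/
theorem Cmd.Tri.loop_list {α : Type*} {a : Cmd} {n r r' : ℕ} (I : List α → Store → Prop)
    (hnil : ∀ σ, I [] σ → σ.reg r = σ.reg r')
    (hcons : ∀ x l σ, I (x :: l) σ → σ.reg r ≠ σ.reg r' ∧ a.Tri n σ (I l)) :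
    ∀ (l : List α) (σ : Store), I l σ →
      (Cmd.loop r r' a).Tri (l.length * (n + 1) + 1) σ (I []) := by
  intro l
  induction l with
  | nil => intro σ h; exact (Cmd.Tri.loop_done (hnil σ h) h).mono (by omega) fun _ h => h
  | cons x l ih =>
    intro σ h
    obtain ⟨hr, h⟩ := hcons x l σ h
    refine (Cmd.Tri.loop_step hr (h.mono le_rfl ih)).mono ?_ fun _ h => h
    rw [List.length_cons, Nat.add_mul]
    omega

/-- Commands without loops. -/
def Cmd.LoopFree : Cmd → Prop
  | .seq a b => a.LoopFree ∧ b.LoopFree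
  | .ite _ _ a b => a.LoopFree ∧ b.LoopFree
  | .loop _ _ _ => False
  | _ => True

/-- The number of steps of a command without loops is at most its size. -/
def Cmd.size : Cmd → ℕ
  | .seq a b => a.size + b.size + 1
  | .ite _ _ a b => a.size + b.size + 1
  | _ => 1

/-- The effect of a command without loops. -/
def Cmd.run : Cmd → Store → Store
  | .skip, σ => σ
  | .set r c, σ => ⟨Function.update σ.reg r c, σ.mem⟩
  | .copy r r', σ => ⟨Function.update σ.reg r (σ.reg r'), σ.mem⟩
  | .inc r, σ => ⟨Function.update σ.reg r (σ.reg r + 1), σ.mem⟩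
  | .load r a d, σ => ⟨Function.update σ.reg r (σ.mem (σ.reg a + d)), σ.mem⟩
  | .store a d r, σ => ⟨σ.reg, Function.update σ.mem (σ.reg a + d) (σ.reg r)⟩
  | .seq a b, σ => b.run (a.run σ)
  | .ite r r' a b, σ => if σ.reg r = σ.reg r' then a.run σ else b.run σ
  | .loop _ _ _, σ => σ

/-- Loop-free parts are verified by evaluating `run`, with the size of the command as a time bound
that does not depend on the store. -/
theorem Cmd.LoopFree.tri {c : Cmd} (hc : c.LoopFree) : ∀ {σ : Store} {Q : Store → Prop},
    Q (c.run σ) → c.Tri c.size σ Q := by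
  induction c with
  | seq a b iha ihb => intro σ Q h; exact .seq (iha hc.1 (ihb hc.2 h))
  | ite r r' a b iha ihb =>
    intro σ Q h
    rw [Cmd.run] at h
    split_ifs at h with hr
    · exact (Cmd.Tri.ite_eq hr (iha hc.1 h)).mono (by simp only [Cmd.size]; omega) fun _ h => h
    · exact (Cmd.Tri.ite_ne hr (ihb hc.2 h)).mono (by simp only [Cmd.size]; omega) fun _ h => h
  | loop => exact hc.elim
  | _ => intro σ Q h L; exact ⟨1, le_rfl, _, rfl, h⟩

theorem Cmd.LoopFree.tri_seq {a b : Cmd} {n : ℕ} (ha : a.LoopFree) {σ : Store}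
    {Q : Store → Prop} (h : b.Tri n (a.run σ) Q) : (Cmd.seq a b).Tri (a.size + n + 1) σ Q :=
  .seq (ha.tri h)

/-! ### Compilation -/

/-- The continuations met during the execution of `c :: L`, except for `L`. -/
def Cmd.conts : Cmd → List Cmd → Set (List Cmd)
  | .seq a b, L => {.seq a b :: L} ∪ a.conts (b :: L) ∪ b.conts L
  | .ite r r' a b, L => {.ite r r' a b :: L} ∪ a.conts L ∪ b.conts L
  | .loop r r' a, L => {.loop r r' a :: L} ∪ a.conts (.loop r r' a :: L)
  | c, L => {c :: L}

theorem Cmd.conts_finite (c : Cmd) : ∀ L, (c.conts L).Finite := by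
  induction c with
  | seq a b iha ihb => intro L; exact ((Set.finite_singleton _).union (iha _)).union (ihb _)
  | ite r r' a b iha ihb => intro L; exact ((Set.finite_singleton _).union (iha _)).union (ihb _)
  | loop r r' a iha => intro L; exact (Set.finite_singleton _).union (iha _)
  | _ => intro L; exact Set.finite_singleton _

theorem Cmd.self_mem_conts (c : Cmd) (L : List Cmd) : c :: L ∈ c.conts L := by
  cases c <;> simp [Cmd.conts]

/-- Execution stays within a finite set of continuations given by the syntax of `c` until it returns
to `L`. This is why continuations can serve as labels of a finite program. -/
theorem Cmd.conts_closed (c : Cmd) : ∀ L, ∀ K ∈ c.conts L, ∀ σ,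
    (cmdStep (K, σ)).1 ∈ c.conts L ∨ (cmdStep (K, σ)).1 = L := by
  induction c with
  | seq a b iha ihb =>
    rintro L K ((rfl | hK) | hK) σ
    · exact .inl (.inl (.inr (a.self_mem_conts _)))
    · rcases iha _ K hK σ with h | h
      · exact .inl (.inl (.inr h))
      · exact .inl (.inr (h ▸ b.self_mem_conts _))
    · rcases ihb _ K hK σ with h | h
      · exact .inl (.inr h)
      · exact .inr h
  | ite r r' a b iha ihb =>
    rintro L K ((rfl | hK) | hK) σ
    · simp only [cmdStep]
      split_ifs
      · exact .inl (.inl (.inr (a.self_mem_conts _)))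
      · exact .inl (.inr (b.self_mem_conts _))
    · exact (iha _ K hK σ).imp (fun h => .inl (.inr h)) id
    · exact (ihb _ K hK σ).imp (fun h => .inr h) id
  | loop r r' a iha =>
    rintro L K (rfl | hK) σ
    · simp only [cmdStep]
      split_ifs
      · exact .inr rfl
      · exact .inl (.inr (a.self_mem_conts _))
    · rcases iha _ K hK σ with h | h
      · exact .inl (.inr h)
      · exact .inl (.inl h)
  | _ => rintro L K rfl σ; exact .inr rfl

/-- The labels of the compiled program. -/
def Cmd.labels (c : Cmd) : Set (List Cmd) := c.conts [] ∪ {[]}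

theorem Cmd.labels_closed (c : Cmd) {K : List Cmd} (hK : K ∈ c.labels) (σ : Store) :
    (cmdStep (K, σ)).1 ∈ c.labels := by
  rcases hK with hK | rfl
  · exact (c.conts_closed [] K hK σ).imp id id
  · exact .inr rfl

open Classical in
/-- The label of a continuation. -/
noncomputable def Cmd.toLabel (c : Cmd) (K : List Cmd) : c.labels :=
  if h : K ∈ c.labels then ⟨K, h⟩ else ⟨[], .inr rfl⟩

theorem Cmd.toLabel_of_mem {c : Cmd} {K : List Cmd} (h : K ∈ c.labels) :
    (c.toLabel K : List Cmd) = K := by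
  rw [Cmd.toLabel, dif_pos h]

/-- The instruction at a continuation. -/
noncomputable def Cmd.instr (c : Cmd) : List Cmd → Instr c.labels
  | [] => .halt
  | .skip :: L => .copy 0 0 (c.toLabel L)
  | .set r v :: L => .set r v (c.toLabel L)
  | .copy r r' :: L => .copy r r' (c.toLabel L)
  | .inc r :: L => .inc r (c.toLabel L)
  | .load r a d :: L => .load r a d (c.toLabel L)
  | .store a d r :: L => .store a d r (c.toLabel L)
  | .seq a b :: L => .copy 0 0 (c.toLabel (a :: b :: L))
  | .ite r r' a b :: L => .ifEq r r' (c.toLabel (a :: L)) (c.toLabel (b :: L))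
  | .loop r r' a :: L => .ifEq r r' (c.toLabel L) (c.toLabel (a :: .loop r r' a :: L))

/-- The compiled program. -/
noncomputable def Cmd.compile (c : Cmd) : Program where
  Label := c.labels
  finite_label := ((c.conts_finite []).union (Set.finite_singleton _)).to_subtype
  start := c.toLabel [c]
  code K := c.instr K

/-- The abstract state of a state of the compiled program. -/
def Cmd.view (c : Cmd) (s : MState c.compile) : List Cmd × Store :=
  (Subtype.val (p := (· ∈ c.labels)) s.pc, ⟨s.reg, s.mem⟩)

/-- The simulation is step for step, so time bounds carry over unchanged; to keep it so, `skip` and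
`seq` are compiled to the neutral instruction `copy 0 0`. -/
theorem Cmd.view_step (c : Cmd) (s : MState c.compile) :
    c.view (c.compile.step s) = cmdStep (c.view s) := by
  obtain ⟨⟨K, hK⟩, reg, mem⟩ := s
  have hcl := c.labels_closed hK ⟨reg, mem⟩
  cases K with
  | nil => rfl
  | cons a L =>
    cases a with
    | ite r r' a b =>
      simp only [cmdStep] at hcl
      simp only [Cmd.view, Program.step, Cmd.compile, Cmd.instr, cmdStep, Prod.mk.injEq, and_true]
      split_ifs at hcl ⊢ <;> exact Cmd.toLabel_of_mem hcl
    | loop r r' a =>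
      simp only [cmdStep] at hcl
      simp only [Cmd.view, Program.step, Cmd.compile, Cmd.instr, cmdStep, Prod.mk.injEq, and_true]
      split_ifs at hcl ⊢ <;> exact Cmd.toLabel_of_mem hcl
    | _ =>
      simp only [cmdStep] at hcl
      simp only [Cmd.view, Program.step, Cmd.compile, Cmd.instr, cmdStep, Cmd.toLabel_of_mem hcl,
        Function.update_eq_self]

theorem Cmd.view_iterate (c : Cmd) (s : MState c.compile) (m : ℕ) :
    c.view (c.compile.step^[m] s) = cmdStep^[m] (c.view s) := by
  induction m generalizing s with
  | zero => rfl
  | succ m ih => rw [Function.iterate_succ_apply, Function.iterate_succ_apply, ih, c.view_step]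

/-- The memory that holds an input word. -/
def inputMem (w : List ℕ) : ℕ → ℕ := fun i => (w[i]?.map (· + 1)).getD 0

/-- A triple holds for every continuation; with the empty one the run ends at the label `[]`, whose
instruction is `halt`. -/
theorem Cmd.Tri.outputs {α : Type*} {c : Cmd} {w : List ℕ} {m : ℕ} {R : α → Prop} {n : α → ℕ}
    {z : α → List ℕ} (h : c.Tri m ⟨fun _ => 0, inputMem w⟩ fun τ => ∃ a, R a ∧ τ.reg 0 = n a ∧
      ∀ i (hi : i < (z a).length), τ.mem (τ.reg 1 + i) = (z a)[i]) :
    ∃ a, R a ∧ c.compile.Outputs w m (n a) (z a) := by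
  obtain ⟨m', hm, τ, h1, a, hR, h2, h3⟩ := h []
  have hv : c.view (c.compile.init w) = ([c], ⟨fun _ => 0, inputMem w⟩) := by
    simp only [Cmd.view, Program.init, Cmd.compile]
    rw [Cmd.toLabel_of_mem (.inl (c.self_mem_conts []))]
    rfl
  have h4 := c.view_iterate (c.compile.init w) m'
  rw [hv, h1] at h4
  refine ⟨a, hR, m', hm, ?_⟩
  generalize c.compile.step^[m'] (c.compile.init w) = s at h4
  obtain ⟨⟨K, hK⟩, reg, mem⟩ := s
  simp only [Cmd.view, Prod.mk.injEq] at h4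
  obtain ⟨rfl, rfl⟩ := h4
  exact ⟨rfl, h2, h3⟩

end Language

/-! ### Registers -/

notation "regCount" => (0 : ℕ)
notation "regAddr" => (1 : ℕ)
notation "regHp" => (2 : ℕ)
notation "regZero" => (3 : ℕ)
notation "regInput" => (4 : ℕ)
notation "regCur" => (5 : ℕ)
notation "regNew" => (6 : ℕ)
notation "regCell" => (7 : ℕ)
notation "regBase" => (8 : ℕ)
notation "regOut" => (9 : ℕ)
notation "regPtr" => (10 : ℕ)
notation "regEnt" => (11 : ℕ)
notation "regCode" => (12 : ℕ)
notation "regRope" => (13 : ℕ)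
notation "regVal" => (14 : ℕ)
notation "regTmp" => (15 : ℕ)
notation "regHist" => (16 : ℕ)
notation "regSel" => (17 : ℕ)
notation "regRoot" => (18 : ℕ)

section Heap

/-! ### The heap -/

/-- The heap `(S', m')` extends the heap `(S, m)`; `S` is the set of the cells whose contents are
final. -/
structure HeapLE (S : Set ℕ) (m : ℕ → ℕ) (S' : Set ℕ) (m' : ℕ → ℕ) : Prop where
  subset : S ⊆ S'
  agree : ∀ i ∈ S, m' i = m i

theorem HeapLE.refl (S : Set ℕ) (m : ℕ → ℕ) : HeapLE S m S m := ⟨subset_rfl, fun _ _ => rfl⟩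

theorem HeapLE.trans {S S' S'' : Set ℕ} {m m' m'' : ℕ → ℕ} (h : HeapLE S m S' m')
    (h' : HeapLE S' m' S'' m'') : HeapLE S m S'' m'' :=
  ⟨h.subset.trans h'.subset, fun i hi => (h'.agree i (h.subset hi)).trans (h.agree i hi)⟩

/-- Binary trees whose inorder traversals are words. -/
inductive Rope : Type
  | nil : Rope
  | node (l : Rope) (v : ℕ) (r : Rope) : Rope

/-- The inorder traversal. -/
def Rope.word : Rope → List ℕ
  | .nil => []
  | .node l v r => l.word ++ v :: r.word

/-- The rope `t` is stored at address `p`. -/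
def RopeAt (S : Set ℕ) (m : ℕ → ℕ) : Rope → ℕ → Prop
  | .nil, p => p = 0
  | .node l v r, p => 0 < p ∧ p ∈ S ∧ p + 1 ∈ S ∧ p + 2 ∈ S ∧ m (p + 1) = v ∧
      RopeAt S m l (m p) ∧ RopeAt S m r (m (p + 2))

theorem RopeAt.mono {S S' : Set ℕ} {m m' : ℕ → ℕ} (h : HeapLE S m S' m') :
    ∀ {t : Rope} {p : ℕ}, RopeAt S m t p → RopeAt S' m' t p
  | .nil, _, hp => hp
  | .node _ _ _, _, ⟨h0, h1, h2, h3, h4, h5, h6⟩ =>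
    ⟨h0, h.subset h1, h.subset h2, h.subset h3, by rw [h.agree _ h2, h4],
      by rw [h.agree _ h1]; exact h5.mono h, by rw [h.agree _ h3]; exact h6.mono h⟩

/-- A rope for the word `w` is stored at address `p`. -/
def HoldsWord (S : Set ℕ) (m : ℕ → ℕ) (p : ℕ) (w : List ℕ) : Prop :=
  ∃ t, RopeAt S m t p ∧ t.word = w

theorem HoldsWord.mono {S S' : Set ℕ} {m m' : ℕ → ℕ} {p : ℕ} {w : List ℕ}
    (hw : HoldsWord S m p w) (h : HeapLE S m S' m') : HoldsWord S' m' p w := by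
  obtain ⟨t, ht, rfl⟩ := hw
  exact ⟨t, ht.mono h, rfl⟩

theorem holdsWord_nil (S : Set ℕ) (m : ℕ → ℕ) : HoldsWord S m 0 [] := ⟨.nil, rfl, rfl⟩

/-- The invariant of the heap: the heap pointer is above all final cells. -/
structure HeapInv (S : Set ℕ) (σ : Store) : Prop where
  zero : σ.reg regZero = 0
  pos : 0 < σ.reg regHp
  bound : ∀ i ∈ S, i < σ.reg regHp

/-- A computation that changes at most the registers `rs` and extends the heap. -/
structure HeapStep (rs : List ℕ) (S : Set ℕ) (σ : Store) (S' : Set ℕ) (τ : Store) : Prop where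
  inv : HeapInv S' τ
  le : HeapLE S σ.mem S' τ.mem
  fresh : ∀ i ∈ S', i ∉ S → σ.reg regHp ≤ i
  hp : σ.reg regHp ≤ τ.reg regHp
  same : ∀ r, r ∉ rs → τ.reg r = σ.reg r

theorem HeapStep.mono {rs rs' : List ℕ} {S S' : Set ℕ} {σ τ : Store} (h : HeapStep rs S σ S' τ)
    (hrs : rs ⊆ rs') : HeapStep rs' S σ S' τ :=
  ⟨h.inv, h.le, h.fresh, h.hp, fun r hr => h.same r fun hr' => hr (hrs hr')⟩

theorem HeapStep.trans {rs : List ℕ} {S S' S'' : Set ℕ} {σ τ υ : Store}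
    (h : HeapStep rs S σ S' τ) (h' : HeapStep rs S' τ S'' υ) : HeapStep rs S σ S'' υ :=
  ⟨h'.inv, h.le.trans h'.le, fun i hi hi' => by
    by_cases h'' : i ∈ S'
    · exact h.fresh i h'' hi'
    · exact h.hp.trans (h'.fresh i hi h''), h.hp.trans h'.hp,
    fun r hr => (h'.same r hr).trans (h.same r hr)⟩

theorem HeapInv.step_refl {S : Set ℕ} {σ : Store} (h : HeapInv S σ) (rs : List ℕ) :
    HeapStep rs S σ S σ :=
  ⟨h, .refl _ _, fun _ hi hi' => absurd hi hi', le_rfl, fun _ _ => rfl⟩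

/-- A change of registers other than the heap pointer. -/
theorem HeapInv.step_regs {S : Set ℕ} {σ τ : Store} (h : HeapInv S σ) (rs : List ℕ)
    (hm : τ.mem = σ.mem) (hs : ∀ r, r ∉ rs → τ.reg r = σ.reg r) (hhp : regHp ∉ rs)
    (hz : regZero ∉ rs) : HeapStep rs S σ S τ := by
  refine ⟨⟨?_, ?_, ?_⟩, ⟨subset_rfl, fun i _ => by rw [hm]⟩, fun _ hi hi' => absurd hi hi', ?_, hs⟩
  · rw [hs _ hz, h.zero]
  · rw [hs _ hhp]; exact h.pos
  · rw [hs _ hhp]; exact h.bound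
  · rw [hs _ hhp]

theorem HeapInv.step_update {S : Set ℕ} {σ : Store} (h : HeapInv S σ) (r v : ℕ)
    (hhp : r ≠ regHp) (hz : r ≠ regZero) :
    HeapStep [r] S σ S ⟨Function.update σ.reg r v, σ.mem⟩ :=
  h.step_regs [r] rfl (fun _ hr => Function.update_of_ne (by simpa using hr) _ _)
    (by simpa using hhp.symm) (by simpa using hz.symm)

/-- Increase a register by a constant. -/
def incBy (r : ℕ) : ℕ → Cmd
  | 0 => .skip
  | n + 1 => .seq (.inc r) (incBy r n)

theorem incBy_loopFree (r n : ℕ) : (incBy r n).LoopFree := by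
  induction n with
  | zero => trivial
  | succ n ih => exact ⟨trivial, ih⟩

theorem incBy_run (r n : ℕ) (σ : Store) :
    (incBy r n).run σ = ⟨Function.update σ.reg r (σ.reg r + n), σ.mem⟩ := by
  induction n generalizing σ with
  | zero => simp [incBy, Cmd.run]
  | succ n ih =>
    simp only [incBy, Cmd.run, ih]
    simp [Nat.add_assoc, Nat.add_comm]

/-- Store the registers `rs` in fresh cells, and their address in the register `dst`. -/
def alloc (dst : ℕ) (rs : List ℕ) : Cmd :=
  .seq (storeAll 0 rs) (.seq (.copy dst regHp) (incBy regHp rs.length))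
where
  /-- Store the registers `rs` above the heap pointer. -/
  storeAll : ℕ → List ℕ → Cmd
    | _, [] => .skip
    | d, r :: rs => .seq (.store regHp d r) (storeAll (d + 1) rs)

theorem alloc.storeAll_loopFree (d : ℕ) (rs : List ℕ) : (alloc.storeAll d rs).LoopFree := by
  induction rs generalizing d with
  | nil => trivial
  | cons r rs ih => exact ⟨trivial, ih _⟩

theorem alloc.storeAll_run (d : ℕ) (rs : List ℕ) (σ : Store) :
    ((alloc.storeAll d rs).run σ).reg = σ.reg ∧
    (∀ i, i < σ.reg regHp + d → ((alloc.storeAll d rs).run σ).mem i = σ.mem i) ∧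
    ∀ j (hj : j < rs.length),
      ((alloc.storeAll d rs).run σ).mem (σ.reg regHp + (d + j)) = σ.reg rs[j] := by
  induction rs generalizing d σ with
  | nil => exact ⟨rfl, fun _ _ => rfl, fun j hj => absurd hj (by simp)⟩
  | cons r rs ih =>
    obtain ⟨h1, h2, h3⟩ := ih (d + 1) ((Cmd.store regHp d r).run σ)
    simp only [alloc.storeAll, Cmd.run] at *
    refine ⟨h1, fun i hi => ?_, fun j hj => ?_⟩
    · rw [h2 i (by omega), Function.update_of_ne (by omega)]
    · cases j with
      | zero => rw [h2 _ (by omega)]; simp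
      | succ j =>
        have := h3 j (by simpa using hj)
        simpa [Nat.add_assoc, Nat.add_comm, Nat.add_left_comm] using this

theorem alloc_loopFree (dst : ℕ) (rs : List ℕ) : (alloc dst rs).LoopFree :=
  ⟨alloc.storeAll_loopFree _ _, trivial, incBy_loopFree _ _⟩

/-- Final cells lie below the heap pointer and only cells from the pointer on are written. Final
data are thus persistent and can be shared between copies. -/
theorem alloc_run {dst : ℕ} {rs : List ℕ} {S : Set ℕ} {σ : Store} (h : HeapInv S σ)
    (hd : dst ≠ regHp) (hz : dst ≠ regZero) :
    let τ := (alloc dst rs).run σ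
    HeapStep [dst, regHp] S σ (S ∪ Set.Ico (σ.reg regHp) (σ.reg regHp + rs.length)) τ ∧
      τ.reg dst = σ.reg regHp ∧
      ∀ j (hj : j < rs.length), τ.mem (σ.reg regHp + j) = σ.reg rs[j] := by
  obtain ⟨h1, h2, h3⟩ := alloc.storeAll_run 0 rs σ
  intro τ
  have hτ : τ = (incBy regHp rs.length).run ((Cmd.copy dst regHp).run
    ((alloc.storeAll 0 rs).run σ)) := rfl
  rw [incBy_run] at hτ
  simp only [Cmd.run, h1] at hτ
  have hpos := h.pos
  have hhp : τ.reg regHp = σ.reg regHp + rs.length := by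
    rw [hτ]; simp [Function.update_of_ne hd.symm]
  have hreg : ∀ r, r ∉ [dst, regHp] → τ.reg r = σ.reg r := by
    intro r hr
    simp only [List.mem_cons, List.not_mem_nil, or_false, not_or] at hr
    rw [hτ]; simp [Function.update_apply, hr.1, hr.2]
  refine ⟨⟨⟨?_, ?_, ?_⟩, ⟨Set.subset_union_left, ?_⟩, ?_, ?_, hreg⟩, ?_, ?_⟩
  · rw [hreg _ (by simp [hz.symm]), h.zero]
  · omega
  · rintro i (hi | hi)
    · have := h.bound i hi; omega
    · rw [hhp]; exact hi.2
  · intro i hi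
    rw [hτ]
    exact h2 i (by have := h.bound i hi; omega)
  · rintro i (hi | hi) hi'
    · exact absurd hi hi'
    · exact hi.1
  · omega
  · rw [hτ]; simp [Function.update_apply, hd]
  · intro j hj
    rw [hτ]
    simpa using h3 j hj

theorem alloc_ropeAt {dst l v r : ℕ} {S : Set ℕ} {σ : Store} (h : HeapInv S σ) {tl tr : Rope}
    (hl : RopeAt S σ.mem tl (σ.reg l)) (hr : RopeAt S σ.mem tr (σ.reg r))
    (hd : dst ≠ regHp) (hz : dst ≠ regZero) :
    ∃ S', HeapStep [dst, regHp] S σ S' ((alloc dst [l, v, r]).run σ) ∧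
      RopeAt S' ((alloc dst [l, v, r]).run σ).mem (.node tl (σ.reg v) tr)
        (((alloc dst [l, v, r]).run σ).reg dst) := by
  obtain ⟨h1, h2, h3⟩ := alloc_run (rs := [l, v, r]) h hd hz
  refine ⟨_, h1, ?_⟩
  have e0 := h3 0 (by simp)
  have e1 := h3 1 (by simp)
  have e2 := h3 2 (by simp)
  simp only [Nat.add_zero, List.getElem_cons_zero, List.getElem_cons_succ] at e0 e1 e2
  rw [h2]
  refine ⟨h.pos, .inr ?_, .inr ?_, .inr ?_, e1, ?_, ?_⟩
  · simp
  · simp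
  · simp
  · rw [e0]; exact hl.mono h1.le
  · rw [e2]; exact hr.mono h1.le

theorem alloc_rope {dst l v r : ℕ} {S : Set ℕ} {σ : Store} (h : HeapInv S σ) {wl wr : List ℕ}
    (hl : HoldsWord S σ.mem (σ.reg l) wl) (hr : HoldsWord S σ.mem (σ.reg r) wr)
    (hd : dst ≠ regHp) (hz : dst ≠ regZero) :
    ∃ S', HeapStep [dst, regHp] S σ S' ((alloc dst [l, v, r]).run σ) ∧
      HoldsWord S' ((alloc dst [l, v, r]).run σ).mem (((alloc dst [l, v, r]).run σ).reg dst)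
        (wl ++ σ.reg v :: wr) := by
  obtain ⟨tl, htl, rfl⟩ := hl
  obtain ⟨tr, htr, rfl⟩ := hr
  obtain ⟨S', h1, h2⟩ := alloc_ropeAt (v := v) h htl htr hd hz
  exact ⟨S', h1, _, h2, rfl⟩

/-- Put a word in front of the rope in `regRope`. -/
def prependWord : List ℕ → Cmd
  | [] => .skip
  | v :: w => .seq (prependWord w)
      (.seq (.set regVal v) (alloc regRope [regZero, regVal, regRope]))

theorem prependWord_loopFree (w : List ℕ) : (prependWord w).LoopFree := by
  induction w with
  | nil => trivial
  | cons v w ih => exact ⟨ih, trivial, alloc_loopFree _ _⟩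

theorem prependWord_run (w : List ℕ) {S : Set ℕ} {σ : Store} (h : HeapInv S σ) {w' : List ℕ}
    (hw : HoldsWord S σ.mem (σ.reg regRope) w') :
    ∃ S', HeapStep [regRope, regVal, regHp] S σ S' ((prependWord w).run σ) ∧
      HoldsWord S' ((prependWord w).run σ).mem (((prependWord w).run σ).reg regRope) (w ++ w') := by
  induction w with
  | nil => exact ⟨S, h.step_refl _, hw⟩
  | cons v w ih =>
    obtain ⟨S', h1, h2⟩ := ih
    simp only [prependWord, Cmd.run]
    set τ := (prependWord w).run σ
    have h3 := (h1.inv.step_update regVal v (by simp) (by simp)).mono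
      (rs' := [regRope, regVal, regHp]) (by simp)
    -- The zero register serves as the empty left subrope.
    obtain ⟨S'', h4, h5⟩ := alloc_rope (dst := regRope) (l := regZero) (v := regVal)
      (r := regRope) h3.inv (wl := []) (wr := w ++ w')
      (by simp [h1.inv.zero, holdsWord_nil]) (by simpa using h2) (by simp) (by simp)
    refine ⟨S'', (h1.trans h3).trans (h4.mono (by simp)), ?_⟩
    simpa using h5

end Heap

section Lists

variable {T : Type} {G : ContextFreeGrammar T} {k : ℕ}

/-! ### Lists of copies in memory -/

/-- The numbering of the rows of the tables, of the operations and of the stacks of pending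
states. -/
structure Layout (G : ContextFreeGrammar T) (k : ℕ) where
  keys : List (Symbol T G.NT × List (Option T))
  pending : List (StateStack G)
  opc : LROp T G.NT → ℕ
  mem_keys : ∀ Y l, (Y, l) ∈ keys ↔ l.length = k
  mem_pending : ∀ q Y l, l.length = k → ∀ o ∈ tableOuts G k q Y l, ∀ v, o.2 = .ready v → v ∈ pending
  mem_pending_start : ∀ l, l.length = k → ∀ o ∈ vouts G k (dfaStart G k) l [],
    ∀ v, o.2 = .ready v → v ∈ pending

namespace Layout

variable (Λ : Layout G k)

open Classical in
/-- The row of a table that belongs to a symbol and a lookahead. -/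
noncomputable def pos (κ : Symbol T G.NT × List (Option T)) : ℕ := Λ.keys.idxOf κ

open Classical in
/-- The code of the pending states of a copy; `0` stands for a copy that has accepted. -/
noncomputable def code : Option (StateStack G) → ℕ
  | none => 0
  | some v => Λ.pending.idxOf v + 1

/-- `idxOf` separates only members of the list, so one side has to be a member; the code `0` is
reserved for accepted copies. -/
theorem code_inj {v : StateStack G} {o : Option (StateStack G)}
    (ho : ∀ v', o = some v' → v' ∈ Λ.pending) (h : Λ.code o = Λ.code (some v)) : o = some v := by
  cases o with
  | none => simp [code] at h
  | some v' =>
    simp only [code, Nat.add_right_cancel_iff] at h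
    rw [(List.idxOf_inj (ho v' rfl)).1 h]

/-- The copy `e` is represented by the base `b`, the code `c` and the rope `p`. -/
structure EntryAt (H : ℕ → StateStack G → Prop) (S : Set ℕ) (m : ℕ → ℕ) (e : Entry G)
    (b c p : ℕ) : Prop where
  code_eq : c = Λ.code e.virt
  word : HoldsWord S m p (e.ops.map Λ.opc)
  base : ∀ v, e.virt = some v → H b e.base ∧ v ∈ Λ.pending

/-- The list `L` of copies is stored at the address `a`. -/
def ListAt (H : ℕ → StateStack G → Prop) (S : Set ℕ) (m : ℕ → ℕ) : List (Entry G) → ℕ → Prop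
  | [], a => a = 0
  | e :: L, a => 0 < a ∧ (∀ i < 4, a + i ∈ S) ∧ Λ.EntryAt H S m e (m a) (m (a + 1)) (m (a + 2)) ∧
      ListAt H S m L (m (a + 3))

variable {Λ} {H H' : ℕ → StateStack G → Prop} {S S' : Set ℕ} {m m' : ℕ → ℕ}

theorem EntryAt.mono (hH : H ≤ H') (h : HeapLE S m S' m') {e : Entry G} {b c p : ℕ}
    (he : Λ.EntryAt H S m e b c p) : Λ.EntryAt H' S' m' e b c p :=
  ⟨he.code_eq, he.word.mono h, fun v hv => ⟨hH _ _ (he.base v hv).1, (he.base v hv).2⟩⟩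

theorem ListAt.mono (hH : H ≤ H') (h : HeapLE S m S' m') :
    ∀ {L : List (Entry G)} {a : ℕ}, Λ.ListAt H S m L a → Λ.ListAt H' S' m' L a
  | [], _, ha => ha
  | e :: L, a, ⟨h0, h1, h2, h3⟩ => by
    refine ⟨h0, fun i hi => h.subset (h1 i hi), ?_, ?_⟩
    · rw [h.agree a (h1 0 (by omega)), h.agree _ (h1 1 (by omega)), h.agree _ (h1 2 (by omega))]
      exact h2.mono hH h
    · rw [h.agree _ (h1 3 (by omega))]
      exact ListAt.mono hH h h3

/-- Load the fields of the first entry of a list, and advance to the next one. -/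
def loadEntry (P : ℕ) : Cmd :=
  .seq (.load regEnt P 0) (.seq (.load regCode P 1) (.seq (.load regRope P 2) (.load P P 3)))

/-- Put a new entry in front of a list. -/
def consEntry (dst : ℕ) : Cmd := alloc dst [regEnt, regCode, regRope, dst]

theorem consEntry_run {dst : ℕ} {σ : Store} (h : HeapInv S σ) (hd : dst ≠ regHp)
    (hz : dst ≠ regZero) {e : Entry G} {L : List (Entry G)}
    (he : Λ.EntryAt H S σ.mem e (σ.reg regEnt) (σ.reg regCode) (σ.reg regRope))
    (hL : Λ.ListAt H S σ.mem L (σ.reg dst)) :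
    ∃ S', HeapStep [dst, regHp] S σ S' ((consEntry dst).run σ) ∧
      Λ.ListAt H S' ((consEntry dst).run σ).mem (e :: L) (((consEntry dst).run σ).reg dst) := by
  obtain ⟨h1, h2, h3⟩ := alloc_run (rs := [regEnt, regCode, regRope, dst]) h hd hz
  refine ⟨_, h1, ?_⟩
  have e0 := h3 0 (by simp)
  have e1 := h3 1 (by simp)
  have e2 := h3 2 (by simp)
  have e3 := h3 3 (by simp)
  simp only [Nat.add_zero, List.getElem_cons_zero, List.getElem_cons_succ] at e0 e1 e2 e3
  rw [consEntry, h2]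
  refine ⟨h.pos, fun i hi => .inr (by simpa using hi), ?_, ?_⟩
  · rw [e0, e1, e2]; exact he.mono le_rfl h1.le
  · rw [e3]; exact hL.mono le_rfl h1.le

/-- Execute the command `body` for the entries of a list. -/
def forEntries (P : ℕ) (body : Cmd) : Cmd := .loop P regZero (.seq (loadEntry P) body)

/-- The invariant `J` is indexed by the entries still to be processed and by the set of final cells.
The rest of the list survives the body because final cells do not change; so the body may allocate
freely, but has to preserve the pointer `P`. -/
theorem forEntries_tri {P n : ℕ} {body : Cmd} (J : List (Entry G) → Set ℕ → Store → Prop)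
    (hP : P ∉ [regZero, regEnt, regCode, regRope])
    (hzero : ∀ L S σ, J L S σ → σ.reg regZero = 0)
    (hstable : ∀ L S σ τ, J L S σ → τ.mem = σ.mem →
      (∀ r, r ∉ [P, regEnt, regCode, regRope] → τ.reg r = σ.reg r) → J L S τ)
    (hbody : ∀ e L S σ, J (e :: L) S σ →
      Λ.EntryAt H S σ.mem e (σ.reg regEnt) (σ.reg regCode) (σ.reg regRope) →
      body.Tri n σ fun τ => ∃ S', HeapLE S σ.mem S' τ.mem ∧ τ.reg P = σ.reg P ∧ J L S' τ)
    {L : List (Entry G)} {σ : Store} (hL : Λ.ListAt H S σ.mem L (σ.reg P)) (hJ : J L S σ) :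
    (forEntries P body).Tri (L.length * ((loadEntry P).size + n + 1 + 1) + 1) σ
      fun τ => ∃ S', J [] S' τ := by
  refine (Cmd.Tri.loop_list (fun L σ => ∃ S, Λ.ListAt H S σ.mem L (σ.reg P) ∧ J L S σ) ?_ ?_
    L σ ⟨S, hL, hJ⟩).mono le_rfl fun τ => ?_
  · rintro σ ⟨S, h1, h2⟩
    rw [hzero _ _ _ h2]; exact h1
  · rintro e L σ ⟨S, ⟨h0, h1, h2, h3⟩, hJ⟩
    refine ⟨by rw [hzero _ _ _ hJ]; omega, ?_⟩
    simp only [List.mem_cons, List.not_mem_nil, or_false, not_or] at hP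
    refine Cmd.LoopFree.tri_seq (by simp [loadEntry, Cmd.LoopFree]) ?_
    refine (hbody e L S ((loadEntry P).run σ) (hstable _ _ σ _ hJ rfl fun r hr => ?_) ?_).mono
      le_rfl ?_
    · simp only [List.mem_cons, List.not_mem_nil, or_false, not_or] at hr
      simp [loadEntry, Cmd.run, Function.update_apply, hr]
    · simpa [loadEntry, Cmd.run, Function.update_apply, hP, Ne.symm hP.2.1, Ne.symm hP.2.2.1,
        Ne.symm hP.2.2.2] using h2
    · rintro τ ⟨S', h4, h5, h6⟩
      refine ⟨S', ?_, h6⟩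
      rw [h5]
      have := h3.mono le_rfl h4
      simpa [loadEntry, Cmd.run, Function.update_apply, hP, Ne.symm hP.2.1, Ne.symm hP.2.2.1,
        Ne.symm hP.2.2.2] using this
  · rintro ⟨S', h1, h2⟩
    exact ⟨S', h2⟩

/-! ### The entries that arise from outcomes -/

/-- Follow a chain of pointers. -/
def follow (r : ℕ) : ℕ → Cmd
  | 0 => .skip
  | d + 1 => .seq (.load r r 0) (follow r d)

theorem follow_loopFree (r d : ℕ) : (follow r d).LoopFree := by
  induction d with
  | zero => trivial
  | succ d ih => exact ⟨trivial, ih⟩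

theorem follow_run (r d : ℕ) (σ : Store) :
    (follow r d).run σ = ⟨Function.update σ.reg r (σ.mem^[d] (σ.reg r)), σ.mem⟩ := by
  induction d generalizing σ with
  | zero => simp [follow, Cmd.run]
  | succ d ih => simp [follow, Cmd.run, ih]

/-- All cells read along the chain are final, so the extended heap has the same chain. -/
theorem iterate_agree {b d : ℕ} (h : HeapLE S m S' m') (hb : ∀ j < d, m^[j] b ∈ S) :
    m'^[d] b = m^[d] b := by
  induction d with
  | zero => rfl
  | succ d ih =>
    rw [Function.iterate_succ_apply', Function.iterate_succ_apply',
      ih fun j hj => hb j (by omega), h.agree _ (hb d (by omega))]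

/-- The tables that are met along the chain of pointers from `b` contain the lists `tab`, in the
rows for the lookahead `l`. -/
def TabAt (Λ : Layout G k) (H : ℕ → StateStack G → Prop) (l : List (Option T))
    (tab : ℕ → G.NT → List (Entry G)) (b : ℕ) (S : Set ℕ) (m : ℕ → ℕ) : Prop :=
  ∀ d X, 0 < d → (∀ j < d, m^[j] b ∈ S) ∧ m^[d] b + (Λ.pos (.nonterminal X, l) + 1) ∈ S ∧
    Λ.ListAt H S m (tab d X) (m (m^[d] b + (Λ.pos (.nonterminal X, l) + 1)))

theorem TabAt.mono {l : List (Option T)} {tab : ℕ → G.NT → List (Entry G)} {b : ℕ}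
    (h : Λ.TabAt H l tab b S m) (hS : HeapLE S m S' m') : Λ.TabAt H l tab b S' m' := by
  intro d X hd
  obtain ⟨h1, h2, h3⟩ := h d X hd
  refine ⟨fun j hj => ?_, ?_, ?_⟩
  · rw [iterate_agree hS fun i hi => h1 i (hi.trans hj)]
    exact hS.subset (h1 j hj)
  · rw [iterate_agree hS h1]
    exact hS.subset h2
  · rw [iterate_agree hS h1, hS.agree _ h2]
    exact h3.mono le_rfl hS

/-- The command for one outcome. -/
noncomputable def outCmd (Λ : Layout G k) (l : List (Option T))
    (o : List (LROp T G.NT) × VOut G) : Cmd :=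
  match o.2 with
  | .ready v => emit (some v)
  | .accept => emit none
  | .pop d X => .seq (.seq (.copy regPtr regBase) (.seq (follow regPtr d)
      (.load regPtr regPtr (Λ.pos (.nonterminal X, l) + 1))))
      (forEntries regPtr (.seq (prependWord (o.1.map Λ.opc)) (consEntry regOut)))
where
  /-- A single entry above the current base. -/
  emit (v : Option (StateStack G)) : Cmd :=
    .seq (.seq (.copy regEnt regBase) (.seq (.set regCode (Λ.code v)) (.set regRope 0)))
      (.seq (prependWord (o.1.map Λ.opc)) (consEntry regOut))

/-- The registers that are changed by the generation of lists. -/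
abbrev genRegs : List ℕ := [regOut, regPtr, regEnt, regCode, regRope, regVal, regHp]

theorem prepend_cons_run {e : Entry G} {σ : Store} (h : HeapInv S σ) {L : List (Entry G)}
    (ρ : List (LROp T G.NT))
    (he : Λ.EntryAt H S σ.mem e (σ.reg regEnt) (σ.reg regCode) (σ.reg regRope))
    (hL : Λ.ListAt H S σ.mem L (σ.reg regOut)) :
    ∃ S', HeapStep [regOut, regRope, regVal, regHp] S σ S'
        ((consEntry regOut).run ((prependWord (ρ.map Λ.opc)).run σ)) ∧
      Λ.ListAt H S' ((consEntry regOut).run ((prependWord (ρ.map Λ.opc)).run σ)).mem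
        (e.prepend ρ :: L)
        (((consEntry regOut).run ((prependWord (ρ.map Λ.opc)).run σ)).reg regOut) := by
  obtain ⟨S', h1, h2⟩ := prependWord_run (ρ.map Λ.opc) h he.word
  have hs := h1.same
  obtain ⟨S'', h3, h4⟩ := consEntry_run (Λ := Λ) (H := H) (dst := regOut) (e := e.prepend ρ)
    (L := L) h1.inv (by simp) (by simp) ⟨by rw [hs _ (by simp)]; exact he.code_eq,
      by simpa [Entry.prepend] using h2, by rw [hs _ (by simp)]; exact he.base⟩
      (by rw [hs _ (by simp)]; exact hL.mono le_rfl h1.le)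
  exact ⟨S'', (h1.mono (by simp)).trans (h3.mono (by simp)), h4⟩

/-- The bound `N` is fixed before the heap and the tables, because every table list has at most `t`
entries. For `pop d X` a chain of `d` pointers leads to a deeper cell, whose row for `X` is copied
with the new operations in front. The loop reverses the order, hence the permutations. -/
theorem outCmd_tri (t : ℕ) (l : List (Option T)) (o : List (LROp T G.NT) × VOut G)
    (hready : ∀ v, o.2 = .ready v → v ∈ Λ.pending) (hpop : ∀ d X, o.2 = .pop d X → 0 < d) :
    ∃ N, ∀ (H : ℕ → StateStack G → Prop) (S : Set ℕ) (σ : Store) (base : StateStack G)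
      (tab : ℕ → G.NT → List (Entry G)) (L : List (Entry G)), HeapInv S σ →
      H (σ.reg regBase) base → (∀ d X, (tab d X).length ≤ t) →
      Λ.TabAt H l tab (σ.reg regBase) S σ.mem → Λ.ListAt H S σ.mem L (σ.reg regOut) →
      (Λ.outCmd l o).Tri N σ fun τ => ∃ S', HeapStep genRegs S σ S' τ ∧
        ∃ L', L'.Perm (outEntries base tab o ++ L) ∧ Λ.ListAt H S' τ.mem L' (τ.reg regOut) := by
  have hemit : ∀ v : Option (StateStack G), (∀ v', v = some v' → v' ∈ Λ.pending) →
      ∃ N, ∀ (H : ℕ → StateStack G → Prop) (S : Set ℕ) (σ : Store) (base : StateStack G)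
      (L : List (Entry G)), HeapInv S σ → H (σ.reg regBase) base →
      Λ.ListAt H S σ.mem L (σ.reg regOut) →
      (outCmd.emit Λ o v).Tri N σ fun τ => ∃ S', HeapStep genRegs S σ S' τ ∧
        Λ.ListAt H S' τ.mem (⟨o.1, base, v⟩ :: L) (τ.reg regOut) := by
    intro v hv
    have hlf : (outCmd.emit Λ o v).LoopFree :=
      ⟨⟨trivial, trivial, trivial⟩, prependWord_loopFree _, alloc_loopFree _ _⟩
    refine ⟨(outCmd.emit Λ o v).size, fun H S σ base L hi hb hL => hlf.tri ?_⟩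
    have h0 : HeapStep [regEnt, regCode, regRope] S σ S
        ((Cmd.seq (.copy regEnt regBase) (.seq (.set regCode (Λ.code v)) (.set regRope 0))).run σ) :=
      hi.step_regs _ rfl (fun r hr => by
        simp only [List.mem_cons, List.not_mem_nil, or_false, not_or] at hr
        simp [Cmd.run, hr]) (by simp) (by simp)
    obtain ⟨S', h1, h2⟩ := prepend_cons_run (Λ := Λ) (H := H) (e := ⟨[], base, v⟩) (L := L)
      h0.inv o.1 ⟨by simp [Cmd.run], by simp [Cmd.run, holdsWord_nil],
        fun v' hv' => ⟨by simpa [Cmd.run, Function.update_apply] using hb, hv v' hv'⟩⟩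
      (by simpa [Cmd.run, Function.update_apply] using hL)
    refine ⟨S', (h0.mono (by simp)).trans (h1.mono (by simp)), ?_⟩
    simp only [Entry.prepend, List.append_nil] at h2
    exact h2
  obtain ⟨ρ, o⟩ := o
  cases o with
  | ready v =>
    obtain ⟨N, hN⟩ := hemit (some v) fun v' h => by cases h; exact hready v rfl
    refine ⟨N, fun H S σ base tab L h1 h2 h3 h4 h5 =>
      (hN H S σ base L h1 h2 h5).mono le_rfl fun τ => ?_⟩
    rintro ⟨S', h6, h7⟩
    exact ⟨S', h6, _, .refl _, h7⟩
  | accept =>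
    obtain ⟨N, hN⟩ := hemit none fun v' h => by cases h
    refine ⟨N, fun H S σ base tab L h1 h2 h3 h4 h5 =>
      (hN H S σ base L h1 h2 h5).mono le_rfl fun τ => ?_⟩
    rintro ⟨S', h6, h7⟩
    exact ⟨S', h6, _, .refl _, h7⟩
  | pop d X =>
    set c₁ := Cmd.seq (.copy regPtr regBase) (.seq (follow regPtr d)
      (.load regPtr regPtr (Λ.pos (.nonterminal X, l) + 1))) with hc₁
    set c₂ := Cmd.seq (prependWord (ρ.map Λ.opc)) (consEntry regOut) with hc₂
    have hlf : c₂.LoopFree := ⟨prependWord_loopFree _, alloc_loopFree _ _⟩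
    refine ⟨c₁.size + (t * ((loadEntry regPtr).size + c₂.size + 1 + 1) + 1) + 1,
      fun H S σ base tab L h1 h2 h3 h4 h5 => ?_⟩
    obtain ⟨-, -, h8⟩ := h4 d X (hpop d X rfl)
    refine (Cmd.LoopFree.tri_seq (a := c₁) (b := forEntries regPtr c₂)
      ⟨trivial, follow_loopFree _ _, trivial⟩ (σ := σ) (n := t *
        ((loadEntry regPtr).size + c₂.size + 1 + 1) + 1) ?_)
    have hrun : c₁.run σ = ⟨Function.update σ.reg regPtr
        (σ.mem (σ.mem^[d] (σ.reg regBase) + (Λ.pos (.nonterminal X, l) + 1))), σ.mem⟩ := by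
      simp [hc₁, Cmd.run, follow_run]
    rw [hrun]
    have h0 := (h1.step_update regPtr
      (σ.mem (σ.mem^[d] (σ.reg regBase) + (Λ.pos (.nonterminal X, l) + 1)))
      (by simp) (by simp)).mono (rs' := genRegs) (by simp)
    refine (forEntries_tri (Λ := Λ) (H := H) (S := S) (n := c₂.size) (L := tab d X)
      (fun R S' σ' => HeapStep genRegs S σ S' σ' ∧ ∃ L' : List (Entry G), L'.Perm (L ++ (tab d X).map
        (Entry.prepend ρ)) ∧ ∃ L₁ : List (Entry G), L'.Perm (L₁ ++ R.map (Entry.prepend ρ)) ∧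
          Λ.ListAt H S' σ'.mem L₁ (σ'.reg regOut)) (by simp) ?_ ?_ ?_ ?_ ?_).mono ?_ ?_
    · rintro R S' σ' ⟨h, -⟩; exact h.inv.zero
    · rintro R S' σ' τ ⟨h, L', hp, L₁, hp₁, hL₁⟩ hm hr
      refine ⟨h.trans ((h.inv.step_regs _ hm hr (by simp) (by simp)).mono (by simp)), L', hp, L₁,
        hp₁, ?_⟩
      rw [hm, hr _ (by simp)]; exact hL₁
    · rintro e R S' σ' ⟨h, L', hp, L₁, hp₁, hL₁⟩ he
      refine hlf.tri ?_
      obtain ⟨S'', h9, h10⟩ := prepend_cons_run (Λ := Λ) h.inv ρ he hL₁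
      refine ⟨S'', h9.le, h9.same _ (by simp), h.trans (h9.mono (by simp)), L', hp, _,
        hp₁.trans ?_, h10⟩
      simp
    · simpa using h8
    · refine ⟨h0, _, .refl _, L, .refl _, ?_⟩
      simpa using h5
    · have := Nat.mul_le_mul_right ((loadEntry regPtr).size + c₂.size + 1 + 1) (h3 d X)
      omega
    · rintro τ ⟨S', h, L', hp, L₁, hp₁, hL₁⟩
      refine ⟨S', h, L₁, ?_, hL₁⟩
      simp only [List.map_nil, List.append_nil] at hp₁
      exact hp₁.symm.trans (hp.trans List.perm_append_comm)

/-- The command that generates the list of the entries for a list of outcomes. -/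
noncomputable def genList (Λ : Layout G k) (l : List (Option T)) :
    List (List (LROp T G.NT) × VOut G) → Cmd
  | [] => .set regOut 0
  | o :: os => .seq (genList Λ l os) (Λ.outCmd l o)

theorem genList_tri (t : ℕ) (l : List (Option T)) (os : List (List (LROp T G.NT) × VOut G))
    (hready : ∀ o ∈ os, ∀ v, o.2 = .ready v → v ∈ Λ.pending)
    (hpop : ∀ o ∈ os, ∀ d X, o.2 = .pop d X → 0 < d) :
    ∃ N, ∀ (H : ℕ → StateStack G → Prop) (S : Set ℕ) (σ : Store) (base : StateStack G)
      (tab : ℕ → G.NT → List (Entry G)), HeapInv S σ →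
      H (σ.reg regBase) base → (∀ d X, (tab d X).length ≤ t) →
      Λ.TabAt H l tab (σ.reg regBase) S σ.mem →
      (Λ.genList l os).Tri N σ fun τ => ∃ S', HeapStep genRegs S σ S' τ ∧
        ∃ L, L.Perm (os.flatMap (outEntries base tab)) ∧ Λ.ListAt H S' τ.mem L (τ.reg regOut) := by
  induction os with
  | nil =>
    refine ⟨(Cmd.set regOut 0).size, fun H S σ base tab h1 h2 h3 h4 =>
      Cmd.LoopFree.tri (c := .set regOut 0) trivial ?_⟩
    exact ⟨S, (h1.step_update regOut 0 (by simp) (by simp)).mono (by simp), [], .refl _,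
      by simp [Cmd.run, ListAt]⟩
  | cons o os ih =>
    obtain ⟨N, hN⟩ := ih (fun o ho => hready o (by simp [ho])) fun o ho => hpop o (by simp [ho])
    obtain ⟨N', hN'⟩ := outCmd_tri (Λ := Λ) t l o (hready o (by simp)) (hpop o (by simp))
    refine ⟨N + N' + 1, fun H S σ base tab h1 h2 h3 h4 => Cmd.Tri.seq ?_⟩
    refine (hN H S σ base tab h1 h2 h3 h4).mono le_rfl ?_
    rintro τ ⟨S', h5, L, hp, hL⟩
    have hb : τ.reg regBase = σ.reg regBase := h5.same _ (by simp)
    refine (hN' H S' τ base tab L h5.inv (by rw [hb]; exact h2) h3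
      (by rw [hb]; exact h4.mono h5.le) hL).mono le_rfl ?_
    rintro υ ⟨S'', h6, L', hp', hL'⟩
    refine ⟨S'', h5.trans h6, L', hp'.trans ?_, hL'⟩
    rw [List.flatMap_cons]
    exact hp.append_left _

end Layout

end Lists

-- State stacks as linked cells with tables

section Cells

variable {T : Type} {G : ContextFreeGrammar T} {k : ℕ}

theorem vred_of_mem_vouts {q : Set (LRItem T G.NT)} {l : List (Option T)} {v : StateStack G}
    {o : List (LROp T G.NT) × VOut G} (h : o ∈ vouts G k q l v) : VRed G k q l v o.1 o.2 := by
  rw [vouts] at h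
  split_ifs at h with hf
  · simpa using h
  · simp at h

theorem pop_pos_of_mem_tableOuts (hG : StartNormal G) {q : Set (LRItem T G.NT)}
    {l : List (Option T)} {Y : Symbol T G.NT} {o : List (LROp T G.NT) × VOut G}
    (h : o ∈ tableOuts G k q Y l) {d : ℕ} {X : G.NT} (ho : o.2 = .pop d X) : 0 < d := by
  rw [tableOuts] at h
  split_ifs at h with hc
  · obtain ⟨hY, st, hst⟩ := hc
    exact ((vred_of_mem_vouts h).pop_spec hG (hst.push hY) ho).2.1
  · simp at h

namespace Layout

variable {Λ : Layout G k} {H H' : ℕ → StateStack G → Prop} {S S' : Set ℕ} {m m' : ℕ → ℕ}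

/-! ### Stacks in memory -/

/-- The row `κ` of a table at the address `c`. -/
def RowAt (Λ : Layout G k) (H : ℕ → StateStack G → Prop) (S : Set ℕ) (m : ℕ → ℕ) (c : ℕ)
    (st : StateStack G) (i : ℕ) (κ : Symbol T G.NT × List (Option T)) : Prop :=
  c + (i + 1) ∈ S ∧
    ∃ L, Λ.ListAt H S m L (m (c + (i + 1))) ∧ ListSpec L (TabRel G k κ.2 st 0 κ.1)

/-- The top cell of the stack `st` is stored at the address `c`. It consists of a pointer to the
next cell and of the table of the stack. -/
structure CellAt (Λ : Layout G k) (H : ℕ → StateStack G → Prop) (S : Set ℕ) (m : ℕ → ℕ) (c : ℕ)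
    (st : StateStack G) : Prop where
  stack : st = [] ∨ IsStack G k st
  mem : c ∈ S
  parent : H (m c) st.tail
  row : ∀ κ ∈ Λ.keys, Λ.RowAt H S m c st (Λ.pos κ) κ

/-- Every address to which a stack is assigned contains a cell of this stack. -/
def HeapOK (Λ : Layout G k) (H : ℕ → StateStack G → Prop) (S : Set ℕ) (m : ℕ → ℕ) : Prop :=
  ∀ c st, H c st → Λ.CellAt H S m c st

theorem RowAt.mono (hH : H ≤ H') (h : HeapLE S m S' m') {c i : ℕ} {st : StateStack G}
    {κ : Symbol T G.NT × List (Option T)} (hr : Λ.RowAt H S m c st i κ) :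
    Λ.RowAt H' S' m' c st i κ := by
  obtain ⟨h1, L, h2, h3⟩ := hr
  exact ⟨h.subset h1, L, by rw [h.agree _ h1]; exact h2.mono hH h, h3⟩

theorem CellAt.mono (hH : H ≤ H') (h : HeapLE S m S' m') {c : ℕ} {st : StateStack G}
    (hc : Λ.CellAt H S m c st) : Λ.CellAt H' S' m' c st :=
  ⟨hc.stack, h.subset hc.mem, by rw [h.agree _ hc.mem]; exact hH _ _ hc.parent,
    fun κ hκ => (hc.row κ hκ).mono hH h⟩

theorem HeapOK.mono (h : HeapLE S m S' m') (ho : Λ.HeapOK H S m) : Λ.HeapOK H S' m' :=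
  fun c st hc => (ho c st hc).mono le_rfl h

theorem HeapOK.iterate (ho : Λ.HeapOK H S m) {c : ℕ} {st : StateStack G} (hp : H (m c) st)
    (d : ℕ) : H (m^[d + 1] c) (st.drop d) := by
  induction d with
  | zero => exact hp
  | succ d ih =>
    rw [Function.iterate_succ_apply', ← List.tail_drop]
    exact (ho _ _ ih).parent

/-- The table in `c` itself may still be unfinished: for `d > 0` the lookup only passes through the
pointer in `c` and ends in a finished cell further down. -/
theorem HeapOK.exists_tab (hG : StartNormal G) {t : ℕ} (hX : IsXLR G k t) (ho : Λ.HeapOK H S m)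
    (hH : H ≤ H') {c : ℕ} (hc : c ∈ S) {st : StateStack G} (hp : H (m c) st)
    (q : Set (LRItem T G.NT)) {l : List (Option T)} (hl : l.length = k) :
    ∃ tab : ℕ → G.NT → List (Entry G), Λ.TabAt H' l tab c S m ∧
      (∀ d X, (tab d X).length ≤ t) ∧
      ∀ d X, 0 < d → ListSpec (tab d X) (TabRel G k l (q :: st) d (.nonterminal X)) := by
  have h : ∀ d X, ∃ L : List (Entry G), L.length ≤ t ∧ (0 < d →
      ((∀ j < d, m^[j] c ∈ S) ∧ m^[d] c + (Λ.pos (.nonterminal X, l) + 1) ∈ S ∧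
      Λ.ListAt H' S m L (m (m^[d] c + (Λ.pos (.nonterminal X, l) + 1)))) ∧
      ListSpec L (TabRel G k l (q :: st) d (.nonterminal X))) := by
    intro d X
    cases d with
    | zero => exact ⟨[], by simp, fun h => absurd h (by omega)⟩
    | succ d =>
      have hd := ho _ _ (ho.iterate hp d)
      obtain ⟨h1, L, h2, h3⟩ := hd.row (.nonterminal X, l) ((Λ.mem_keys _ _).2 hl)
      refine ⟨L, h3.length_le_of_tabRel hG hX hl hd.stack, fun _ => ⟨⟨fun j hj => ?_, h1,
        h2.mono hH (.refl _ _)⟩, h3⟩⟩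
      cases j with
      | zero => exact hc
      | succ j => exact (ho _ _ (ho.iterate hp j)).mem
  choose tab h1 h2 using h
  exact ⟨tab, fun d X hd => (h2 d X hd).1, h1, fun d X hd => (h2 d X hd).2⟩

/-- Fill the rows of the table of the new cell at `regBase`, beginning with row `i`. -/
noncomputable def fillRows (Λ : Layout G k) (q : Set (LRItem T G.NT)) :
    ℕ → List (Symbol T G.NT × List (Option T)) → Cmd
  | _, [] => .skip
  | i, κ :: κs => .seq (.seq (Λ.genList κ.2 (tableOuts G k q κ.1 κ.2))
      (.store regBase (i + 1) regOut)) (fillRows Λ q (i + 1) κs)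

/-- Reserve a new cell above the cell at `regCell`. -/
noncomputable def newCell (Λ : Layout G k) : Cmd :=
  .seq (.copy regBase regHp) (.seq (.store regHp 0 regCell) (incBy regHp (Λ.keys.length + 1)))

/-- Push a state on the stack at `regCell`. -/
noncomputable def push (Λ : Layout G k) (q : Set (LRItem T G.NT)) : Cmd :=
  .seq Λ.newCell (.seq (Λ.fillRows q 0 Λ.keys) (.copy regCell regBase))

/-- The registers that are changed by `push`. -/
abbrev pushRegs : List ℕ := regCell :: regBase :: genRegs

/-- The intermediate states of the command `push`, after `i` rows. -/
structure PushInv (Λ : Layout G k) (H : ℕ → StateStack G → Prop) (S₀ : Set ℕ) (σ₀ : Store)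
    (q : Set (LRItem T G.NT)) (st : StateStack G) (i : ℕ) (S : Set ℕ) (σ : Store) : Prop where
  step : HeapStep (regBase :: genRegs) S₀ σ₀ S σ
  base : σ.reg regBase = σ₀.reg regHp
  mem : σ₀.reg regHp ∈ S
  parent : σ.mem (σ₀.reg regHp) = σ₀.reg regCell
  hp : σ₀.reg regHp + Λ.keys.length < σ.reg regHp
  free : ∀ j, i ≤ j → j < Λ.keys.length → σ₀.reg regHp + (j + 1) ∉ S
  row : ∀ j (hj : j < Λ.keys.length), j < i →
    Λ.RowAt H S σ.mem (σ₀.reg regHp) (q :: st) j Λ.keys[j]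

/-- The rows of the new cell are reserved below the heap pointer but become final one by one. `H'`
already names the new cell, so entries may use it as their base while its table is being filled; the
lookups rely only on the older cells described by `H`. -/
theorem fillRows_tri (hG : StartNormal G) {t : ℕ} (hX : IsXLR G k t) (Λ : Layout G k)
    (q : Set (LRItem T G.NT)) (κs : List (Symbol T G.NT × List (Option T))) :
    ∀ i, Λ.keys.drop i = κs → ∃ N, ∀ (H H' : ℕ → StateStack G → Prop) (S₀ S : Set ℕ)
      (σ₀ σ : Store) (st : StateStack G), Λ.HeapOK H S₀ σ₀.mem → H ≤ H' →
      H (σ₀.reg regCell) st → H' (σ₀.reg regHp) (q :: st) → IsStack G k (q :: st) →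
      Λ.PushInv H' S₀ σ₀ q st i S σ →
      (Λ.fillRows q i κs).Tri N σ fun τ =>
        ∃ S', Λ.PushInv H' S₀ σ₀ q st Λ.keys.length S' τ := by
  induction κs with
  | nil =>
    refine fun i hi => ⟨1, fun H H' S₀ S σ₀ σ st h1 h2 h3 h4 h5 h6 =>
      Cmd.LoopFree.tri (c := .skip) trivial ⟨S, h6.step, h6.base, h6.mem, h6.parent, h6.hp,
        fun j hj hj' => absurd hj' (by omega), fun j hj _ => h6.row j hj ?_⟩⟩
    have := List.drop_eq_nil_iff.1 hi
    omega
  | cons κ κs ih =>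
    intro i hi
    have hlt : i < Λ.keys.length := by
      by_contra h
      rw [List.drop_of_length_le (by omega)] at hi
      cases hi
    have hκ : Λ.keys[i] = κ := by
      rw [List.drop_eq_getElem_cons hlt] at hi; exact (List.cons_eq_cons.1 hi).1
    have hl : κ.2.length = k :=
      (Λ.mem_keys κ.1 κ.2).1 (hκ ▸ List.getElem_mem hlt)
    obtain ⟨N, hN⟩ := ih (i + 1) (by
      rw [List.drop_eq_getElem_cons hlt] at hi; exact (List.cons_eq_cons.1 hi).2)
    obtain ⟨N', hN'⟩ := genList_tri (Λ := Λ) t κ.2 (tableOuts G k q κ.1 κ.2)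
      (fun o ho v hv => Λ.mem_pending q κ.1 κ.2 hl o ho v hv)
      (fun o ho d X hd => pop_pos_of_mem_tableOuts hG ho hd)
    refine ⟨N' + 1 + 1 + N + 1, fun H H' S₀ S σ₀ σ st h1 h2 h3 h4 h5 h6 => Cmd.Tri.seq ?_⟩
    refine (Cmd.Tri.seq (m := 1) (n := N')
      (Q := fun τ => ∃ S', Λ.PushInv H' S₀ σ₀ q st (i + 1) S' τ) ?_).mono le_rfl ?_
    · obtain ⟨tab, ht1, ht2, ht3⟩ := (h1.mono h6.step.le).exists_tab hG hX h2 h6.mem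
        (by rw [h6.parent]; exact h3) q hl
      refine (hN' H' S σ (q :: st) tab h6.step.inv (by rw [h6.base]; exact h4) ht2
        (by rw [h6.base]; exact ht1)).mono le_rfl ?_
      rintro τ ⟨S', h7, L, hp, hL⟩
      have hspec := listSpec_tableOuts hG hX hl h5 (fun d X hd _ => ht3 d X hd) κ.1
      have hspecL : ListSpec L (TabRel G k κ.2 (q :: st) 0 κ.1) :=
        ⟨((hp.map _).nodup_iff).2 hspec.1, fun ρ res => by
          rw [hspec.2]; simp only [hp.mem_iff]⟩
      have hb : τ.reg regBase = σ₀.reg regHp := by rw [h7.same _ (by simp), h6.base]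
      -- Cells that became final while the list was generated lie beyond the reserved block.
      have hfree : ∀ j, i ≤ j → j < Λ.keys.length → σ₀.reg regHp + (j + 1) ∉ S' := by
        intro j hj hj' h
        have := h7.fresh _ h (h6.free j hj hj')
        have := h6.hp
        omega
      set a := σ₀.reg regHp + (i + 1) with ha
      have ha' := hfree i le_rfl hlt
      rw [← ha] at ha'
      have hle : HeapLE S' τ.mem (insert a S')
          (Function.update τ.mem a (τ.reg regOut)) :=
        ⟨Set.subset_insert _ _, fun j hj => Function.update_of_ne (ne_of_mem_of_not_mem hj ha') _ _⟩
      have hhp : σ₀.reg regHp + Λ.keys.length < τ.reg regHp := h6.hp.trans_le h7.hp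
      have h8 := h6.step.trans (h7.mono (List.subset_cons_self _ _))
      refine Cmd.LoopFree.tri (c := .store regBase (i + 1) regOut) trivial ⟨insert a S', ?_⟩
      have hrun : (Cmd.store regBase (i + 1) regOut).run τ =
          ⟨τ.reg, Function.update τ.mem a (τ.reg regOut)⟩ := by
        simp only [Cmd.run, hb, ha]
      rw [hrun]
      refine ⟨⟨⟨h7.inv.zero, h7.inv.pos, ?_⟩, h8.le.trans hle, ?_, h8.hp, h8.same⟩, hb,
        hle.subset (h7.le.subset h6.mem), ?_, hhp, ?_, ?_⟩
      · rintro j (rfl | hj)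
        · simp only [ha]; omega
        · exact h7.inv.bound j hj
      · rintro j (rfl | hj) hj'
        · simp only [ha]; omega
        · exact h8.fresh j hj hj'
      · refine (hle.agree _ (h7.le.subset h6.mem)).trans ?_
        rw [h7.le.agree _ h6.mem, h6.parent]
      · intro j hj hj'
        rintro (h | h)
        · simp only [ha] at h; omega
        · exact hfree j (by omega) hj' h
      · intro j hj hj'
        rcases Nat.lt_succ_iff_lt_or_eq.1 hj' with h | rfl
        · exact ((h6.row j hj h).mono le_rfl h7.le).mono le_rfl hle
        · refine ⟨Set.mem_insert _ _, L, ?_, by rw [hκ]; exact hspecL⟩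
          simp only [← ha, Function.update_self]
          exact hL.mono le_rfl hle
    · rintro τ ⟨S', h7⟩
      exact hN H H' S₀ S' σ₀ τ st h1 h2 h3 h4 h5 h7

/-- The cost does not depend on the height of the stack: the table has a fixed number of rows, each
generated in bounded time. -/
theorem push_tri (hG : StartNormal G) {t : ℕ} (hX : IsXLR G k t) (Λ : Layout G k)
    (q : Set (LRItem T G.NT)) :
    ∃ N, ∀ (H : ℕ → StateStack G → Prop) (S : Set ℕ) (σ : Store) (st : StateStack G),
      HeapInv S σ → Λ.HeapOK H S σ.mem → H (σ.reg regCell) st → IsStack G k (q :: st) →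
      (Λ.push q).Tri N σ fun τ => ∃ S' H', HeapStep pushRegs S σ S' τ ∧ H ≤ H' ∧
        Λ.HeapOK H' S' τ.mem ∧ H' (τ.reg regCell) (q :: st) := by
  obtain ⟨N, hN⟩ := fillRows_tri hG hX Λ q Λ.keys 0 rfl
  have hlf : Λ.newCell.LoopFree := ⟨trivial, trivial, incBy_loopFree _ _⟩
  refine ⟨Λ.newCell.size + (N + 1 + 1) + 1, fun H S σ st h1 h2 h3 h4 => hlf.tri_seq ?_⟩
  set A := σ.reg regHp with hA
  have hrun : Λ.newCell.run σ = ⟨Function.update (Function.update σ.reg regBase A) regHp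
      (A + (Λ.keys.length + 1)), Function.update σ.mem A (σ.reg regCell)⟩ := by
    simp [newCell, Cmd.run, incBy_run, hA]
  rw [hrun]
  have hAS : A ∉ S := fun h => (h1.bound A h).false
  have hle : HeapLE S σ.mem (insert A S) (Function.update σ.mem A (σ.reg regCell)) :=
    ⟨Set.subset_insert _ _, fun j hj => Function.update_of_ne (ne_of_mem_of_not_mem hj hAS) _ _⟩
  -- The address `A` is assigned to `q :: st` before any row of its table exists.
  have h5 : Λ.PushInv (fun c st' => H c st' ∨ c = A ∧ st' = q :: st) S σ q st 0 (insert A S)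
      ⟨Function.update (Function.update σ.reg regBase A) regHp
      (A + (Λ.keys.length + 1)), Function.update σ.mem A (σ.reg regCell)⟩ := by
    refine ⟨⟨⟨?_, ?_, ?_⟩, hle, ?_, ?_, ?_⟩, ?_, ?_, ?_, ?_, ?_, ?_⟩
    · simp [h1.zero]
    · simp
    · rintro j (rfl | hj)
      · simp
      · have := h1.bound j hj
        simp only [Function.update_self]; omega
    · rintro j (rfl | hj) hj'
      · exact le_rfl
      · exact absurd hj hj'
    · simp [hA]
    · intro r hr
      simp only [List.mem_cons, List.not_mem_nil, or_false, not_or] at hr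
      simp [hr]
    · simp [hA]
    · simp [hA]
    · simp [hA]
    · simp [hA]
    · rintro j - hj (h | h)
      · omega
      · have := h1.bound _ h; omega
    · intro j hj h; omega
  refine Cmd.Tri.seq ((hN H _ S _ σ _ st h2 (fun c st' h => .inl h) h3 (.inr ⟨rfl, rfl⟩) h4
    h5).mono le_rfl ?_)
  rintro τ ⟨S', h6⟩
  refine Cmd.LoopFree.tri (c := .copy regCell regBase) trivial
    ⟨S', fun c st' => H c st' ∨ c = A ∧ st' = q :: st, ?_, fun c st' h => .inl h, ?_, ?_⟩
  · exact (h6.step.mono (List.subset_cons_self _ _)).trans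
      ((h6.step.inv.step_update regCell (τ.reg regBase) (by simp) (by simp)).mono (by simp))
  · rintro c st' (h | ⟨rfl, rfl⟩)
    · exact (h2 c st' h).mono (fun c st' h => .inl h) h6.step.le
    · refine ⟨.inr h4, h6.mem, .inl ?_, fun κ hκ => ?_⟩
      · have h7 : τ.mem A = σ.reg regCell := h6.parent
        simp only [Cmd.run, h7]; exact h3
      · have hlt : Λ.pos κ < Λ.keys.length := by
          classical
          rw [pos]; convert List.idxOf_lt_length_of_mem hκ
        have := h6.row (Λ.pos κ) hlt hlt
        rwa [show Λ.keys[Λ.pos κ] = κ by simp [pos]] at this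
  · right
    simp [Cmd.run, h6.base, hA]

/-- Push a list of states, the last one first. -/
noncomputable def pushAll (Λ : Layout G k) : StateStack G → Cmd
  | [] => .skip
  | q :: v => .seq (pushAll Λ v) (Λ.push q)

theorem pushAll_tri (hG : StartNormal G) {t : ℕ} (hX : IsXLR G k t) (Λ : Layout G k)
    (v : StateStack G) :
    ∃ N, ∀ (H : ℕ → StateStack G → Prop) (S : Set ℕ) (σ : Store) (st : StateStack G),
      HeapInv S σ → Λ.HeapOK H S σ.mem → H (σ.reg regCell) st →
      v ++ st = [] ∨ IsStack G k (v ++ st) →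
      (Λ.pushAll v).Tri N σ fun τ => ∃ S' H', HeapStep pushRegs S σ S' τ ∧ H ≤ H' ∧
        Λ.HeapOK H' S' τ.mem ∧ H' (τ.reg regCell) (v ++ st) := by
  induction v with
  | nil =>
    exact ⟨1, fun H S σ st h1 h2 h3 _ => Cmd.LoopFree.tri (c := .skip) trivial
      ⟨S, H, h1.step_refl _, le_rfl, h2, h3⟩⟩
  | cons q v ih =>
    obtain ⟨N, hN⟩ := ih
    obtain ⟨N', hN'⟩ := push_tri hG hX Λ q
    refine ⟨N + N' + 1, fun H S σ st h1 h2 h3 h5 => Cmd.Tri.seq ?_⟩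
    replace h5 : IsStack G k (q :: (v ++ st)) := by simpa using h5
    have h4 : v ++ st = [] ∨ IsStack G k (v ++ st) := by
      by_cases h : v ++ st = []
      · exact .inl h
      · exact .inr (h5.tail h)
    refine (hN H S σ st h1 h2 h3 h4).mono le_rfl ?_
    rintro τ ⟨S', H', h6, h7, h8, h9⟩
    refine (hN' H' S' τ _ h6.inv h8 h9 h5).mono le_rfl ?_
    rintro υ ⟨S'', H'', h10, h11, h12, h13⟩
    exact ⟨S'', H'', h6.trans h10, h7.trans h11, h12, h13⟩

end Layout

end Cells

section Switch

/-! ### Case distinctions -/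

/-- Execute the command `g a` for the first `a` in the list whose value `f a` is in the
register `r`. -/
def switch {α : Type*} (r : ℕ) (f : α → ℕ) (g : α → Cmd) : List α → Cmd
  | [] => .skip
  | a :: as => .seq (.set regSel (f a)) (.ite r regSel (g a) (switch r f g as))

/-- The comparisons overwrite `regSel`, hence the arbitrary value `v` in the hypotheses. -/
theorem switch_tri {α : Type*} {r : ℕ} (hr : r ≠ regSel) {f : α → ℕ} {g : α → Cmd} {N : ℕ}
    {σ : Store} {Q : Store → Prop} {as : List α}
    (h : ∀ a ∈ as, f a = σ.reg r → ∀ v,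
      (g a).Tri N ⟨Function.update σ.reg regSel v, σ.mem⟩ Q)
    (hnone : (∀ a ∈ as, f a ≠ σ.reg r) → ∀ v, Q ⟨Function.update σ.reg regSel v, σ.mem⟩) :
    (switch r f g as).Tri (as.length * 3 + N + 1) σ Q := by
  suffices ∀ v, (switch r f g as).Tri (as.length * 3 + N + 1)
      ⟨Function.update σ.reg regSel v, σ.mem⟩ Q by
    simpa using this (σ.reg regSel)
  induction as with
  | nil =>
    intro v
    exact (Cmd.LoopFree.tri (c := .skip) trivial (hnone (by simp) v)).mono
      (by simp [Cmd.size]) fun _ h => h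
  | cons a as ih =>
    intro v
    rw [switch]
    refine (Cmd.LoopFree.tri_seq (a := .set regSel (f a)) (n := as.length * 3 + N + 1 + 1)
      trivial ?_).mono ?_ fun _ h => h
    · simp only [Cmd.run, Function.update_idem]
      by_cases ha : f a = σ.reg r
      · refine (Cmd.Tri.ite_eq ?_ (h a (by simp) ha _)).mono (by omega) fun _ h => h
        simp [hr, ha]
      · refine Cmd.Tri.ite_ne ?_ (ih (fun b hb => h b (by simp [hb])) (fun hn => hnone ?_) _)
        · simpa [hr] using Ne.symm ha
        · intro b hb
          rcases List.mem_cons.1 hb with rfl | hb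
          · exact ha
          · exact hn b hb
    · simp only [List.length_cons, Cmd.size]; omega

/-- A case distinction over a finite list needs one time bound for all branches. The hypothesis
covers all larger `n`, so a maximum works. -/
theorem exists_common_bound {α : Type*} {P : α → ℕ → Prop} (as : List α)
    (hP : ∀ a ∈ as, ∃ N, ∀ n, N ≤ n → P a n) : ∃ N, ∀ a ∈ as, P a N := by
  suffices ∃ N, ∀ a ∈ as, ∀ n, N ≤ n → P a n by
    obtain ⟨N, hN⟩ := this
    exact ⟨N, fun a ha => hN a ha N le_rfl⟩
  induction as with
  | nil => exact ⟨0, by simp⟩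
  | cons a as ih =>
    obtain ⟨N, hN⟩ := ih fun b hb => hP b (by simp [hb])
    obtain ⟨N', hN'⟩ := hP a (by simp)
    refine ⟨max N N', fun b hb n hn => ?_⟩
    rcases List.mem_cons.1 hb with rfl | hb
    · exact hN' n ((le_max_right _ _).trans hn)
    · exact hN b hb n ((le_max_left _ _).trans hn)

/-- Choose the command `body w` for the word `w` of length `n` that stands in the memory at the
address in `regInput`, beginning with the offset `d`. -/
def withWindow {α : Type*} (as : List α) (f : α → ℕ) : ℕ → ℕ → List α → (List α → Cmd) → Cmd
  | 0, _, acc, body => body acc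
  | n + 1, d, acc, body => .seq (.load regTmp regInput d)
      (switch regTmp f (fun a => withWindow as f n (d + 1) (acc ++ [a]) body) as)

/-- Branching over all symbols at each position moves the window from the data into the program, so
that `body` can be specialised to the word read; this costs a constant per position. -/
theorem withWindow_tri {α : Type*} {as : List α} (has : ∀ a, a ∈ as) {f : α → ℕ}
    (hf : Function.Injective f) {body : List α → Cmd} {N : ℕ} {Q : Store → Prop} (w : List α) :
    ∀ (d : ℕ) (acc : List α) (σ : Store),
      (∀ i (hi : i < w.length), σ.mem (σ.reg regInput + (d + i)) = f w[i]) →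
      (∀ τ, τ.mem = σ.mem → (∀ r, r ∉ [regTmp, regSel] → τ.reg r = σ.reg r) →
        (body (acc ++ w)).Tri N τ Q) →
      (withWindow as f w.length d acc body).Tri (w.length * (as.length * 3 + 3) + N) σ Q := by
  induction w with
  | nil =>
    intro d acc σ _ h
    simpa [withWindow] using h σ rfl fun _ _ => rfl
  | cons a w ih =>
    intro d acc σ hw h
    rw [List.length_cons, withWindow]
    refine (Cmd.LoopFree.tri_seq (a := .load regTmp regInput d) (n := as.length * 3 +
      (w.length * (as.length * 3 + 3) + N) + 1) trivial (switch_tri (by simp) ?_ ?_)).mono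
      ?_ fun _ h => h
    · intro b _ hb v
      have h0 := hw 0 (by simp)
      simp only [Cmd.run, Function.update_self] at hb ⊢
      simp only [Nat.add_zero, List.getElem_cons_zero] at h0
      obtain rfl : b = a := hf (hb.trans h0)
      refine ih (d + 1) (acc ++ [b]) _ ?_ ?_
      · intro i hi
        have := hw (i + 1) (by simpa using hi)
        simpa [Nat.add_assoc, Nat.add_comm, Nat.add_left_comm] using this
      · intro τ hm hs
        rw [List.append_assoc, List.singleton_append]
        refine h τ hm fun r hr => ?_
        rw [hs r hr]
        simp only [List.mem_cons, List.not_mem_nil, or_false, not_or] at hr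
        simp [hr]
    · intro hn
      have h0 := hw 0 (by simp)
      simp only [Nat.add_zero, List.getElem_cons_zero] at h0
      exact absurd (by simpa [Cmd.run] using h0.symm) (hn a (has a))
    · simp only [Cmd.size, Nat.add_mul]; omega

end Switch

-- The effect of one shift on the list of copies

section Steps

variable {T : Type} {G : ContextFreeGrammar T} {k : ℕ}

theorem CopyAt.isStack (hG : StartNormal G) {x : List T} {s : ℕ} {p : List (LROp T G.NT)}
    {st : StateStack G} (h : CopyAt G k x s p (some st)) : IsStack G k st := by
  obtain ⟨fs, ρ, hf, -, -, hr⟩ := h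
  exact hr.isStack hG ⟨fs, hf, rfl⟩

theorem Red.shift_notMem {l : List (Option T)} {st : StateStack G} {ρ : List (LROp T G.NT)}
    {res : Option (StateStack G)} (h : Red G k l st ρ res) (a : T) : LROp.shift a ∉ ρ := by
  induction h with
  | ready => simp
  | accept => simp
  | step S st r q st' ρ res h hr hd hrec ih => simpa using ih

theorem append_cons_inj {α : Type*} {a : α} {u u' v v' : List α} (hv : a ∉ v) (hv' : a ∉ v')
    (h : u ++ a :: v = u' ++ a :: v') : u = u' ∧ v = v' := by
  rcases List.append_eq_append_iff.1 h with ⟨w, rfl, h₁⟩ | ⟨w, rfl, h₁⟩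
  · cases w with
    | nil => simpa using h₁
    | cons b w =>
      obtain ⟨rfl, rfl⟩ := List.cons_eq_cons.1 h₁
      simp at hv
  · cases w with
    | nil => simpa [eq_comm] using h₁
    | cons b w =>
      obtain ⟨rfl, rfl⟩ := List.cons_eq_cons.1 h₁
      simp at hv'

/-- The list `L` contains the copies that arise from the copies in the list `P` by shifting the
terminal `a`. -/
def StepSpec (G : ContextFreeGrammar T) (k : ℕ) (a : T) (l : List (Option T))
    (P L : List (Entry G)) : Prop :=
  (L.map Entry.ops).Nodup ∧ ∀ p res, (∃ e ∈ L, e.ops = p ∧ e.res = res) ↔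
    ∃ e ∈ P, ∃ st ρ, e.res = some st ∧ p = e.ops ++ .shift a :: ρ ∧
      TabRel G k l st 0 (.terminal a) ρ res

theorem StepSpec.nil (a : T) (l : List (Option T)) : StepSpec G k a l [] [] :=
  ⟨by simp, by simp⟩

theorem StepSpec.cons_none {a : T} {l : List (Option T)} {P L : List (Entry G)}
    (h : StepSpec G k a l P L) {e : Entry G} (he : e.res = none) :
    StepSpec G k a l (e :: P) L := by
  refine ⟨h.1, fun p res => ?_⟩
  rw [h.2]
  simp [he]

/-- The reductions behind the shift contain no shift, so the last `shift a` of a sequence marks off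
the history of the copy. As the history of `e` is new, its continuations do not repeat earlier ones.
-/
theorem StepSpec.cons_some {a : T} {l : List (Option T)} {P L L' M : List (Entry G)}
    (h : StepSpec G k a l P L) {e : Entry G} {st : StateStack G} (he : e.res = some st)
    (hne : e.ops ∉ P.map Entry.ops) (hM : ListSpec M (TabRel G k l st 0 (.terminal a)))
    (hL : L'.Perm (M.map (Entry.prepend (e.ops ++ [.shift a])) ++ L)) :
    StepSpec G k a l (e :: P) L' := by
  have hshift : ∀ {st ρ res}, TabRel G k l st 0 (.terminal a) ρ res → LROp.shift a ∉ ρ := by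
    rintro st ρ res ⟨-, q, st', -, hr⟩
    exact hr.shift_notMem a
  constructor
  · rw [(hL.map _).nodup_iff, List.map_append, List.nodup_append']
    refine ⟨?_, h.1, ?_⟩
    · have : (M.map (Entry.prepend (e.ops ++ [.shift a]))).map Entry.ops =
          (M.map Entry.ops).map ((e.ops ++ [.shift a]) ++ ·) := by
        simp [Entry.prepend]
      rw [this]
      exact hM.1.map (List.append_right_injective _)
    · rw [List.disjoint_left]
      intro p hp hp'
      simp only [List.map_map, List.mem_map, Function.comp_apply] at hp
      obtain ⟨f, hf, rfl⟩ := hp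
      obtain ⟨g, hg, hgp⟩ := List.mem_map.1 hp'
      obtain ⟨e', he', st', ρ, hr, hp, htab⟩ := (h.2 _ _).1 ⟨g, hg, hgp, rfl⟩
      have h1 := hshift ((hM.2 f.ops f.res).2 ⟨f, hf, rfl, rfl⟩)
      have h2 := hshift htab
      simp only [Entry.prepend, List.append_assoc, List.singleton_append] at hp
      have := (append_cons_inj h1 h2 hp).1
      exact hne (this ▸ List.mem_map_of_mem he')
  · intro p res
    have h1 : (∃ f ∈ L', f.ops = p ∧ f.res = res) ↔
        (∃ f ∈ M, (f.prepend (e.ops ++ [.shift a])).ops = p ∧ f.res = res) ∨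
        ∃ f ∈ L, f.ops = p ∧ f.res = res := by
      simp only [hL.mem_iff, List.mem_append, List.mem_map, or_and_right, exists_or]
      refine or_congr_left ⟨?_, ?_⟩
      · rintro ⟨_, ⟨f, hf, rfl⟩, h1, h2⟩; exact ⟨f, hf, h1, h2⟩
      · rintro ⟨f, hf, h1, h2⟩; exact ⟨_, ⟨f, hf, rfl⟩, h1, h2⟩
    rw [h1, h.2]
    simp only [List.mem_cons, or_and_right, exists_or, exists_eq_left]
    refine or_congr_left ⟨?_, ?_⟩
    · rintro ⟨f, hf, rfl, rfl⟩
      exact ⟨st, f.ops, he, by simp [Entry.prepend], (hM.2 _ _).2 ⟨f, hf, rfl, rfl⟩⟩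
    · rintro ⟨st', ρ, h2, rfl, h3⟩
      rw [he] at h2
      cases h2
      obtain ⟨f, hf, rfl, rfl⟩ := (hM.2 _ _).1 h3
      exact ⟨f, hf, by simp [Entry.prepend], rfl⟩

theorem StepSpec.listSpec (hG : StartNormal G) {x : List T} {s : ℕ} (hs : s < x.length)
    {P L : List (Entry G)} (hP : ListSpec P (CopyAt G k x s))
    (h : StepSpec G k x[s] (lookahead k (x.drop (s + 1))) P L) :
    ListSpec L (CopyAt G k x (s + 1)) := by
  refine ⟨h.1, fun p res => ?_⟩
  rw [h.2, copyAt_succ hG hs]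
  constructor
  · rintro ⟨p₀, q, st, ρ, h1, rfl, h2⟩
    obtain ⟨e, he, rfl, he'⟩ := (hP.2 _ _).1 h1
    exact ⟨e, he, q :: st, ρ, he', rfl, productive_terminal _, q, st, rfl, h2⟩
  · rintro ⟨e, he, st, ρ, h1, rfl, -, q, st', h2, h3⟩
    rw [List.drop_zero] at h2
    subst h2
    exact ⟨e.ops, q, st', ρ, (hP.2 _ _).2 ⟨e, he, rfl, h1⟩, rfl, h3⟩

end Steps

section MainLoop

variable {T : Type} {G : ContextFreeGrammar T} {k : ℕ}

namespace Layout

/-! ### The treatment of one input symbol -/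

/-- The registers that are changed by `shiftEntries`. -/
abbrev shiftRegs : List ℕ := [regNew, regPtr, regEnt, regCode, regRope, regVal, regHp]

/-- Append a shift and the operations of an entry to the history of a copy. -/
def shiftEntry (Λ : Layout G k) (a : T) : Cmd :=
  .seq (.set regVal (Λ.opc (.shift a)))
    (.seq (alloc regRope [regHist, regVal, regRope]) (consEntry regNew))

/-- One rope node, with the history on the left, the shift as its value and the operations of the
entry on the right, joins the three parts in constant time. The subropes are shared and not copied.
-/
theorem shiftEntries_tri (Λ : Layout G k) (a : T) (t : ℕ) :
    ∃ N, ∀ (H : ℕ → StateStack G → Prop) (S : Set ℕ) (σ : Store) (p : List (LROp T G.NT))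
      (M L : List (Entry G)), HeapInv S σ → M.length ≤ t →
      HoldsWord S σ.mem (σ.reg regHist) (p.map Λ.opc) → Λ.ListAt H S σ.mem M (σ.reg regPtr) →
      Λ.ListAt H S σ.mem L (σ.reg regNew) →
      (forEntries regPtr (Λ.shiftEntry a)).Tri N σ fun τ =>
        ∃ S', HeapStep shiftRegs S σ S' τ ∧
          ∃ L', L'.Perm (M.map (Entry.prepend (p ++ [.shift a])) ++ L) ∧
            Λ.ListAt H S' τ.mem L' (τ.reg regNew) := by
  have hlf : (Λ.shiftEntry a).LoopFree := ⟨trivial, alloc_loopFree _ _, alloc_loopFree _ _⟩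
  refine ⟨t * ((loadEntry regPtr).size + (Λ.shiftEntry a).size + 1 + 1) + 1,
    fun H S σ p M L h1 h2 h3 h4 h5 => ?_⟩
  refine (forEntries_tri (Λ := Λ) (H := H) (S := S) (n := (Λ.shiftEntry a).size) (L := M)
    (fun R S' σ' => HeapStep shiftRegs S σ S' σ' ∧ ∃ L₁ : List (Entry G),
      (M.map (Entry.prepend (p ++ [.shift a])) ++ L).Perm
        (L₁ ++ R.map (Entry.prepend (p ++ [.shift a]))) ∧
        Λ.ListAt H S' σ'.mem L₁ (σ'.reg regNew)) (by simp) ?_ ?_ ?_ h4 ?_).mono ?_ ?_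
  · rintro R S' σ' ⟨h, -⟩; exact h.inv.zero
  · rintro R S' σ' τ ⟨h, L₁, hp₁, hL₁⟩ hm hr
    refine ⟨h.trans ((h.inv.step_regs _ hm hr (by simp) (by simp)).mono (by simp)), L₁,
      hp₁, ?_⟩
    rw [hm, hr _ (by simp)]; exact hL₁
  · rintro e R S' σ' ⟨h, L₁, hp₁, hL₁⟩ he
    refine hlf.tri ?_
    have h6 := h.inv.step_update regVal (Λ.opc (.shift a)) (by simp) (by simp)
    have hw := he.word
    obtain ⟨S₁, h7, h8⟩ := alloc_rope (dst := regRope) (l := regHist) (v := regVal)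
      (r := regRope) (wl := p.map Λ.opc) (wr := e.ops.map Λ.opc) h6.inv
      (by simpa [h.same regHist (by simp)] using h3.mono h.le) (by simpa using hw) (by simp)
      (by simp)
    set σ₁ : Store := ⟨Function.update σ'.reg regVal (Λ.opc (.shift a)), σ'.mem⟩ with hσ₁
    set σ₂ := (alloc regRope [regHist, regVal, regRope]).run σ₁ with hσ₂
    have h9 := (h6.mono (rs' := [regVal, regRope, regHp]) (by simp)).trans
      (h7.mono (by simp))
    obtain ⟨S₂, h10, h11⟩ := consEntry_run (Λ := Λ) (H := H) (dst := regNew)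
      (e := e.prepend (p ++ [.shift a])) (L := L₁) h9.inv (by simp) (by simp)
      ⟨by rw [h9.same _ (by simp)]; exact he.code_eq,
        by simpa [Entry.prepend, hσ₁] using h8, by rw [h9.same _ (by simp)]; exact he.base⟩
      (by rw [h9.same _ (by simp)]; exact hL₁.mono le_rfl h9.le)
    have h12 := (h9.mono (rs' := shiftRegs) (by simp)).trans (h10.mono (by simp))
    refine ⟨S₂, h12.le, ?_, h.trans h12, _, hp₁.trans ?_, h11⟩
    · exact (h10.same _ (by simp)).trans (h9.same _ (by simp))
    · simp
  · exact ⟨h1.step_refl _, L, List.perm_append_comm, h5⟩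
  · have := Nat.mul_le_mul_right ((loadEntry regPtr).size + (Λ.shiftEntry a).size + 1 + 1) h2
    omega
  · rintro τ ⟨S', h, L₁, hp₁, hL₁⟩
    simp only [List.map_nil, List.append_nil] at hp₁
    exact ⟨S', h, L₁, hp₁.symm, hL₁⟩

/-- The registers that are changed by `stepEntry`. -/
abbrev stepRegs : List ℕ := regSel :: regHist :: regNew :: pushRegs

/-- Continue a copy with pending states `v` after the terminal `a`. -/
noncomputable def stepPending (Λ : Layout G k) (a : T) (l : List (Option T)) (v : StateStack G) :
    Cmd :=
  .seq (.seq (.copy regHist regRope) (.copy regCell regEnt)) (.seq (Λ.pushAll v)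
    (.seq (.load regPtr regCell (Λ.pos (.terminal a, l) + 1))
      (forEntries regPtr (Λ.shiftEntry a))))

/-- Continue a copy after the terminal `a`. -/
noncomputable def stepEntry (Λ : Layout G k) (a : T) (l : List (Option T)) : Cmd :=
  switch regCode (fun v => Λ.code (some v)) (Λ.stepPending a l) Λ.pending

/-- The pending states of a copy exist only as a code until it shifts. Once they are pushed, the row
for `a` and `l` in the top cell lists exactly the continuations behind the shift. -/
theorem stepPending_tri (hG : StartNormal G) {t : ℕ} (hX : IsXLR G k t) (Λ : Layout G k) (a : T)
    {l : List (Option T)} (hl : l.length = k) (v : StateStack G) :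
    ∃ N, ∀ (H : ℕ → StateStack G → Prop) (S : Set ℕ) (σ : Store) (e : Entry G)
      (P L : List (Entry G)), HeapInv S σ → Λ.HeapOK H S σ.mem →
      Λ.EntryAt H S σ.mem e (σ.reg regEnt) (σ.reg regCode) (σ.reg regRope) →
      Λ.ListAt H S σ.mem L (σ.reg regNew) → StepSpec G k a l P L →
      e.ops ∉ P.map Entry.ops → (∀ st, e.res = some st → IsStack G k st) → e.virt = some v →
      (Λ.stepPending a l v).Tri N σ fun τ => ∃ S' H', HeapStep stepRegs S σ S' τ ∧ H ≤ H' ∧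
        Λ.HeapOK H' S' τ.mem ∧ ∃ L', Λ.ListAt H' S' τ.mem L' (τ.reg regNew) ∧
          StepSpec G k a l (e :: P) L' := by
  obtain ⟨N₁, hN₁⟩ := pushAll_tri hG hX Λ v
  obtain ⟨N₂, hN₂⟩ := shiftEntries_tri Λ a t
  set c : Cmd := .seq (.copy regHist regRope) (.copy regCell regEnt) with hc
  have hlf : c.LoopFree := ⟨trivial, trivial⟩
  refine ⟨c.size + (N₁ + (1 + N₂ + 1) + 1) + 1, fun H S σ e P L h1 h2 h3 h4 h5 h6 h7 h8 => ?_⟩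
  have hres : e.res = some (v ++ e.base) := by simp [Entry.res, h8]
  have hst := h7 _ hres
  have h0 : HeapStep [regHist, regCell] S σ S (c.run σ) :=
    h1.step_regs _ rfl (fun r hr => by
      simp only [List.mem_cons, List.not_mem_nil, or_false, not_or] at hr
      simp [hc, Cmd.run, hr]) (by simp) (by simp)
  refine hlf.tri_seq (Cmd.Tri.seq ((hN₁ H S (c.run σ) e.base h0.inv (h2.mono h0.le)
    (by simpa [hc, Cmd.run] using (h3.base v h8).1) (.inr hst)).mono le_rfl ?_))
  rintro τ ⟨S₁, H₁, h9, h10, h11, h12⟩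
  have hcell := h11 _ _ h12
  obtain ⟨h13, M, h14, h15⟩ := hcell.row (.terminal a, l) ((Λ.mem_keys _ _).2 hl)
  have h16 := h9.inv.step_update regPtr
    (τ.mem (τ.reg regCell + (Λ.pos (.terminal a, l) + 1))) (by simp) (by simp)
  have h17 := ((h0.mono (rs' := stepRegs) (by simp)).trans (h9.mono (by simp))).trans
    (h16.mono (by simp))
  refine Cmd.LoopFree.tri_seq (a := .load regPtr regCell (Λ.pos (.terminal a, l) + 1)) trivial
    ((hN₂ H₁ S₁ _ e.ops M L h16.inv (h15.length_le_of_tabRel hG hX hl (.inr hst)) ?_ ?_ ?_).mono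
      le_rfl ?_)
  · have : ((Cmd.load regPtr regCell (Λ.pos (.terminal a, l) + 1)).run τ).reg regHist =
        σ.reg regRope := by
      simp [Cmd.run, h9.same regHist (by simp), hc]
    have h := h3.word.mono h17.le
    rwa [← this] at h
  · simpa using h14
  · have : ((Cmd.load regPtr regCell (Λ.pos (.terminal a, l) + 1)).run τ).reg regNew =
        σ.reg regNew := by
      simp [Cmd.run, h9.same regNew (by simp), hc]
    have h := h4.mono h10 h17.le
    rwa [← this] at h
  · rintro υ ⟨S₂, h18, L', h19, h20⟩
    exact ⟨S₂, H₁, h17.trans (h18.mono (by simp)), h10,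
      (h11.mono h16.le).mono h18.le, L', h20, h5.cons_some hres h6 h15 h19⟩

/-- The code selects the pending states among finitely many possibilities. An accepted copy has code
`0`, matches no branch and is dropped, as it cannot shift. -/
theorem stepEntry_tri (hG : StartNormal G) {t : ℕ} (hX : IsXLR G k t) (Λ : Layout G k) (a : T)
    {l : List (Option T)} (hl : l.length = k) :
    ∃ N, ∀ (H : ℕ → StateStack G → Prop) (S : Set ℕ) (σ : Store) (e : Entry G)
      (P L : List (Entry G)), HeapInv S σ → Λ.HeapOK H S σ.mem →
      Λ.EntryAt H S σ.mem e (σ.reg regEnt) (σ.reg regCode) (σ.reg regRope) →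
      Λ.ListAt H S σ.mem L (σ.reg regNew) → StepSpec G k a l P L →
      e.ops ∉ P.map Entry.ops → (∀ st, e.res = some st → IsStack G k st) →
      (Λ.stepEntry a l).Tri N σ fun τ => ∃ S' H', HeapStep stepRegs S σ S' τ ∧ H ≤ H' ∧
        Λ.HeapOK H' S' τ.mem ∧ ∃ L', Λ.ListAt H' S' τ.mem L' (τ.reg regNew) ∧
          StepSpec G k a l (e :: P) L' := by
  obtain ⟨N, hN⟩ := exists_common_bound (P := fun v N =>
    ∀ (H : ℕ → StateStack G → Prop) (S : Set ℕ) (σ : Store) (e : Entry G)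
      (P L : List (Entry G)), HeapInv S σ → Λ.HeapOK H S σ.mem →
      Λ.EntryAt H S σ.mem e (σ.reg regEnt) (σ.reg regCode) (σ.reg regRope) →
      Λ.ListAt H S σ.mem L (σ.reg regNew) → StepSpec G k a l P L →
      e.ops ∉ P.map Entry.ops → (∀ st, e.res = some st → IsStack G k st) → e.virt = some v →
      (Λ.stepPending a l v).Tri N σ fun τ => ∃ S' H', HeapStep stepRegs S σ S' τ ∧ H ≤ H' ∧
        Λ.HeapOK H' S' τ.mem ∧ ∃ L', Λ.ListAt H' S' τ.mem L' (τ.reg regNew) ∧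
          StepSpec G k a l (e :: P) L') Λ.pending fun v _ => by
    obtain ⟨N, hN⟩ := stepPending_tri hG hX Λ a hl v
    exact ⟨N, fun n hn H S σ e P L h1 h2 h3 h4 h5 h6 h7 h8 =>
      (hN H S σ e P L h1 h2 h3 h4 h5 h6 h7 h8).mono hn fun _ h => h⟩
  refine ⟨Λ.pending.length * 3 + N + 1, fun H S σ e P L h1 h2 h3 h4 h5 h6 h7 =>
    switch_tri (by simp) ?_ ?_⟩
  · intro v hv hcode w
    have hstep := h1.step_update regSel w (by simp) (by simp)
    have hvirt : e.virt = some v := Λ.code_inj (fun v' h => (h3.base v' h).2)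
      (h3.code_eq.symm.trans hcode.symm)
    refine (hN v hv H S _ e P L hstep.inv (h2.mono hstep.le) (by simpa using h3)
      (by simpa using h4) h5 h6 h7 hvirt).mono le_rfl ?_
    rintro τ ⟨S', H', h8, h9⟩
    exact ⟨S', H', (hstep.mono (by simp)).trans h8, h9⟩
  · intro hn w
    have hstep := h1.step_update regSel w (by simp) (by simp)
    have hres : e.res = none := by
      cases hv : e.virt with
      | none => simp [Entry.res, hv]
      | some v => exact absurd (by rw [h3.code_eq, hv]) (hn v (h3.base v hv).2)
    exact ⟨S, H, hstep.mono (by simp), le_rfl, h2.mono hstep.le, L, by simpa using h4,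
      h5.cons_none hres⟩

/-- The registers that are changed by `stepList`. -/
abbrev loopRegs : List ℕ := regTmp :: regInput :: regCur :: stepRegs

/-- Read the terminal `a`, with lookahead `l` after it. -/
noncomputable def stepList (Λ : Layout G k) (a : T) (l : List (Option T)) : Cmd :=
  .seq (.set regNew 0) (.seq (forEntries regCur (Λ.stepEntry a l))
    (.seq (.inc regInput) (.seq (.copy regCur regNew) (.load regTmp regInput 0))))

/-- At most `t` copies are processed, each in bounded time; so one input symbol costs a constant. -/
theorem stepList_tri (hG : StartNormal G) {t : ℕ} (hX : IsXLR G k t) (Λ : Layout G k) (a : T)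
    {l : List (Option T)} (hl : l.length = k) :
    ∃ N, ∀ (H : ℕ → StateStack G → Prop) (S : Set ℕ) (σ : Store) (L : List (Entry G))
      (x : List T) (s : ℕ) (hs : s < x.length), x[s] = a → lookahead k (x.drop (s + 1)) = l →
      HeapInv S σ → Λ.HeapOK H S σ.mem → Λ.ListAt H S σ.mem L (σ.reg regCur) →
      ListSpec L (CopyAt G k x s) →
      (Λ.stepList a l).Tri N σ fun τ => ∃ S' H', HeapStep loopRegs S σ S' τ ∧
        Λ.HeapOK H' S' τ.mem ∧ (∃ L', Λ.ListAt H' S' τ.mem L' (τ.reg regCur) ∧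
          ListSpec L' (CopyAt G k x (s + 1))) ∧ τ.reg regInput = σ.reg regInput + 1 ∧
          τ.reg regTmp = τ.mem (τ.reg regInput) := by
  obtain ⟨N, hN⟩ := stepEntry_tri hG hX Λ a hl
  set c : Cmd := .seq (.inc regInput) (.seq (.copy regCur regNew) (.load regTmp regInput 0)) with hc
  have hlf : c.LoopFree := ⟨trivial, trivial, trivial⟩
  refine ⟨1 + (t * ((loadEntry regCur).size + N + 1 + 1) + 1 + c.size + 1) + 1,
    fun H S σ L x s hs hxa hxl h1 h2 h3 h4 => ?_⟩
  have h0 := (h1.step_update regNew 0 (by simp) (by simp)).mono (rs' := regCur :: stepRegs)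
    (by simp)
  refine Cmd.LoopFree.tri_seq (a := .set regNew 0) trivial (Cmd.Tri.seq ?_)
  refine (forEntries_tri (Λ := Λ) (H := H) (S := S) (n := N) (L := L)
    (fun R S' σ' => HeapStep (regCur :: stepRegs) S σ S' σ' ∧ ∃ H', H ≤ H' ∧
      Λ.HeapOK H' S' σ'.mem ∧ ∃ P L', (P ++ R).Perm L ∧ Λ.ListAt H' S' σ'.mem L' (σ'.reg regNew) ∧
        StepSpec G k a l P L') (by simp) ?_ ?_ ?_ (by simpa [Cmd.run] using h3) ?_).mono ?_ ?_
  · rintro R S' σ' ⟨h, -⟩; exact h.inv.zero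
  · rintro R S' σ' τ ⟨h, H', hH, hok, P, L', hp, hL', hspec⟩ hm hr
    refine ⟨h.trans ((h.inv.step_regs _ hm hr (by simp) (by simp)).mono (by simp)), H', hH,
      by rw [hm]; exact hok, P, L', hp, ?_, hspec⟩
    rw [hm, hr _ (by simp)]; exact hL'
  · rintro e R S' σ' ⟨h, H', hH, hok, P, L', hp, hL', hspec⟩ he
    have hmem : e ∈ L := hp.subset (by simp)
    refine (hN H' S' σ' e P L' h.inv hok (he.mono hH (.refl _ _)) hL' hspec ?_ ?_).mono le_rfl ?_
    · have := ((hp.map Entry.ops).nodup_iff).2 h4.1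
      rw [List.map_append, List.nodup_append'] at this
      exact fun h => (List.disjoint_left.1 this.2.2) h (by simp)
    · intro st hst
      exact ((h4.2 e.ops (some st)).2 ⟨e, hmem, rfl, hst⟩).isStack hG
    · rintro τ ⟨S'', H'', h5, h6, h7, L'', h8, h9⟩
      refine ⟨S'', h5.le, h5.same _ (by simp), h.trans (h5.mono (by simp)), H'',
        hH.trans h6, h7, e :: P, L'', ?_, h8, h9⟩
      exact (List.perm_middle.symm).trans hp
  · exact ⟨h0, H, le_rfl, h2, [], [], .refl _, by simp [Cmd.run, ListAt], .nil _ _⟩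
  · have := Nat.mul_le_mul_right ((loadEntry regCur).size + N + 1 + 1)
      (h4.length_le_of_copyAt hG hX)
    omega
  · rintro τ ⟨S', h, H', hH, hok, P, L', hp, hL', hspec⟩
    refine hlf.tri ?_
    have h5 : HeapStep [regInput, regCur, regTmp] S' τ S' (c.run τ) :=
      h.inv.step_regs _ rfl (fun r hr => by
        simp only [List.mem_cons, List.not_mem_nil, or_false, not_or] at hr
        simp [hc, Cmd.run, hr]) (by simp) (by simp)
    refine ⟨S', H', (h.mono (by simp)).trans (h5.mono (by simp)), hok.mono h5.le,
      ⟨L', by simpa [hc, Cmd.run] using hL', ?_⟩, ?_, ?_⟩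
    · subst hxa hxl
      rw [List.append_nil] at hp
      refine StepSpec.listSpec hG hs ⟨((hp.map _).nodup_iff).2 h4.1, fun ρ res => ?_⟩ hspec
      rw [h4.2]; simp only [hp.mem_iff]
    · simp [hc, Cmd.run, h.same regInput (by simp)]
    · simp [hc, Cmd.run]

end Layout

/-! ### The main loop -/

theorem lookahead_getElem (y : List T) (i : ℕ) (hi : i < (lookahead k y).length) :
    (lookahead k y)[i] = y[i]? := by
  have hk : i < k := by rwa [lookahead_length] at hi
  simp only [lookahead, List.getElem_take]
  by_cases h : i < y.length
  · rw [List.getElem_append_left (by simpa using h)]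
    simp [h]
  · rw [List.getElem_append_right (by simpa using h)]
    simp only [List.getElem_replicate]
    rw [List.getElem?_eq_none (by omega)]

/-- The contents of the memory cell for a symbol of the input, or for the end marker. -/
def symCode (encT : T → ℕ) (o : Option T) : ℕ := (o.map (encT · + 1)).getD 0

theorem symCode_injective {encT : T → ℕ} (h : Function.Injective encT) :
    Function.Injective (symCode encT) := by
  rintro (_ | a) (_ | b) hab
  · rfl
  · simp [symCode] at hab
  · simp [symCode] at hab
  · simp only [symCode, Option.map_some, Option.getD_some, Nat.add_right_cancel_iff] at hab
    rw [h hab]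

/-- The input and `k` end markers stand at the beginning of the memory. -/
def InputAt (encT : T → ℕ) (k : ℕ) (x : List T) (S : Set ℕ) (m : ℕ → ℕ) : Prop :=
  ∀ i ≤ x.length + k, i ∈ S ∧ m i = symCode encT x[i]?

theorem InputAt.mono {encT : T → ℕ} {x : List T} {S S' : Set ℕ} {m m' : ℕ → ℕ}
    (h : InputAt encT k x S m) (hS : HeapLE S m S' m') : InputAt encT k x S' m' := fun i hi =>
  ⟨hS.subset (h i hi).1, by rw [hS.agree _ (h i hi).1, (h i hi).2]⟩

namespace Layout

/-- Read all input symbols. -/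
noncomputable def readInput (Λ : Layout G k) (encT : T → ℕ) (opts : List (Option T)) : Cmd :=
  .loop regTmp regZero (withWindow opts (symCode encT) (k + 1) 0 [] fun w =>
    match w with
    | some a :: l => Λ.stepList a l
    | _ => .skip)

/-- The time of a round is bounded by a maximum over the finitely many pairs of a terminal and a
lookahead. The loop ends at the first zero, the code of the end marker. -/
theorem readInput_tri (hG : StartNormal G) {t : ℕ} (hX : IsXLR G k t) (Λ : Layout G k)
    {encT : T → ℕ} (henc : Function.Injective encT) {opts : List (Option T)}
    (hopts : ∀ a, a ∈ opts) :
    ∃ N, ∀ (H : ℕ → StateStack G → Prop) (S : Set ℕ) (σ : Store) (L : List (Entry G))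
      (x : List T), HeapInv S σ → Λ.HeapOK H S σ.mem → InputAt encT k x S σ.mem →
      Λ.ListAt H S σ.mem L (σ.reg regCur) → ListSpec L (CopyAt G k x 0) →
      σ.reg regInput = 0 → σ.reg regTmp = σ.mem 0 →
      (Λ.readInput encT opts).Tri (N * (x.length + 1)) σ fun τ => ∃ S' H',
        HeapStep loopRegs S σ S' τ ∧ Λ.HeapOK H' S' τ.mem ∧
        ∃ L', Λ.ListAt H' S' τ.mem L' (τ.reg regCur) ∧ ListSpec L' (CopyAt G k x x.length) := by
  obtain ⟨N, hN⟩ := exists_common_bound (P := fun (κ : Symbol T G.NT × List (Option T)) N =>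
    ∀ a, κ.1 = .terminal a → ∀ (H : ℕ → StateStack G → Prop) (S : Set ℕ) (σ : Store)
      (L : List (Entry G)) (x : List T) (s : ℕ) (hs : s < x.length), x[s] = a →
      lookahead k (x.drop (s + 1)) = κ.2 →
      HeapInv S σ → Λ.HeapOK H S σ.mem → Λ.ListAt H S σ.mem L (σ.reg regCur) →
      ListSpec L (CopyAt G k x s) →
      (Λ.stepList a κ.2).Tri N σ fun τ => ∃ S' H', HeapStep loopRegs S σ S' τ ∧
        Λ.HeapOK H' S' τ.mem ∧ (∃ L', Λ.ListAt H' S' τ.mem L' (τ.reg regCur) ∧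
          ListSpec L' (CopyAt G k x (s + 1))) ∧ τ.reg regInput = σ.reg regInput + 1 ∧
          τ.reg regTmp = τ.mem (τ.reg regInput)) Λ.keys fun κ hκ => by
    rcases hκ1 : κ.1 with a | X
    · obtain ⟨N, hN⟩ := stepList_tri hG hX Λ a ((Λ.mem_keys κ.1 κ.2).1 hκ)
      refine ⟨N, fun n hn b hb H S σ L x s hs h1 h2 h3 h4 h5 h6 => ?_⟩
      cases hb
      exact (hN H S σ L x s hs h1 h2 h3 h4 h5 h6).mono hn fun _ h => h
    · exact ⟨0, fun n _ b hb => by cases hb⟩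
  set n₁ := (k + 1) * (opts.length * 3 + 3) + N with hn₁
  refine ⟨n₁ + 1, fun H S σ L x h1 h2 h3 h4 h5 h6 h7 => ?_⟩
  refine (Cmd.Tri.loop_list (n := n₁) (fun (y : List T) σ' => ∃ s S' H' L', y = x.drop s ∧
    s ≤ x.length ∧ HeapStep loopRegs S σ S' σ' ∧ Λ.HeapOK H' S' σ'.mem ∧
    Λ.ListAt H' S' σ'.mem L' (σ'.reg regCur) ∧ ListSpec L' (CopyAt G k x s) ∧
    σ'.reg regInput = s ∧ σ'.reg regTmp = σ'.mem s) ?_ ?_ x σ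
    ⟨0, S, H, L, by simp, by simp, h1.step_refl _, h2, h4, h5, h6, h7⟩).mono ?_ ?_
  · rintro σ' ⟨s, S', H', L', hy, hs, h8, -, -, -, -, h9⟩
    have hsl : s = x.length := by
      have := List.drop_eq_nil_iff.1 hy.symm
      omega
    rw [h9, h8.inv.zero, ((h3.mono h8.le) s (by omega)).2, hsl]
    simp [symCode]
  · rintro b y σ' ⟨s, S', H', L', hy, hs, h8, h9, h10, h11, h12, h13⟩
    have hlt : s < x.length := by
      by_contra h
      rw [List.drop_of_length_le (by omega)] at hy
      cases hy
    rw [List.drop_eq_getElem_cons hlt] at hy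
    obtain ⟨rfl, rfl⟩ := List.cons_eq_cons.1 hy
    have hin := h3.mono h8.le
    refine ⟨?_, ?_⟩
    · rw [h13, h8.inv.zero, (hin s (by omega)).2]
      simp [symCode, hlt]
    have hl := lookahead_length k (x.drop (s + 1))
    have hwin := withWindow_tri hopts (symCode_injective henc) (N := N)
      (body := fun w => match w with
        | some a :: l => Λ.stepList a l
        | _ => .skip)
      (Q := fun τ => ∃ S'' H'', HeapStep loopRegs S σ S'' τ ∧
        Λ.HeapOK H'' S'' τ.mem ∧ (∃ L', Λ.ListAt H'' S'' τ.mem L' (τ.reg regCur) ∧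
          ListSpec L' (CopyAt G k x (s + 1))) ∧ τ.reg regInput = s + 1 ∧
          τ.reg regTmp = τ.mem (τ.reg regInput))
      (some x[s] :: lookahead k (x.drop (s + 1))) 0 [] σ' ?_ ?_
    · rw [List.length_cons, hl] at hwin
      refine hwin.mono le_rfl ?_
      rintro τ ⟨S'', H'', h14, h15, ⟨L'', h16, h17⟩, h18, h19⟩
      exact ⟨s + 1, S'', H'', L'', rfl, hlt, h14, h15, h16, h17, h18, by rw [h19, h18]⟩
    · intro i hi
      rw [h12, Nat.zero_add]
      have hi' : i < k + 1 := by simpa [hl] using hi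
      rw [(hin (s + i) (by omega)).2]
      cases i with
      | zero => simp [hlt]
      | succ i =>
        rw [List.getElem_cons_succ, lookahead_getElem, List.getElem?_drop]
        congr 2
        omega
    · intro τ hm hr
      have hstep := h8.inv.step_regs [regTmp, regSel] hm hr (by simp) (by simp)
      refine (hN (.terminal x[s], lookahead k (x.drop (s + 1))) ((Λ.mem_keys _ _).2 hl) x[s] rfl
        H' S' τ L' x s hlt rfl rfl hstep.inv (h9.mono hstep.le)
        (by rw [hm, hr _ (by simp)]; exact h10) h11).mono le_rfl ?_
      rintro υ ⟨S'', H'', h14, h15, h16, h17, h18⟩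
      exact ⟨S'', H'', (h8.trans (hstep.mono (by simp))).trans h14, h15, h16,
        by rw [h17, hr _ (by simp), h12], h18⟩
  · rw [Nat.mul_comm, Nat.mul_add]
    omega
  · rintro τ ⟨s, S', H', L', hy, hs, h8, h9, h10, h11, -, -⟩
    have hsl : s = x.length := by
      have := List.drop_eq_nil_iff.1 hy.symm
      omega
    exact ⟨S', H', h8, h9, L', h10, hsl ▸ h11⟩

end Layout

end MainLoop

section Output

/-! ### Output of words -/

/-- The word `w` is stored as a linked list at the address `p`. -/
def WordAt (S : Set ℕ) (m : ℕ → ℕ) : List ℕ → ℕ → Prop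
  | [], p => p = 0
  | v :: w, p => 0 < p ∧ p ∈ S ∧ p + 1 ∈ S ∧ m p = v ∧ WordAt S m w (m (p + 1))

theorem WordAt.mono {S S' : Set ℕ} {m m' : ℕ → ℕ} (h : HeapLE S m S' m') :
    ∀ {w : List ℕ} {p : ℕ}, WordAt S m w p → WordAt S' m' w p
  | [], _, hp => hp
  | _ :: _, _, ⟨h0, h1, h2, h3, h4⟩ =>
    ⟨h0, h.subset h1, h.subset h2, by rw [h.agree _ h1, h3],
      by rw [h.agree _ h2]; exact h4.mono h⟩

/-- The number of nodes. -/
def Rope.size : Rope → ℕ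
  | .nil => 0
  | .node l _ r => l.size + r.size + 1

/-- The number of nodes on the leftmost branch. -/
def Rope.spine : Rope → ℕ
  | .nil => 0
  | .node l _ _ => l.spine + 1

theorem Rope.spine_le_size (t : Rope) : t.spine ≤ t.size := by
  induction t with
  | nil => exact le_rfl
  | node l v r ih _ => simp only [Rope.spine, Rope.size]; omega

theorem Rope.size_eq (t : Rope) : t.size = t.word.length := by
  induction t with
  | nil => rfl
  | node l v r ihl ihr => simp [Rope.size, Rope.word, ihl, ihr]; omega

/-- Move the last element of the rope at `regRoot`, whose right subtree is empty, to the front of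
the list at `regOut`. -/
def popRight : Cmd :=
  .seq (.load regVal regRoot 1) (.seq (alloc regOut [regVal, regOut]) (.load regRoot regRoot 0))

/-- Rotate the rope at `regRoot`, whose right subtree is at `regTmp`, to the left. -/
def rotateLeft : Cmd :=
  .seq (.seq (.load regEnt regRoot 0) (.seq (.load regVal regRoot 1) (.load regCode regTmp 0)))
    (.seq (alloc regEnt [regEnt, regVal, regCode])
      (.seq (.seq (.load regVal regTmp 1) (.load regCode regTmp 2))
        (alloc regRoot [regEnt, regVal, regCode])))

/-- Move the elements of the rope at `regRoot` to the list at `regOut`. -/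
def flatten : Cmd :=
  .loop regRoot regZero (.seq (.load regTmp regRoot 2) (.ite regTmp regZero popRight rotateLeft))

/-- The registers that are changed by `flatten`. -/
abbrev flattenRegs : List ℕ := [regRoot, regTmp, regVal, regOut, regEnt, regCode, regHp]

theorem popRight_run {S : Set ℕ} {σ : Store} (h : HeapInv S σ) {l : Rope} {v : ℕ} {w : List ℕ}
    (hr : RopeAt S σ.mem (.node l v .nil) (σ.reg regRoot)) (hw : WordAt S σ.mem w (σ.reg regOut)) :
    ∃ S', HeapStep flattenRegs S σ S' (popRight.run σ) ∧
      RopeAt S' (popRight.run σ).mem l ((popRight.run σ).reg regRoot) ∧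
      WordAt S' (popRight.run σ).mem (v :: w) ((popRight.run σ).reg regOut) := by
  obtain ⟨h0, h1, h2, h3, h4, h5, -⟩ := hr
  have h6 := h.step_update regVal (σ.mem (σ.reg regRoot + 1)) (by simp) (by simp)
  set σ₁ : Store := ⟨Function.update σ.reg regVal (σ.mem (σ.reg regRoot + 1)), σ.mem⟩ with hσ₁
  obtain ⟨h7, h8, h9⟩ := alloc_run (dst := regOut) (rs := [regVal, regOut]) h6.inv (by simp)
    (by simp)
  have e0 := h9 0 (by simp)
  have e1 := h9 1 (by simp)
  set σ₂ := (alloc regOut [regVal, regOut]).run σ₁ with hσ₂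
  set S' := S ∪ Set.Ico (σ₁.reg regHp) (σ₁.reg regHp + [regVal, regOut].length) with hS'
  have hroot : σ₂.reg regRoot = σ.reg regRoot := by
    rw [h7.same _ (by simp)]; simp [hσ₁]
  have h10 := h7.inv.step_update regRoot (σ₂.mem (σ₂.reg regRoot + 0)) (by simp) (by simp)
  have hrun : popRight.run σ = ⟨Function.update σ₂.reg regRoot (σ₂.mem (σ₂.reg regRoot + 0)),
    σ₂.mem⟩ := rfl
  rw [hrun]
  refine ⟨S', ((h6.mono (by simp)).trans (h7.mono (by simp))).trans (h10.mono (by simp)), ?_, ?_⟩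
  · simp only [Function.update_self, Nat.add_zero, hroot]
    rw [h7.le.agree _ h1]
    exact h5.mono h7.le
  · simp only [Nat.add_zero, List.getElem_cons_zero, List.getElem_cons_succ] at e0 e1
    have hout : (Function.update σ₂.reg regRoot (σ₂.mem (σ₂.reg regRoot + 0))) regOut =
        σ₁.reg regHp := by
      simp [h8]
    simp only [hout]
    refine ⟨h6.inv.pos, .inr (by simp), .inr (by simp), ?_, ?_⟩
    · rw [e0]; simp [hσ₁, h4]
    · rw [e1]
      have : σ₁.reg regOut = σ.reg regOut := by simp [hσ₁]
      rw [this]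
      exact hw.mono h7.le

/-- The rotation allocates two new nodes and leaves the old ones intact, since other ropes may share
them. -/
theorem rotateLeft_run {S : Set ℕ} {σ : Store} (h : HeapInv S σ) {l rl rr : Rope} {v rv : ℕ}
    {w : List ℕ} (hr : RopeAt S σ.mem (.node l v (.node rl rv rr)) (σ.reg regRoot))
    (ht : σ.reg regTmp = σ.mem (σ.reg regRoot + 2)) (hw : WordAt S σ.mem w (σ.reg regOut)) :
    ∃ S', HeapStep flattenRegs S σ S' (rotateLeft.run σ) ∧
      RopeAt S' (rotateLeft.run σ).mem (.node (.node l v rl) rv rr)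
        ((rotateLeft.run σ).reg regRoot) ∧
      WordAt S' (rotateLeft.run σ).mem w ((rotateLeft.run σ).reg regOut) := by
  obtain ⟨-, -, -, -, h4, h5, h6⟩ := hr
  rw [← ht] at h6
  obtain ⟨-, h7, h8, h9, h10, h11, h12⟩ := h6
  set σ₁ := (Cmd.seq (.load regEnt regRoot 0) (.seq (.load regVal regRoot 1)
    (.load regCode regTmp 0))).run σ with hσ₁
  have s1 : HeapStep [regEnt, regVal, regCode] S σ S σ₁ :=
    h.step_regs _ rfl (fun r hr => by
      simp only [List.mem_cons, List.not_mem_nil, or_false, not_or] at hr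
      simp [hσ₁, Cmd.run, hr]) (by simp) (by simp)
  have hmem₁ : σ₁.mem = σ.mem := rfl
  obtain ⟨S₂, s2, r2⟩ := alloc_ropeAt (dst := regEnt) (l := regEnt) (v := regVal)
    (r := regCode) (tl := l) (tr := rl) s1.inv (by simpa [hσ₁, Cmd.run] using h5)
    (by simpa [hσ₁, Cmd.run] using h11) (by simp) (by simp)
  have hv : σ₁.reg regVal = v := by simp [hσ₁, Cmd.run, h4]
  rw [hv] at r2
  set σ₂ := (alloc regEnt [regEnt, regVal, regCode]).run σ₁ with hσ₂
  set σ₃ := (Cmd.seq (.load regVal regTmp 1) (.load regCode regTmp 2)).run σ₂ with hσ₃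
  have s3 : HeapStep [regVal, regCode] S₂ σ₂ S₂ σ₃ :=
    s2.inv.step_regs _ rfl (fun r hr => by
      simp only [List.mem_cons, List.not_mem_nil, or_false, not_or] at hr
      simp [hσ₃, Cmd.run, hr]) (by simp) (by simp)
  have htmp : σ₂.reg regTmp = σ.reg regTmp := by
    rw [s2.same _ (by simp), s1.same _ (by simp)]
  have s12 := (s1.mono (rs' := flattenRegs) (by simp)).trans (s2.mono (by simp))
  obtain ⟨S₄, s4, r4⟩ := alloc_ropeAt (dst := regRoot) (l := regEnt) (v := regVal)
    (r := regCode) (tl := .node l v rl) (tr := rr) s3.inv (by simpa [hσ₃, Cmd.run] using r2)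
    (by
      have := h12.mono s12.le
      simp only [hσ₃, Cmd.run, Function.update_self]
      rw [Function.update_of_ne (by simp), htmp, s12.le.agree _ h9]
      exact this) (by simp) (by simp)
  have hv' : σ₃.reg regVal = rv := by
    simp only [hσ₃, Cmd.run]
    rw [Function.update_of_ne (by simp), Function.update_self, htmp, s12.le.agree _ h8, h10]
  rw [hv'] at r4
  have s := (s12.trans (s3.mono (by simp))).trans (s4.mono (by simp))
  refine ⟨S₄, s, r4, ?_⟩
  have : (rotateLeft.run σ).reg regOut = σ.reg regOut := by
    refine (s4.same _ (by simp)).trans ?_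
    rw [s3.same _ (by simp), s2.same _ (by simp), s1.same _ (by simp)]
  rw [this]
  exact hw.mono s.le

/-- The potential `2 * t.size - t.spine` drops by one in every round: `popRight` lowers both size
and spine by one, `rotateLeft` keeps the size and lengthens the spine by one. Hence the time is
linear in the number of nodes, whatever the shape of the rope. -/
theorem flatten_tri : ∃ N, ∀ (n : ℕ) (S : Set ℕ) (σ : Store) (t : Rope) (w : List ℕ),
    2 * t.size ≤ n + t.spine → HeapInv S σ → RopeAt S σ.mem t (σ.reg regRoot) →
    WordAt S σ.mem w (σ.reg regOut) →
    flatten.Tri (n * N + 1) σ fun τ => ∃ S', HeapStep flattenRegs S σ S' τ ∧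
      WordAt S' τ.mem (t.word ++ w) (τ.reg regOut) := by
  have hlf : popRight.LoopFree ∧ rotateLeft.LoopFree :=
    ⟨⟨trivial, alloc_loopFree _ _, trivial⟩, ⟨trivial, trivial, trivial⟩, alloc_loopFree _ _,
      ⟨trivial, trivial⟩, alloc_loopFree _ _⟩
  set b : Cmd := .seq (.load regTmp regRoot 2) (.ite regTmp regZero popRight rotateLeft) with hb
  have hblf : b.LoopFree := ⟨trivial, hlf⟩
  refine ⟨b.size + 1, fun n => ?_⟩
  induction n with
  | zero =>
    intro S σ t w hn h hr hw
    cases t with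
    | nil =>
      exact (Cmd.Tri.loop_done (by rw [h.zero]; exact hr) ⟨S, h.step_refl _, hw⟩).mono (by simp)
        fun _ h => h
    | node l v r =>
      have := Rope.spine_le_size (.node l v r)
      simp only [Rope.size] at *
      omega
  | succ n ih =>
    intro S σ t w hn h hr hw
    cases t with
    | nil =>
      exact (Cmd.Tri.loop_done (by rw [h.zero]; exact hr) ⟨S, h.step_refl _, hw⟩).mono (by simp)
        fun _ h => h
    | node l v r =>
      have hpos : σ.reg regRoot ≠ σ.reg regZero := by
        rw [h.zero]; exact hr.1.ne'
      set σ₁ := (Cmd.load regTmp regRoot 2).run σ with hσ₁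
      have s1 : HeapStep [regTmp] S σ S σ₁ := h.step_update _ _ (by simp) (by simp)
      have hr₁ : RopeAt S σ₁.mem (.node l v r) (σ₁.reg regRoot) := by
        simpa [hσ₁, Cmd.run] using hr
      have hw₁ : WordAt S σ₁.mem w (σ₁.reg regOut) := by
        simpa [hσ₁, Cmd.run] using hw
      have ht : σ₁.reg regTmp = σ₁.mem (σ₁.reg regRoot + 2) := by
        simp [hσ₁, Cmd.run]
      have key : ∃ S₂ t₂ w₂, HeapStep flattenRegs S σ S₂ (b.run σ) ∧
          RopeAt S₂ (b.run σ).mem t₂ ((b.run σ).reg regRoot) ∧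
          WordAt S₂ (b.run σ).mem w₂ ((b.run σ).reg regOut) ∧
          t₂.word ++ w₂ = (Rope.node l v r).word ++ w ∧ 2 * t₂.size ≤ n + t₂.spine := by
        have hrun : b.run σ = if σ₁.reg regTmp = σ₁.reg regZero then popRight.run σ₁
          else rotateLeft.run σ₁ := rfl
        cases r with
        | nil =>
          have hz : σ₁.reg regTmp = σ₁.reg regZero := by
            rw [ht, s1.inv.zero]; exact hr₁.2.2.2.2.2.2
          rw [hrun, if_pos hz]
          obtain ⟨S₂, s2, h2, h3⟩ := popRight_run s1.inv hr₁ hw₁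
          refine ⟨S₂, l, v :: w, (s1.mono (by simp)).trans s2, h2, h3, by simp [Rope.word], ?_⟩
          simp only [Rope.size, Rope.spine] at hn
          omega
        | node rl rv rr =>
          have hz : σ₁.reg regTmp ≠ σ₁.reg regZero := by
            rw [ht, s1.inv.zero]; exact hr₁.2.2.2.2.2.2.1.ne'
          rw [hrun, if_neg hz]
          obtain ⟨S₂, s2, h2, h3⟩ := rotateLeft_run s1.inv hr₁ ht hw₁
          refine ⟨S₂, _, w, (s1.mono (by simp)).trans s2, h2, h3, by simp [Rope.word], ?_⟩
          simp only [Rope.size, Rope.spine] at hn ⊢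
          omega
      obtain ⟨S₂, t₂, w₂, s2, h2, h3, hword, hn₂⟩ := key
      refine (Cmd.Tri.loop_step hpos (hblf.tri (((ih S₂ _ t₂ w₂ hn₂ s2.inv h2 h3).mono le_rfl
        ?_)))).mono ?_ fun _ h => h
      · rintro τ ⟨S', s3, h4⟩
        exact ⟨S', s2.trans s3, hword ▸ h4⟩
      · rw [Nat.add_mul]; omega

/-- Copy the list at `regOut` to consecutive cells, beginning with the one whose address is put
into `regAddr`. -/
def emitWord : Cmd :=
  .seq (.copy regAddr regHp) (.loop regOut regZero
    (.seq (.seq (.load regVal regOut 0) (.load regOut regOut 1)) (alloc regTmp [regVal])))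

/-- Nothing else is allocated during the loop, so its one-cell allocations are adjacent and begin at
the old heap pointer. -/
theorem emitWord_tri : ∃ N, ∀ (S : Set ℕ) (σ : Store) (w : List ℕ), HeapInv S σ →
    WordAt S σ.mem w (σ.reg regOut) →
    emitWord.Tri (N * (w.length + 1)) σ fun τ => τ.reg regCount = σ.reg regCount ∧
      ∀ i (hi : i < w.length), τ.mem (τ.reg regAddr + i) = w[i] := by
  set c : Cmd := .seq (.load regVal regOut 0) (.load regOut regOut 1) with hc
  set b : Cmd := .seq c (alloc regTmp [regVal]) with hb
  have hlf : b.LoopFree := ⟨⟨trivial, trivial⟩, alloc_loopFree _ _⟩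
  refine ⟨b.size + 3, fun S σ w h hw => ?_⟩
  set A := σ.reg regHp with hA
  have s0 := h.step_update regAddr A (by simp) (by simp)
  refine (Cmd.LoopFree.tri_seq (a := .copy regAddr regHp) trivial (Cmd.Tri.loop_list
    (n := b.size) (fun (w' : List ℕ) σ' => ∃ S' done, HeapInv S' σ' ∧ done ++ w' = w ∧
      WordAt S' σ'.mem w' (σ'.reg regOut) ∧ σ'.reg regHp = A + done.length ∧
      σ'.reg regAddr = A ∧ σ'.reg regCount = σ.reg regCount ∧
      ∀ i (hi : i < done.length), A + i ∈ S' ∧ σ'.mem (A + i) = done[i]) ?_ ?_ w _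
      ⟨S, [], s0.inv, rfl, ?_, ?_, ?_, ?_, ?_⟩)).mono ?_ ?_
  · rintro σ' ⟨S', done, h1, -, h2, -⟩
    rw [h1.zero]; exact h2
  · rintro v w' σ' ⟨S', done, h1, hdone, ⟨h2, h3, h4, h5, h6⟩, h7, h8, h9, h10⟩
    refine ⟨by rw [h1.zero]; exact h2.ne', hlf.tri ?_⟩
    have s1 : HeapStep [regVal, regOut] S' σ' S' (c.run σ') :=
      h1.step_regs _ rfl (fun r hr => by
        simp only [List.mem_cons, List.not_mem_nil, or_false, not_or] at hr
        simp [hc, Cmd.run, hr]) (by simp) (by simp)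
    obtain ⟨s2, h11, h12⟩ := alloc_run (dst := regTmp) (rs := [regVal]) s1.inv (by simp)
      (by simp)
    have e0 := h12 0 (by simp)
    simp only [Nat.add_zero, List.getElem_cons_zero] at e0
    have hhp : (c.run σ').reg regHp = A + done.length := by
      rw [s1.same _ (by simp), h7]
    have hval : (c.run σ').reg regVal = v := by simp [hc, Cmd.run, h5]
    have hout : (c.run σ').reg regOut = σ'.mem (σ'.reg regOut + 1) := by simp [hc, Cmd.run]
    rw [hhp, hval] at e0
    have hrun : b.run σ' = (alloc regTmp [regVal]).run (c.run σ') := rfl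
    rw [hrun]
    refine ⟨_, done ++ [v], s2.inv, by simp [hdone], ?_, ?_, ?_, ?_, ?_⟩
    · rw [s2.same _ (by simp), hout]
      exact h6.mono (s1.le.trans s2.le)
    · simp only [alloc, Cmd.run, incBy_run, (alloc.storeAll_run _ _ _).1]
      simp [hhp, Nat.add_assoc]
    · rw [s2.same _ (by simp), s1.same _ (by simp), h8]
    · rw [s2.same _ (by simp), s1.same _ (by simp), h9]
    · intro i hi
      rw [List.length_append, List.length_singleton] at hi
      rcases Nat.lt_succ_iff_lt_or_eq.1 hi with hi' | rfl
      · obtain ⟨h13, h14⟩ := h10 i hi'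
        refine ⟨(s1.le.trans s2.le).subset h13, ?_⟩
        rw [(s1.le.trans s2.le).agree _ h13, h14, List.getElem_append_left hi']
      · refine ⟨.inr (by simp [hhp]), ?_⟩
        rw [e0]; simp
  · simpa [Cmd.run] using hw
  · simp [Cmd.run, hA]
  · simp [Cmd.run, hA]
  · simp [Cmd.run]
  · simp
  · simp only [Cmd.size, Nat.add_mul, Nat.mul_add, Nat.mul_comm w.length]
    omega
  · rintro τ ⟨S', done, -, hdone, -, -, h1, h2, h3⟩
    rw [List.append_nil] at hdone
    subst hdone
    exact ⟨h2, fun i hi => by rw [h1]; exact (h3 i hi).2⟩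

end Output

-- Collecting the accepted parses

section Collect

variable {T : Type} {G : ContextFreeGrammar T} {k : ℕ}

namespace Layout

/-- The word that lists the operations of copies. -/
def entriesWord (Λ : Layout G k) (A : List (Entry G)) : List ℕ :=
  A.flatMap fun e => e.ops.map Λ.opc ++ [0]

/-- Count the copies that have accepted, and collect their operations. -/
def collect : Cmd :=
  forEntries regCur (.ite regCode regZero
    (.seq (.inc regCount) (alloc regRoot [regRope, regZero, regRoot])) .skip)

/-- The registers that are changed by `collect`. -/
abbrev collectRegs : List ℕ := [regCur, regEnt, regCode, regRope, regCount, regRoot, regHp]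

/-- Acceptance is recognised by the code `0`. The value of the new rope node comes from the zero
register, which provides the separator `0` behind each parse. -/
theorem collect_tri (Λ : Layout G k) (t : ℕ) :
    ∃ N, ∀ (H : ℕ → StateStack G → Prop) (S : Set ℕ) (σ : Store) (L : List (Entry G)),
      HeapInv S σ → L.length ≤ t → Λ.ListAt H S σ.mem L (σ.reg regCur) →
      σ.reg regCount = 0 → σ.reg regRoot = 0 →
      collect.Tri N σ fun τ => ∃ S' A, HeapStep collectRegs S σ S' τ ∧
        A.Perm (L.filter fun e => e.virt.isNone) ∧ τ.reg regCount = A.length ∧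
        HoldsWord S' τ.mem (τ.reg regRoot) (Λ.entriesWord A) := by
  set c : Cmd := .seq (.inc regCount) (alloc regRoot [regRope, regZero, regRoot]) with hc
  set b : Cmd := .ite regCode regZero c .skip with hb
  have hlf : b.LoopFree := ⟨⟨trivial, alloc_loopFree _ _⟩, trivial⟩
  refine ⟨t * ((loadEntry regCur).size + b.size + 1 + 1) + 1, fun H S σ L h1 h2 h3 h4 h5 => ?_⟩
  refine (forEntries_tri (Λ := Λ) (H := H) (S := S) (n := b.size) (L := L)
    (fun R S' σ' => HeapStep collectRegs S σ S' σ' ∧ ∃ A : List (Entry G),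
      (A ++ R.filter fun e => e.virt.isNone).Perm (L.filter fun e => e.virt.isNone) ∧
      σ'.reg regCount = A.length ∧ HoldsWord S' σ'.mem (σ'.reg regRoot) (Λ.entriesWord A))
    (by simp) ?_ ?_ ?_ h3 ?_).mono ?_ ?_
  · rintro R S' σ' ⟨h, -⟩; exact h.inv.zero
  · rintro R S' σ' τ ⟨h, A, hp, hn, hw⟩ hm hr
    refine ⟨h.trans ((h.inv.step_regs _ hm hr (by simp) (by simp)).mono (by simp)), A, hp, ?_, ?_⟩
    · rw [hr _ (by simp)]; exact hn
    · rw [hm, hr _ (by simp)]; exact hw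
  · rintro e R S' σ' ⟨h, A, hp, hn, hw⟩ he
    refine hlf.tri ?_
    have hcode := he.code_eq
    cases hv : e.virt with
    | none =>
      have hz : σ'.reg regCode = σ'.reg regZero := by
        rw [hcode, hv, h.inv.zero]; rfl
      have hrun : b.run σ' = c.run σ' := by simp only [hb, Cmd.run, if_pos hz]
      rw [hrun]
      have s1 := h.inv.step_update regCount (σ'.reg regCount + 1) (by simp) (by simp)
      obtain ⟨S₂, s2, h6⟩ := alloc_rope (dst := regRoot) (l := regRope) (v := regZero)
        (r := regRoot) (wl := e.ops.map Λ.opc) (wr := Λ.entriesWord A) s1.inv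
        (by simpa using he.word) (by simpa using hw) (by simp) (by simp)
      have s := (s1.mono (rs' := collectRegs) (by simp)).trans (s2.mono (by simp))
      refine ⟨S₂, s.le, ?_, h.trans s, e :: A, ?_, ?_, ?_⟩
      · exact (s2.same _ (by simp)).trans (by simp)
      · refine List.Perm.trans ?_ hp
        simp only [List.filter_cons, hv, Option.isNone_none, if_true, List.cons_append]
        exact List.perm_middle.symm
      · refine (s2.same _ (by simp)).trans ?_
        simp [hn]
      · have h7 : HoldsWord S₂ (c.run σ').mem ((c.run σ').reg regRoot) _ := h6
        simpa [entriesWord, h.inv.zero] using h7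
    | some v =>
      have hz : σ'.reg regCode ≠ σ'.reg regZero := by
        rw [hcode, hv, h.inv.zero]; simp [code]
      have hrun : b.run σ' = σ' := by simp only [hb, Cmd.run, if_neg hz]
      rw [hrun]
      refine ⟨S', .refl _ _, rfl, h, A, ?_, hn, hw⟩
      simpa [List.filter_cons, hv] using hp
  · exact ⟨h1.step_refl _, [], .refl _, by simp [h4], by rw [h5]; exact holdsWord_nil _ _⟩
  · have := Nat.mul_le_mul_right ((loadEntry regCur).size + b.size + 1 + 1) h2
    omega
  · rintro τ ⟨S', h, A, hp, hn, hw⟩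
    exact ⟨S', A, h, by simpa using hp, hn, hw⟩

end Layout

end Collect

section Program

variable {T : Type} {G : ContextFreeGrammar T} {k : ℕ}

/-! ### The parsing program -/

namespace Layout

/-- Find the end of the input, and create a cell for the empty stack after it. -/
noncomputable def setup (Λ : Layout G k) : Cmd :=
  .seq (.seq (.load regTmp regHp 0) (.loop regTmp regZero
    (.seq (.inc regHp) (.load regTmp regHp 0))))
    (.seq (incBy regHp (k + 1)) (.seq (.copy regCell regHp) (.seq (.store regHp 0 regCell)
      (incBy regHp (Λ.keys.length + 1)))))

/-- Input symbols are stored increased by one, so the first zero cell is the end of the input. The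
heap begins only behind the zeros that play the role of end markers. -/
theorem setup_tri (Λ : Layout G k) (encT : T → ℕ) :
    ∃ N, ∀ x : List T, Λ.setup.Tri (N * (x.length + 1))
      ⟨fun _ => 0, inputMem (x.map encT)⟩ fun τ => ∃ S H, HeapInv S τ ∧ Λ.HeapOK H S τ.mem ∧
        InputAt encT k x S τ.mem ∧ H (τ.reg regCell) [] ∧
        ∀ r, r ∉ [regTmp, regHp, regCell] → τ.reg r = 0 := by
  set c : Cmd := .seq (incBy regHp (k + 1)) (.seq (.copy regCell regHp)
    (.seq (.store regHp 0 regCell) (incBy regHp (Λ.keys.length + 1)))) with hc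
  have hlf : c.LoopFree := ⟨incBy_loopFree _ _, trivial, trivial, incBy_loopFree _ _⟩
  have hmem : ∀ (x : List T) i, inputMem (x.map encT) i = symCode encT x[i]? := by
    intro x i
    simp only [inputMem, symCode, List.getElem?_map]
    cases x[i]? <;> simp
  refine ⟨c.size + 10, fun x => ?_⟩
  set m₀ := inputMem (x.map encT) with hm₀
  refine (Cmd.Tri.seq (n := 1 + (x.length * 4 + 1) + 1) (m := c.size) ?_).mono ?_ fun _ h => h
  · refine (Cmd.LoopFree.tri_seq (a := .load regTmp regHp 0) trivial ((Cmd.Tri.loop_list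
      (n := 3) (fun (y : List T) τ => ∃ s, y = x.drop s ∧ s ≤ x.length ∧ τ.reg regHp = s ∧
        τ.reg regTmp = m₀ s ∧ τ.mem = m₀ ∧ ∀ r, r ∉ [regTmp, regHp] → τ.reg r = 0) ?_ ?_ x _
        ⟨0, by simp, by simp, ?_, ?_, rfl, ?_⟩).mono le_rfl ?_))
    · rintro τ ⟨s, hy, hs, -, h1, -, h2⟩
      have hsl : s = x.length := by
        have := List.drop_eq_nil_iff.1 hy.symm
        omega
      rw [h1, h2 _ (by simp), hm₀, hmem, hsl]
      simp [symCode]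
    · rintro b y τ ⟨s, hy, hs, h1, h2, h3, h4⟩
      have hlt : s < x.length := by
        by_contra h
        rw [List.drop_of_length_le (by omega)] at hy
        cases hy
      rw [List.drop_eq_getElem_cons hlt] at hy
      obtain ⟨rfl, rfl⟩ := List.cons_eq_cons.1 hy
      refine ⟨?_, Cmd.LoopFree.tri (c := .seq (.inc regHp) (.load regTmp regHp 0))
        ⟨trivial, trivial⟩ ⟨s + 1, rfl, hlt, ?_, ?_, h3, ?_⟩⟩
      · rw [h2, h4 _ (by simp), hm₀, hmem]
        simp [symCode, hlt]
      · simp [Cmd.run, h1]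
      · simp [Cmd.run, h1, h3]
      · intro r hr
        have := h4 r hr
        simp only [List.mem_cons, List.not_mem_nil, or_false, not_or] at hr
        simp [Cmd.run, hr, this]
    · simp [Cmd.run]
    · simp [Cmd.run]
    · intro r hr
      simp only [List.mem_cons, List.not_mem_nil, or_false, not_or] at hr
      simp [Cmd.run, hr]
    · rintro τ ⟨s, hy, hs, h1, -, h3, h4⟩
      have hsl : s = x.length := by
        have := List.drop_eq_nil_iff.1 hy.symm
        omega
      refine hlf.tri ?_
      set E := x.length + (k + 1) with hE
      have hrun : c.run τ = ⟨Function.update (Function.update (Function.update τ.reg regHp E)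
          regCell E) regHp (E + (Λ.keys.length + 1)), Function.update m₀ E E⟩ := by
        simp [hc, Cmd.run, incBy_run, h1, hsl, h3, hE]
      have hzero : ∀ i, x.length ≤ i → m₀ i = 0 := by
        intro i hi
        rw [hm₀, hmem, List.getElem?_eq_none hi]; rfl
      rw [hrun]
      -- The cell of the empty stack is its own parent and its rows are zero, that is, empty lists;
      -- pointers that run past the bottom of a stack stay here and find nothing.
      refine ⟨{i | i < E + (Λ.keys.length + 1)}, fun c st => c = E ∧ st = [], ⟨?_, ?_, ?_⟩,
        ?_, ?_, ?_, ?_⟩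
      · simpa using h4 regZero (by simp)
      · simp
      · intro i hi
        simpa using hi
      · rintro _ _ ⟨rfl, rfl⟩
        refine ⟨.inl rfl, ?_, ?_, fun κ hκ => ⟨?_, [], ?_, by simp, ?_⟩⟩
        · simp
        · simp
        · have : Λ.pos κ < Λ.keys.length := by
            classical
            rw [pos]; convert List.idxOf_lt_length_of_mem hκ
          simp only [Set.mem_ofPred_eq]
          omega
        · change Function.update m₀ E E (E + (Λ.pos κ + 1)) = 0
          rw [Function.update_of_ne (by omega)]
          exact hzero _ (by omega)
        · rintro ρ res
          refine ⟨?_, by simp⟩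
          rintro ⟨-, q, st', h, -⟩
          simp at h
      · intro i hi
        refine ⟨?_, ?_⟩
        · simp only [Set.mem_ofPred_eq]; omega
        · change Function.update m₀ E E i = _
          rw [Function.update_of_ne (by omega), hm₀, hmem]
      · simp
      · intro r hr
        have := h4 r (by simp only [List.mem_cons, List.not_mem_nil, or_false, not_or] at hr ⊢
                         exact ⟨hr.1, hr.2.1⟩)
        simp only [List.mem_cons, List.not_mem_nil, or_false, not_or] at hr
        simp [hr, this]
  · simp only [Nat.add_mul, Nat.mul_add]
    omega

/-- Compute the copies before the first input symbol is read. -/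
noncomputable def startCopies (Λ : Layout G k) (encT : T → ℕ) (opts : List (Option T)) : Cmd :=
  .seq (.copy regBase regCell) (.seq (withWindow opts (symCode encT) k 0 [] fun l =>
    Λ.genList l (vouts G k (dfaStart G k) l []))
    (.seq (.copy regCur regOut) (.load regTmp regInput 0)))

/-- The first reductions run directly on the bottom state, with no symbol pushed above it. Their
outcomes are selected by the first `k` symbols of the input. -/
theorem startCopies_tri (hG : StartNormal G) {t : ℕ} (hX : IsXLR G k t) (Λ : Layout G k)
    {encT : T → ℕ} (henc : Function.Injective encT) {opts : List (Option T)}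
    (hopts : ∀ a, a ∈ opts) :
    ∃ N, ∀ (H : ℕ → StateStack G → Prop) (S : Set ℕ) (σ : Store) (x : List T),
      HeapInv S σ → Λ.HeapOK H S σ.mem → InputAt encT k x S σ.mem →
      H (σ.reg regCell) [dfaStart G k] → σ.reg regInput = 0 →
      (Λ.startCopies encT opts).Tri N σ fun τ => ∃ S',
        HeapStep (regTmp :: regSel :: regCur :: regBase :: genRegs) S σ S' τ ∧
        (∃ L, Λ.ListAt H S' τ.mem L (τ.reg regCur) ∧ ListSpec L (CopyAt G k x 0)) ∧
        τ.reg regTmp = τ.mem 0 := by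
  have hpop : ∀ l, ∀ o ∈ vouts G k (dfaStart G k) l [], ∀ d X, o.2 = .pop d X → 0 < d :=
    fun l o ho d X hd => ((vred_of_mem_vouts ho).pop_spec hG (st := []) isStack_start hd).2.1
  obtain ⟨N, hN⟩ := exists_common_bound (P := fun (κ : Symbol T G.NT × List (Option T)) N =>
    ∀ (H : ℕ → StateStack G → Prop) (S : Set ℕ) (σ : Store) (base : StateStack G)
      (tab : ℕ → G.NT → List (Entry G)), HeapInv S σ →
      H (σ.reg regBase) base → (∀ d X, (tab d X).length ≤ t) →
      Λ.TabAt H κ.2 tab (σ.reg regBase) S σ.mem →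
      (Λ.genList κ.2 (vouts G k (dfaStart G k) κ.2 [])).Tri N σ fun τ => ∃ S',
        HeapStep genRegs S σ S' τ ∧ ∃ L, L.Perm ((vouts G k (dfaStart G k) κ.2 []).flatMap
          (outEntries base tab)) ∧ Λ.ListAt H S' τ.mem L (τ.reg regOut)) Λ.keys fun κ hκ => by
    obtain ⟨N, hN⟩ := genList_tri (Λ := Λ) t κ.2 (vouts G k (dfaStart G k) κ.2 [])
      (Λ.mem_pending_start κ.2 ((Λ.mem_keys κ.1 κ.2).1 hκ)) (hpop κ.2)
    exact ⟨N, fun n hn H S σ base tab h1 h2 h3 h4 =>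
      (hN H S σ base tab h1 h2 h3 h4).mono hn fun _ h => h⟩
  set c : Cmd := .seq (.copy regCur regOut) (.load regTmp regInput 0) with hc
  have hlf : c.LoopFree := ⟨trivial, trivial⟩
  refine ⟨1 + (k * (opts.length * 3 + 3) + N + c.size + 1) + 1,
    fun H S σ x h1 h2 h3 h4 h5 => ?_⟩
  have s0 := h1.step_update regBase (σ.reg regCell) (by simp) (by simp)
  set σ₀ : Store := ⟨Function.update σ.reg regBase (σ.reg regCell), σ.mem⟩ with hσ₀
  have hl := lookahead_length k x
  refine Cmd.LoopFree.tri_seq (a := .copy regBase regCell) trivial (Cmd.Tri.seq ?_)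
  have hwin := withWindow_tri hopts (symCode_injective henc) (N := N)
    (body := fun l => Λ.genList l (vouts G k (dfaStart G k) l []))
    (Q := fun τ => ∃ S', HeapStep (regTmp :: regSel :: regCur :: regBase :: genRegs) S σ S' τ ∧
        ∃ L, Λ.ListAt H S' τ.mem L (τ.reg regOut) ∧ ListSpec L (CopyAt G k x 0))
    (lookahead k x) 0 [] σ₀ ?_ ?_
  · rw [hl] at hwin
    refine hwin.mono le_rfl ?_
    rintro τ ⟨S', s1, L, h6, h7⟩
    refine hlf.tri ?_
    have s2 : HeapStep [regCur, regTmp] S' τ S' (c.run τ) :=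
      s1.inv.step_regs _ rfl (fun r hr => by
        simp only [List.mem_cons, List.not_mem_nil, or_false, not_or] at hr
        simp [hc, Cmd.run, hr]) (by simp) (by simp)
    refine ⟨S', s1.trans (s2.mono (by simp)), ⟨L, by simpa [hc, Cmd.run] using h6, h7⟩, ?_⟩
    have : τ.reg regInput = 0 := by rw [s1.same _ (by simp), h5]
    simp [hc, Cmd.run, this]
  · intro i hi
    rw [hl] at hi
    have : σ₀.reg regInput = 0 := by simp [hσ₀, h5]
    rw [this, Nat.zero_add, Nat.zero_add, (h3 i (by omega)).2, lookahead_getElem]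
  · intro τ hm hr
    have s1 := s0.inv.step_regs [regTmp, regSel] hm hr (by simp) (by simp)
    have hcell := h2 _ _ h4
    have hb : τ.reg regBase = σ.reg regCell := by
      rw [hr _ (by simp)]; simp [hσ₀]
    have hm' : τ.mem = σ.mem := hm
    obtain ⟨tab, ht1, ht2, ht3⟩ := h2.exists_tab hG hX le_rfl hcell.mem hcell.parent
      (dfaStart G k) hl
    refine (hN (.nonterminal G.initial, lookahead k x) ((Λ.mem_keys _ _).2 hl) H S τ
      [dfaStart G k] tab s1.inv (by rw [hb]; exact h4) ht2 (by rw [hb, hm']; exact ht1)).mono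
      le_rfl ?_
    rintro υ ⟨S', s2, L, hp, hL⟩
    have hspec := listSpec_vouts hG hX hl (q := dfaStart G k) (st := []) (v := [])
      isStack_start (fun d X hd _ => ht3 d X hd)
    refine ⟨S', ((s0.mono (by simp)).trans (s1.mono (by simp))).trans (s2.mono (by simp)), L, hL,
      ((hp.map _).nodup_iff).2 hspec.1, fun ρ res => ?_⟩
    rw [copyAt_zero hG, ← List.nil_append [dfaStart G k], hspec.2]
    simp only [hp.mem_iff]

/-- The parsing program. -/
noncomputable def parser (Λ : Layout G k) (encT : T → ℕ) (opts : List (Option T)) : Cmd :=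
  .seq Λ.setup (.seq (Λ.push (dfaStart G k)) (.seq (Λ.startCopies encT opts)
    (.seq (Λ.readInput encT opts) (.seq collect (.seq (.set regOut 0) (.seq flatten emitWord))))))

/-- Setup, reading, flattening and output are linear in the length of the input, the rest takes
constant time. The output word is linear because there are at most `t` parses, each of them linear
by `hB`. -/
theorem parser_tri (hG : StartNormal G) {t : ℕ} (hX : IsXLR G k t) (Λ : Layout G k)
    {encT : T → ℕ} (henc : Function.Injective encT) {opts : List (Option T)}
    (hopts : ∀ a, a ∈ opts) {B : ℕ}
    (hB : ∀ x p, IsLRParse G x p → p.length ≤ B * (x.length + 1)) :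
    ∃ N, ∀ x : List T, (Λ.parser encT opts).Tri (N * (x.length + 1))
      ⟨fun _ => 0, inputMem (x.map encT)⟩ fun τ => ∃ A : List (Entry G),
        ((A.map Entry.ops).Nodup ∧ ∀ p, p ∈ A.map Entry.ops ↔ IsLRParse G x p) ∧
        τ.reg regCount = A.length ∧
        ∀ i (hi : i < (Λ.entriesWord A).length),
          τ.mem (τ.reg regAddr + i) = (Λ.entriesWord A)[i] := by
  obtain ⟨N₁, hN₁⟩ := setup_tri Λ encT
  obtain ⟨N₂, hN₂⟩ := push_tri hG hX Λ (dfaStart G k)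
  obtain ⟨N₃, hN₃⟩ := startCopies_tri hG hX Λ henc hopts
  obtain ⟨N₄, hN₄⟩ := readInput_tri hG hX Λ henc hopts
  obtain ⟨N₅, hN₅⟩ := collect_tri Λ t
  obtain ⟨N₆, hN₆⟩ := flatten_tri
  obtain ⟨N₇, hN₇⟩ := emitWord_tri
  set D := t * (B + 1) with hD
  refine ⟨N₁ + N₂ + N₃ + N₄ + N₅ + 2 * D * N₆ + N₇ * (D + 1) + 10, fun x => ?_⟩
  set n := x.length + 1 with hn
  refine (Cmd.Tri.seq (n := N₁ * n) (m := N₂ + (N₃ + (N₄ * n + (N₅ + (1 +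
    (2 * (D * n) * N₆ + 1 + N₇ * (D * n + 1) + 1) + 1) + 1) + 1) + 1) + 1) ?_).mono ?_
    fun _ h => h
  swap
  · have h1 : N₂ + N₃ + N₅ + N₇ + 8 ≤ (N₂ + N₃ + N₅ + N₇ + 8) * n :=
      Nat.le_mul_of_pos_right _ (by omega)
    have h2 : 2 * (D * n) * N₆ = 2 * D * N₆ * n := by ring
    have h3 : N₇ * (D * n + 1) = N₇ * D * n + N₇ := by ring
    rw [h2, h3]
    have h4 : (N₁ + N₂ + N₃ + N₄ + N₅ + 2 * D * N₆ + N₇ * (D + 1) + 10) * n =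
        N₁ * n + N₄ * n + 2 * D * N₆ * n + N₇ * D * n + (N₂ + N₃ + N₅ + N₇ + 8) * n + 2 * n := by
      ring
    rw [h4]
    omega
  refine (hN₁ x).mono le_rfl ?_
  rintro σ₁ ⟨S₁, H₁, i1, ok1, in1, c1, z1⟩
  refine Cmd.Tri.seq ((hN₂ H₁ S₁ σ₁ [] i1 ok1 c1 isStack_start).mono le_rfl ?_)
  rintro σ₂ ⟨S₂, H₂, s2, -, ok2, c2⟩
  have in2 := in1.mono s2.le
  have hz2 : ∀ r, r ∉ [regTmp, regHp, regCell] → r ∉ pushRegs → σ₂.reg r = 0 := fun r hr hr' => by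
    rw [s2.same _ hr', z1 _ hr]
  refine Cmd.Tri.seq ((hN₃ H₂ S₂ σ₂ x s2.inv ok2 in2 c2 (hz2 _ (by simp) (by simp))).mono
    le_rfl ?_)
  rintro σ₃ ⟨S₃, s3, ⟨L₃, l3, sp3⟩, t3⟩
  have in3 := in2.mono s3.le
  refine Cmd.Tri.seq ((hN₄ H₂ S₃ σ₃ L₃ x s3.inv (ok2.mono s3.le) in3 l3 sp3
    (by rw [s3.same _ (by simp)]; exact hz2 _ (by simp) (by simp)) t3).mono le_rfl ?_)
  rintro σ₄ ⟨S₄, H₄, s4, ok4, L₄, l4, sp4⟩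
  have hz4 : ∀ r, r ∉ [regTmp, regHp, regCell] → r ∉ pushRegs →
      r ∉ regTmp :: regSel :: regCur :: regBase :: genRegs → r ∉ loopRegs → σ₄.reg r = 0 := by
    intro r h1 h2 h3 h4
    rw [s4.same _ h4, s3.same _ h3, hz2 _ h1 h2]
  refine Cmd.Tri.seq ((hN₅ H₄ S₄ σ₄ L₄ s4.inv (sp4.length_le_of_copyAt hG hX) l4
    (hz4 _ (by simp) (by simp) (by simp) (by simp))
    (hz4 _ (by simp) (by simp) (by simp) (by simp))).mono le_rfl ?_)
  rintro σ₅ ⟨S₅, A, s5, hp, hcount, tr, r5, hword⟩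
  have hparse : ∀ p, p ∈ A.map Entry.ops ↔ IsLRParse G x p := by
    intro p
    rw [← copyAt_length_none hG, sp4.2, (hp.map Entry.ops).mem_iff]
    simp only [List.mem_map, List.mem_filter, and_assoc, Option.isNone_iff_eq_none]
    refine exists_congr fun e => and_congr_right fun _ => ?_
    rw [and_comm, Entry.res, Option.map_eq_none_iff]
  -- In `D = t * (B + 1)` the added `1` pays for the separators.
  have hlen : (Λ.entriesWord A).length ≤ D * n := by
    have h1 : A.length ≤ t := by
      rw [hp.length_eq]
      exact (List.length_filter_le _ _).trans (sp4.length_le_of_copyAt hG hX)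
    have h2 : ∀ A' : List (Entry G), (∀ e ∈ A', IsLRParse G x e.ops) →
        (Λ.entriesWord A').length ≤ A'.length * ((B + 1) * n) := by
      intro A' hA'
      induction A' with
      | nil => simp [entriesWord]
      | cons e A' ih =>
        have h3 := ih fun e he => hA' e (by simp [he])
        have h4 := hB x e.ops (hA' e (by simp))
        simp only [entriesWord, List.flatMap_cons, List.length_append, List.length_map,
          List.length_cons, List.length_nil] at h3 ⊢
        have h5 : (B + 1) * n = B * n + n := by ring
        rw [← hn] at h4
        rw [Nat.add_mul A'.length, Nat.one_mul]
        omega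
    calc (Λ.entriesWord A).length ≤ A.length * ((B + 1) * n) :=
          h2 A fun e he => (hparse _).1 (List.mem_map_of_mem he)
      _ ≤ t * ((B + 1) * n) := Nat.mul_le_mul_right _ h1
      _ = D * n := by rw [hD]; ring
  have s6 := s5.inv.step_update regOut 0 (by simp) (by simp)
  refine Cmd.LoopFree.tri_seq (a := .set regOut 0) trivial (Cmd.Tri.seq ?_)
  refine (hN₆ (2 * (D * n)) S₅ _ tr [] ?_ s6.inv (by simpa using r5)
    (by simp [WordAt])).mono le_rfl ?_
  · rw [Rope.size_eq, hword]; omega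
  rintro σ₇ ⟨S₇, s7, w7⟩
  rw [List.append_nil, hword] at w7
  refine (hN₇ S₇ σ₇ _ s7.inv w7).mono (Nat.mul_le_mul_left _ (by omega)) ?_
  rintro τ ⟨h8, h9⟩
  refine ⟨A, ⟨?_, hparse⟩, ?_, h9⟩
  · rw [(hp.map _).nodup_iff]
    exact sp4.1.sublist ((List.filter_sublist).map _)
  · rw [h8, s7.same _ (by simp), s6.same _ (by simp), hcount]

end Layout

/-! ### Parsing in linear time -/

/-- There are finitely many states, symbols and lookaheads, and each combination has a finite list
of outcomes; so only finitely many lists of pending states occur. -/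
theorem exists_layout [Finite T] [Finite G.NT] (hG : StartNormal G)
    (opc : LROp T G.NT → ℕ) : ∃ Λ : Layout G k, Λ.opc = opc := by
  have hkeys : {κ : Symbol T G.NT × List (Option T) | κ.2.length = k}.Finite := by
    have : Finite (Symbol T G.NT) :=
      Finite.of_injective (β := T ⊕ G.NT) (fun s => match s with
        | .terminal a => .inl a
        | .nonterminal X => .inr X) (by
        rintro (a | X) (b | Y) h <;> simp_all)
    refine ((Set.finite_univ (α := Symbol T G.NT)).prod
      (List.finite_length_eq (Option T) k)).subset ?_
    rintro ⟨s, l⟩ h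
    exact ⟨trivial, h⟩
  have hpend : ∀ os : List (List (LROp T G.NT) × VOut G),
      {v | ∃ o ∈ os, o.2 = .ready v}.Finite := by
    intro os
    refine Set.Finite.subset ((os.map fun o => match o.2 with
      | .ready v => v
      | _ => []).finite_toSet) ?_
    rintro v ⟨o, ho, hv⟩
    exact List.mem_map.2 ⟨o, ho, by rw [hv]⟩
  have hp₁ : (⋃ q ∈ Set.range (lrNFA G k).eval, ⋃ κ ∈ hkeys.toFinset,
      {v | ∃ o ∈ tableOuts G k q κ.1 κ.2, o.2 = .ready v}).Finite :=
    (states_finite hG).biUnion fun q _ => hkeys.toFinset.finite_toSet.biUnion fun κ _ => hpend _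
  have hp₂ : (⋃ κ ∈ hkeys.toFinset,
      {v | ∃ o ∈ vouts G k (dfaStart G k) κ.2 [], o.2 = .ready v}).Finite :=
    hkeys.toFinset.finite_toSet.biUnion fun κ _ => hpend _
  refine ⟨⟨hkeys.toFinset.toList, (hp₁.union hp₂).toFinset.toList, opc, fun Y l => by simp,
    fun q Y l hl o ho v hv => ?_, fun l hl o ho v hv => ?_⟩, rfl⟩
  · rw [Finset.mem_toList, Set.Finite.mem_toFinset]
    refine .inl (Set.mem_biUnion (x := q) ?_ (Set.mem_biUnion (x := (Y, l)) (by simpa using hl)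
      ⟨o, ho, hv⟩))
    rw [tableOuts] at ho
    split_ifs at ho with h
    · obtain ⟨-, st, hst⟩ := h
      exact hst.eval_mem
    · simp at ho
  · rw [Finset.mem_toList, Set.Finite.mem_toFinset]
    exact .inr (Set.mem_biUnion (x := (.nonterminal G.initial, l)) (by simpa using hl)
      ⟨o, ho, hv⟩)

/-- The accepted copies give each LR parse once, and a tree is chosen for each parse. Injectivity of
postorder ensures that no tree is missed. The length of a parse is bounded by the bound on runs, as
a parse is the operation sequence of a successful run. -/
theorem linearTimeParsable [Finite T] [Finite G.NT] (hG : StartNormal G) {t : ℕ}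
    (hX : IsXLR G k t) : LinearTimeParsable G := by
  intro encT encR hT _
  obtain ⟨Λ, hΛ⟩ := exists_layout (k := k) hG (opCode encT encR)
  obtain ⟨opts, hopts⟩ : ∃ opts : List (Option T), ∀ a, a ∈ opts :=
    ⟨(Set.finite_univ (α := Option T)).toFinset.toList, by simp⟩
  obtain ⟨B, hB⟩ := exists_run_bound hG hX
  obtain ⟨N, hN⟩ := Λ.parser_tri hG hX hT hopts (B := B) (by
    rintro x p ⟨P, hP, rfl⟩
    exact hB x _ _ ((run_success_iff hG x _ P).2 ⟨hP, rfl⟩))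
  refine ⟨(Λ.parser encT opts).compile, N, fun x => ?_⟩
  obtain ⟨A, ⟨hnd, hmem⟩, hout⟩ := (hN x).outputs
  obtain ⟨L, hL⟩ : A.map Entry.ops ∈ Set.range (List.map
      fun P : {P // IsParseTree G x P} => P.1.postorder) := by
    rw [Set.range_list_map]
    intro p hp
    obtain ⟨P, hP, rfl⟩ := (hmem p).1 hp
    exact ⟨⟨P, hP⟩, rfl⟩
  have hpost : (L.map Subtype.val).map ParseTree.postorder = A.map Entry.ops := by
    rw [← hL, List.map_map]; rfl
  refine ⟨L.map Subtype.val, ?_, fun P => ⟨fun hP => ?_, fun hP => ?_⟩, ?_⟩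
  · rw [← hpost] at hnd
    exact hnd.of_map _
  · obtain ⟨P', -, rfl⟩ := List.mem_map.1 hP
    exact P'.2
  · have h := (hmem P.postorder).2 ⟨P, hP, rfl⟩
    rw [← hpost] at h
    obtain ⟨P', hP', heq⟩ := List.mem_map.1 h
    obtain ⟨P'', -, rfl⟩ := List.mem_map.1 hP'
    rwa [← P''.2.1.postorder_injective hP.1 heq]
  · have hlen : (L.map Subtype.val).length = A.length := by
      rw [← List.length_map (f := ParseTree.postorder), hpost, List.length_map]
    have hword : treesCode encT encR (L.map Subtype.val) = Λ.entriesWord A := by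
      rw [treesCode, Layout.entriesWord, hΛ,
        ← List.flatMap_map Entry.ops (fun p => p.map (opCode encT encR) ++ [0]), ← hpost]
      simp only [List.flatMap_map]
    rw [hlen, hword]
    exact hout

end Program

end XLR

theorem mainTheorem3 {T : Type} [Finite T] (G : ContextFreeGrammar T) [Finite G.NT]
    (hG : XLR.StartNormal G) (k t : ℕ) (hX : XLR.IsXLR G k t) :
    -- the grammar can be parsed in linear time
    XLR.LinearTimeParsable G ∧
    -- the successful runs of the stack-based XLR algorithm are exactly the parse trees of the input
    (∀ (x : List T) (p : List (XLR.LROp T G.NT)) (P : XLR.ParseTree T G.NT),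
      XLR.Run G k x p (.success P) ↔ XLR.IsParseTree G x P ∧ p = P.postorder) ∧
    -- each copy performs linearly many operations
    (∃ C : ℕ, ∀ (x : List T) (p : List (XLR.LROp T G.NT)) (o : XLR.Outcome G),
      XLR.Run G k x p o → p.length ≤ C * (x.length + 1)) ∧
    ∀ (x : List T) (s : ℕ), s ≤ x.length →
      -- partial LR parses with the current lookahead correspond to runs about to shift, or to runs
      -- that have just completed a parse
      (∀ p : List (XLR.LROp T G.NT),
        XLR.IsPartialLRParse G k (x.take s) (XLR.lookahead k (x.drop s)) p ↔
          XLR.ShiftReadyAt G k x s p ∨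
            (XLR.lookahead k (x.drop s) = List.replicate k none ∧ XLR.IsLRParse G (x.take s) p ∧
              ∃ o, XLR.Run G k x p o)) ∧
      -- every live copy has performed an initial part of such a partial LR parse
      (∀ p : List (XLR.LROp T G.NT), XLR.LiveAt G k x s p →
        ∃ q, p <+: q ∧
          XLR.IsPartialLRParse G k (x.take s) (XLR.lookahead k (x.drop s)) q) ∧
      -- at most `t` live copies, none of which is a continuation of another, share a cursor position
      (∀ F : Finset (List (XLR.LROp T G.NT)), (∀ p ∈ F, XLR.LiveAt G k x s p) →
        (∀ p ∈ F, ∀ q ∈ F, p <+: q → p = q) → F.card ≤ t) := by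
  exact ⟨XLR.linearTimeParsable hG hX, fun x p P => XLR.run_success_iff hG x p P,
    XLR.exists_run_bound hG hX, fun x s _ => ⟨fun p => XLR.isPartialLRParse_iff hG p,
      fun p h => XLR.exists_isPartial_of_liveAt hG h,
      fun F h1 h2 => XLR.card_liveAt_le hG hX F h1 h2⟩⟩
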